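/- **Setting.** Let $\mathbb N=\{1,2,\dots\}$, $\mathbb D=\{|z|<1\}$, and let $\Omega_\Psi$ be the set of bounded operators $A$ on $\ell^2(\mathbb Z)$ whose matrix $(a_{i,j})$ is tridiagonal, with $\alpha_j=a_{j+1,j}$, $\beta_j=a_{j,j}$, $\gamma_j=a_{j-1,j}$, and which are pseudoergodic: there are nonempty compact $\Sigma_\alpha,\Sigma_\beta,\Sigma_\gamma\subset\mathbb C$ with $\alpha_j\in\Sigma_\alpha$, $\beta_j\in\Sigma_\beta$, $\gamma_j\in\Sigma_\gamma$ for all $j\in\mathbb Z$ such that for all $\varepsilon>0$, $n\in\mathbb N$ and every $n\times n$ tridiagonal matrix $B$ with subdiagonal, diagonal, superdiagonal entries in $\Sigma_\alpha,\Sigma_\beta,\Sigma_\gamma$, respectively, some principal submatrix $(a_{i,j})_{i,j=k+1}^{k+n}$, $k\in\mathbb Z$, is within operator-norm distance less than $\varepsilon$ of $B$. Then necessarily $\Sigma_\alpha=\overline{\{\alpha_j:j\in\mathbb Z\}}$, and likewise for $\Sigma_\beta,\Sigma_\gamma$. Write $\operatorname{Spec}_\varepsilon A=\{\lambda:\|(A-\lambda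 I)^{-1}\|^{-1}\le\varepsilon\}$ (the left side being $0$ if $\lambda\in\operatorname{Spec}A$), $\nu(B)=\inf_{\|x\|=1}\|Bx\|$, and $d_H$ for the Hausdorff distance; $\to$ between sets is convergence in $d_H$. **Inputs.** Let $\mathcal B:A\mapsto(\alpha_{\max},\beta_{\max},\gamma_{\max})\in\mathbb R^3$ satisfy $\alpha_{\max}\ge\|\alpha\|_\infty$, $\beta_{\max}\ge\|\beta\|_\infty$, $\gamma_{\max}\ge\|\gamma\|_\infty$ and $R:=\alpha_{\max}+\beta_{\max}+\gamma_{\max}>0$, and let $\mathcal E:(A,n)\mapsto(\Sigma^n_\alpha,\Sigma^n_\beta,\Sigma^n_\gamma)$, $n\in\mathbb N$, give finite sets $\Sigma^n_G\subset\Sigma_G$ with $d_H(\Sigma_G,\Sigma^n_G)\le\frac1{3n}$, $G\in\{\alpha,\beta,\gamma\}$ (presented as lists). Fix $t\in\mathbb C$ with $|t|=1$. Let $S_n$ be the finite set of $n\times n$ matrices $M+N$ with $M$ tridiagonal with subdiagonal, diagonal, superdiagonal entries in $\Sigma^n_\alpha,\Sigma^n_\beta,\Sigma^n_\gamma$, and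 $N_{i,j}=\delta_{i,1}\delta_{j,n}\,t\hat\alpha+\delta_{i,n}\delta_{j,1}\,\bar t\hat\gamma$ for some $\hat\alpha\in\Sigma^n_\alpha$, $\hat\gamma\in\Sigma^n_\gamma$. With $\varepsilon_n^\dagger:=(\alpha_{\max}+\gamma_{\max})\frac{22}{7n}$ put $$\Pi^n_{\rm fin}(A):=\Big\{\lambda\in\tfrac1n(\mathbb Z+\mathrm i\mathbb Z)\cap R\,\mathbb D:\ \min_{B\in S_n}\nu(B-\lambda I_n)\le\varepsilon_n^\dagger+\tfrac3n\Big\},\qquad \widehat\Pi^n_{\rm fin}(A):=\Pi^n_{\rm fin}(A)+\tfrac2n\overline{\mathbb D}.$$ **Proposition.** (i) There is one program (exact real arithmetic operations and order comparisons, Blum–Shub–Smale style, with built-in number $1$ only) that, for all such $t,\mathcal B,\mathcal E$, all $A\in\Omega_\Psi$ and all $n\in\mathbb N$, given $n$, $t$, $\mathcal B(A)$ and $\mathcal E(A,n)$, halts after finitely many operations and returns the list of elements of the finite set $\Pi^n_{\rm fin}(A)$. (ii) For every $A\in\Omega_\Psi$, $\Pi^n_{\rm fin}(A)\to\operatorname{Spec}A$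 and $\widehat\Pi^n_{\rm fin}(A)\to\operatorname{Spec}A$ as $n\to\infty$, and for every $n\in\mathbb N$ $$\operatorname{Spec}A\ \subset\ \widehat\Pi^n_{\rm fin}(A)\ \subset\ \operatorname{Spec}_{\varepsilon_n^\dagger+3/n}A+\tfrac2n\overline{\mathbb D}.$$ (iii) Consider the computational problem of determining $A\mapsto\operatorname{Spec}A$, $A\in\Omega_\Psi$, among nonempty compact sets with the Hausdorff metric, from the evaluations $\mathcal B$ and $\mathcal E(\cdot,n)$, $n\in\mathbb N$. Here an arithmetic tower of height one is a single program with finitely many real constants which, given $n$ and oracle access to the evaluations of $A$, returns after finitely many operations a finite string $(r,z_1,\dots,z_m)$, $r\ge0$, $m\ge1$, specifying the set $\bigcup_i(z_i+r\overline{\mathbb D})$. Both $\Pi^n_{\rm fin}$ and $\widehat\Pi^n_{\rm fin}$ are such towers; the problem is in the class $\Pi_1^A$ (some convergent arithmetic tower $\Gamma_n$ admits compact $X_n(A)\supset\operatorname{Spec}A$ with $d_H(X_n(A),\Gamma_n(A))\le2^{-n}$), and its arithmetic solvability complexity index equals one (a convergent tower of height one exists, but no program of this kind, without the input $n$, returns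 a string specifying exactly $\operatorname{Spec}A$ for every $A\in\Omega_\Psi$). (iv) The convergence is uniform: for all $\Sigma_\alpha,\Sigma_\beta,\Sigma_\gamma\subset\mathbb C$ and $C\in\mathbb R$ there is a sequence $\delta_n\to0$ such that, for all $t,\mathcal B,\mathcal E$ as above, all $A$ pseudoergodic with respect to $\Sigma_\alpha,\Sigma_\beta,\Sigma_\gamma$ with $\alpha_{\max}+\gamma_{\max}\le C$, and all $n\in\mathbb N$, both $d_H(\Pi^n_{\rm fin}(A),\operatorname{Spec}A)\le\delta_n$ and $d_H(\widehat\Pi^n_{\rm fin}(A),\operatorname{Spec}A)\le\delta_n$. -/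

import Mathlib

open Filter Topology
open scoped ENNReal

noncomputable section

namespace TridiagSpec

/-! ### Tridiagonal operators on the space of square summable bi-infinite sequences -/

/-- The Hilbert space of square summable complex sequences indexed by the integers. -/
abbrev E : Type := lp (fun _ : ℤ => ℂ) 2

/-- The matrix entry in row `i` and column `j` of a bounded operator. -/
def entry (A : E →L[ℂ] E) (i j : ℤ) : ℂ := (A (lp.single 2 j (1 : ℂ))) i

/-- The matrix of `A` is tridiagonal. -/
def IsTridiagonal (A : E →L[ℂ] E) : Prop := ∀ i j : ℤ, 1 < |i - j| → entry A i j = 0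

/-- The subdiagonal entries `α j`. -/
def subdiag (A : E →L[ℂ] E) (j : ℤ) : ℂ := entry A (j + 1) j

/-- The diagonal entries `β j`. -/
def diagonal (A : E →L[ℂ] E) (j : ℤ) : ℂ := entry A j j

/-- The superdiagonal entries `γ j`. -/
def superdiag (A : E →L[ℂ] E) (j : ℤ) : ℂ := entry A (j - 1) j

/-- The principal submatrix of `A` with rows and columns `k + 1, …, k + n`. -/
def finiteSection (A : E →L[ℂ] E) (n : ℕ) (k : ℤ) : Matrix (Fin n) (Fin n) ℂ :=
  Matrix.of fun i j => entry A (k + 1 + (i : ℕ)) (k + 1 + (j : ℕ))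

/-- The operator on Euclidean space given by a square matrix. -/
abbrev matOp {n : ℕ} (M : Matrix (Fin n) (Fin n) ℂ) :
    EuclideanSpace ℂ (Fin n) →L[ℂ] EuclideanSpace ℂ (Fin n) :=
  Matrix.toEuclideanCLM (n := Fin n) (𝕜 := ℂ) M

/-- The `n × n` tridiagonal matrices with subdiagonal entries in `Sα`, diagonal entries in `Sβ`,
and superdiagonal entries in `Sγ`. -/
def tridiagMatrices (n : ℕ) (Sα Sβ Sγ : Set ℂ) : Set (Matrix (Fin n) (Fin n) ℂ) :=
  {M | ∀ i j : Fin n,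
    ((i : ℕ) = j + 1 → M i j ∈ Sα) ∧ (i = j → M i j ∈ Sβ) ∧ ((j : ℕ) = i + 1 → M i j ∈ Sγ) ∧
    ((i : ℕ) ≠ j + 1 → i ≠ j → (j : ℕ) ≠ i + 1 → M i j = 0)}

/-- The corner matrices used for periodisation: top right entry `t a` with `a ∈ Sα`, bottom left
entry `conj t * c` with `c ∈ Sγ` (for `n = 1` the two corners coincide and the entries add up). -/
def cornerMatrices (n : ℕ) (t : ℂ) (Sα Sγ : Set ℂ) : Set (Matrix (Fin n) (Fin n) ℂ) :=
  {M | ∃ a ∈ Sα, ∃ c ∈ Sγ, ∀ i j : Fin n, M i j =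
    (if (i : ℕ) = 0 ∧ (j : ℕ) + 1 = n then t * a else 0) +
    (if (i : ℕ) + 1 = n ∧ (j : ℕ) = 0 then (starRingEnd ℂ) t * c else 0)}

/-- Periodised `n × n` tridiagonal matrices with entries from the three given sets. -/
def periodisedMatrices (n : ℕ) (t : ℂ) (Sα Sβ Sγ : Set ℂ) : Set (Matrix (Fin n) (Fin n) ℂ) :=
  Set.image2 (fun M N => M + N) (tridiagMatrices n Sα Sβ Sγ) (cornerMatrices n t Sα Sγ)

/-- Pseudoergodicity (Davies) with respect to three nonempty compact sets. -/
structure PseudoergodicWrt (A : E →L[ℂ] E) (Sα Sβ Sγ : Set ℂ) : Prop where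
  tridiagonal : IsTridiagonal A
  compact : IsCompact Sα ∧ IsCompact Sβ ∧ IsCompact Sγ
  nonempty : Sα.Nonempty ∧ Sβ.Nonempty ∧ Sγ.Nonempty
  entries_mem : ∀ j : ℤ, subdiag A j ∈ Sα ∧ diagonal A j ∈ Sβ ∧ superdiag A j ∈ Sγ
  approx : ∀ ε : ℝ, 0 < ε → ∀ n : ℕ, 0 < n → ∀ B ∈ tridiagMatrices n Sα Sβ Sγ,
    ∃ k : ℤ, ‖matOp (finiteSection A n k - B)‖ < ε

/-- The set of all pseudoergodic tridiagonal operators. -/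
def PsErg : Type := {A : E →L[ℂ] E // ∃ Sα Sβ Sγ : Set ℂ, PseudoergodicWrt A Sα Sβ Sγ}

/-- The closure of the set of subdiagonal entries. -/
def PsErg.Sα (A : PsErg) : Set ℂ := closure (Set.range (subdiag A.1))

/-- The closure of the set of diagonal entries. -/
def PsErg.Sβ (A : PsErg) : Set ℂ := closure (Set.range (diagonal A.1))

/-- The closure of the set of superdiagonal entries. -/
def PsErg.Sγ (A : PsErg) : Set ℂ := closure (Set.range (superdiag A.1))

/-- The spectrum, as a map from pseudoergodic operators to sets. -/
def Spec (A : PsErg) : Set ℂ := spectrum ℂ A.1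

/-- The closed `ε`-pseudospectrum. At spectral points `resolvent` is `0`, hence so is the inverse
of its norm: this is the usual convention that the norm of the resolvent is infinite there. -/
def closedPseudospectrum (ε : ℝ) (A : E →L[ℂ] E) : Set ℂ := {z | ‖resolvent A z‖⁻¹ ≤ ε}

/-- The lower norm `inf {‖T x‖ : ‖x‖ = 1}` of a square matrix. -/
def lowerNorm {n : ℕ} (M : Matrix (Fin n) (Fin n) ℂ) : ℝ :=
  sInf {r : ℝ | ∃ x : EuclideanSpace ℂ (Fin n), ‖x‖ = 1 ∧ r = ‖matOp M x‖}

/-- The closed `r`-neighbourhood `S + r 𝔻̄` of a set (for `0 ≤ r`). -/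
def addDisc (S : Set ℂ) (r : ℝ) : Set ℂ := {z | ∃ w ∈ S, ‖z - w‖ ≤ r}

/-- Convergence in the Hausdorff distance. -/
def HConv (S : ℕ → Set ℂ) (T : Set ℂ) : Prop :=
  Tendsto (fun n => Metric.hausdorffEDist (S n) T) atTop (𝓝 0)

/-! ### The finite approximating sets -/

/-- The points of `(1 / n) (ℤ + i ℤ)` in the open disc of radius `r`. -/
def grid (n : ℕ) (r : ℝ) : Set ℂ :=
  {z | (∃ a b : ℤ, z = ((a : ℂ) + (b : ℂ) * Complex.I) / (n : ℂ)) ∧ ‖z‖ < r}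

/-- The points `z` at which the minimum over the finite set of periodised matrices `B` of the
lower norm of `B - z I` is at most `ε`. -/
def deltaFin (n : ℕ) (t : ℂ) (Sα Sβ Sγ : Set ℂ) (ε : ℝ) : Set ℂ :=
  {z | ∃ B ∈ periodisedMatrices n t Sα Sβ Sγ,
    lowerNorm (B - z • (1 : Matrix (Fin n) (Fin n) ℂ)) ≤ ε}

/-- Three real numbers, meant as upper bounds for the sup norms of the three diagonals. -/
structure Bounds where
  α : ℝ
  β : ℝ
  γ : ℝ

/-- The sum of the three bounds. -/
def Bounds.radius (b : Bounds) : ℝ := b.α + b.β + b.γ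

/-- The quantity `ε†ₙ = (α_max + γ_max) * 22 / (7 n)`. -/
def Bounds.epsDag (b : Bounds) (n : ℕ) : ℝ := (b.α + b.γ) * (22 / (7 * (n : ℝ)))

/-- Three finite sets of complex numbers, each given by a list of its elements
(in any order, repetitions allowed). -/
structure Nets where
  α : List ℂ
  β : List ℂ
  γ : List ℂ

/-- The finite set of the elements of a list. -/
def listSet (l : List ℂ) : Set ℂ := {z | z ∈ l}

/-- The finite approximation of the spectrum computed from bounds and nets. -/
def piFin (t : ℂ) (n : ℕ) (b : Bounds) (s : Nets) : Set ℂ :=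
  deltaFin n t (listSet s.α) (listSet s.β) (listSet s.γ) (b.epsDag n + 3 / (n : ℝ)) ∩
    grid n b.radius

/-- The finite approximation fattened by discs of radius `2 / n`. -/
def piHat (t : ℂ) (n : ℕ) (b : Bounds) (s : Nets) : Set ℂ := addDisc (piFin t n b s) (2 / (n : ℝ))

/-- `Bd` assigns to each operator upper bounds for the sup norms of its diagonals, with a
positive sum (the radius of the grid). -/
def IsBoundMap (Bd : PsErg → Bounds) : Prop :=
  ∀ A : PsErg, (∀ j : ℤ, ‖subdiag A.1 j‖ ≤ (Bd A).α) ∧ (∀ j : ℤ, ‖diagonal A.1 j‖ ≤ (Bd A).β) ∧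
    (∀ j : ℤ, ‖superdiag A.1 j‖ ≤ (Bd A).γ) ∧ 0 < (Bd A).radius

/-- `S'` is a subset of `S` at Hausdorff distance at most `1 / (3 n)`. -/
def IsNet (n : ℕ) (S S' : Set ℂ) : Prop :=
  S' ⊆ S ∧ Metric.hausdorffEDist S S' ≤ ENNReal.ofReal (1 / (3 * (n : ℝ)))

/-- `Nt` assigns to each operator `A` and each `n ≥ 1` finite `1 / (3 n)`-nets of the closures of
the sets of diagonal entries of `A`. -/
def IsNetMap (Nt : PsErg → ℕ → Nets) : Prop :=
  ∀ (A : PsErg) (n : ℕ), 0 < n → IsNet n A.Sα (listSet (Nt A n).α) ∧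
    IsNet n A.Sβ (listSet (Nt A n).β) ∧ IsNet n A.Sγ (listSet (Nt A n).γ)

/-! ### A machine model over the reals

A Blum-Shub-Smale type model: a program works on finite trees with real leaves. Its primitive
steps are the exact arithmetic operations and order comparisons on real numbers, the handling of
pairs, and oracle queries. The only built-in number is `1`. -/

/-- Finite binary trees with real leaves. -/
inductive RData : Type
  | nil : RData
  | num : ℝ → RData
  | pair : RData → RData → RData

/-- Programs. -/
inductive Prog : Type
  | skip : Prog
  | nil : Prog
  | one : Prog
  | fst : Prog
  | snd : Prog
  | add : Prog
  | sub : Prog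
  | mul : Prog
  | div : Prog
  | query : Prog
  | pair : Prog → Prog → Prog
  | comp : Prog → Prog → Prog
  | ifPos : Prog → Prog → Prog → Prog
  | ifNil : Prog → Prog → Prog → Prog
  | loop : Prog → Prog → Prog

/-- `Run O p x y N`: with oracle `O`, the program `p` started on input `x` halts with output `y`
after `N` steps. `Prog.comp p q` runs `p` first, and `Prog.loop c b` repeats `b` as long as the
test `c` returns a positive number. Division by `0`, or an operation applied to data of the wrong
shape, yields no result. -/
inductive Run (O : ℕ → RData) : Prog → RData → RData → ℕ → Prop
  | skip (x : RData) : Run O Prog.skip x x 1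
  | nil (x : RData) : Run O Prog.nil x RData.nil 1
  | one (x : RData) : Run O Prog.one x (RData.num 1) 1
  | fst (x y : RData) : Run O Prog.fst (RData.pair x y) x 1
  | snd (x y : RData) : Run O Prog.snd (RData.pair x y) y 1
  | add (a b : ℝ) : Run O Prog.add (RData.pair (RData.num a) (RData.num b)) (RData.num (a + b)) 1
  | sub (a b : ℝ) : Run O Prog.sub (RData.pair (RData.num a) (RData.num b)) (RData.num (a - b)) 1
  | mul (a b : ℝ) : Run O Prog.mul (RData.pair (RData.num a) (RData.num b)) (RData.num (a * b)) 1
  | div (a b : ℝ) (hb : b ≠ 0) :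
      Run O Prog.div (RData.pair (RData.num a) (RData.num b)) (RData.num (a / b)) 1
  | query (k : ℕ) : Run O Prog.query (RData.num (k : ℝ)) (O k) 1
  | pair {p q : Prog} {x y z : RData} {M N : ℕ} (hp : Run O p x y M) (hq : Run O q x z N) :
      Run O (Prog.pair p q) x (RData.pair y z) (M + N + 1)
  | comp {p q : Prog} {x y z : RData} {M N : ℕ} (hp : Run O p x y M) (hq : Run O q y z N) :
      Run O (Prog.comp p q) x z (M + N + 1)
  | ifPos_true {c p q : Prog} {x y : RData} {r : ℝ} {M N : ℕ} (hc : Run O c x (RData.num r) M)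
      (hr : 0 < r) (hp : Run O p x y N) : Run O (Prog.ifPos c p q) x y (M + N + 1)
  | ifPos_false {c p q : Prog} {x y : RData} {r : ℝ} {M N : ℕ} (hc : Run O c x (RData.num r) M)
      (hr : r ≤ 0) (hq : Run O q x y N) : Run O (Prog.ifPos c p q) x y (M + N + 1)
  | ifNil_true {c p q : Prog} {x y : RData} {M N : ℕ} (hc : Run O c x RData.nil M)
      (hp : Run O p x y N) : Run O (Prog.ifNil c p q) x y (M + N + 1)
  | ifNil_false {c p q : Prog} {x y v : RData} {M N : ℕ} (hc : Run O c x v M)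
      (hv : v ≠ RData.nil) (hq : Run O q x y N) : Run O (Prog.ifNil c p q) x y (M + N + 1)
  | loop_stop {c b : Prog} {x : RData} {r : ℝ} {M : ℕ} (hc : Run O c x (RData.num r) M)
      (hr : r ≤ 0) : Run O (Prog.loop c b) x x (M + 1)
  | loop_step {c b : Prog} {x y z : RData} {r : ℝ} {M N K : ℕ} (hc : Run O c x (RData.num r) M)
      (hr : 0 < r) (hb : Run O b x y N) (hl : Run O (Prog.loop c b) y z K) :
      Run O (Prog.loop c b) x z (M + N + K + 1)

/-- A complex number as a pair of reals. -/
def encComplex (z : ℂ) : RData := RData.pair (RData.num z.re) (RData.num z.im)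

/-- A list of complex numbers. -/
def encList : List ℂ → RData
  | [] => RData.nil
  | z :: l => RData.pair (encComplex z) (encList l)

/-- Three bounds. -/
def encBounds (b : Bounds) : RData :=
  RData.pair (RData.num b.α) (RData.pair (RData.num b.β) (RData.num b.γ))

/-- Three lists. -/
def encNets (s : Nets) : RData := RData.pair (encList s.α) (RData.pair (encList s.β) (encList s.γ))

/-- The input `(n, t, bounds, nets)`. -/
def encInput (n : ℕ) (t : ℂ) (b : Bounds) (s : Nets) : RData :=
  RData.pair (RData.num (n : ℝ)) (RData.pair (encComplex t) (RData.pair (encBounds b) (encNets s)))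

/-- The program `p`, without oracle, halts on input `x` after finitely many operations and returns
a list of exactly the elements of the set `S`. -/
def ComputesFiniteSet (p : Prog) (x : RData) (S : Set ℂ) : Prop :=
  ∃ (l : List ℂ) (N : ℕ), Run (fun _ => RData.nil) p x (encList l) N ∧ listSet l = S

/-! ### The solvability complexity index

A computational problem is a map `Ξ` from a class `Ω` to the nonempty compact subsets of `ℂ` with
the Hausdorff metric, with a countable family `Λ` of evaluations of the elements of `Ω`, each
returning finitely many numbers. -/

/-- A finite string of numbers `(r, z₁, …, zₘ)` with `0 ≤ r` and `1 ≤ m` specifies the nonempty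
compact set formed by the closed discs of radius `r` about the points `zᵢ`; a finite set is the
case `r = 0`. -/
def Specifies (d : RData) (S : Set ℂ) : Prop :=
  ∃ (r : ℝ) (l : List ℂ), 0 ≤ r ∧ l ≠ [] ∧ d = RData.pair (RData.num r) (encList l) ∧
    S = addDisc (listSet l) r

/-- `Γ` is a height one arithmetic tower: one program, with finitely many real machine constants
`c`, takes `n ≥ 1` as input, has oracle access to the evaluations of `A`, and returns a string
specifying `Γ n A` after finitely many operations. -/
def IsArithmeticTower {Ω : Type} (Λ : ℕ → Ω → RData) (Γ : ℕ → Ω → Set ℂ) : Prop :=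
  ∃ (p : Prog) (c : RData), ∀ (A : Ω) (n : ℕ), 0 < n → ∃ (d : RData) (N : ℕ),
    Run (fun k => Λ k A) p (RData.pair (RData.num (n : ℝ)) c) d N ∧ Specifies d (Γ n A)

/-- `Ξ` can be computed exactly in finitely many operations (arithmetic index zero). -/
def ArithmeticIndexZero {Ω : Type} (Ξ : Ω → Set ℂ) (Λ : ℕ → Ω → RData) : Prop :=
  ∃ (p : Prog) (c : RData), ∀ A : Ω, ∃ (d : RData) (N : ℕ),
    Run (fun k => Λ k A) p c d N ∧ Specifies d (Ξ A)

/-- The arithmetic solvability complexity index equals one: some height one arithmetic tower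
converges to `Ξ`, and `Ξ` cannot be computed exactly. -/
def ArithmeticIndexOne {Ω : Type} (Ξ : Ω → Set ℂ) (Λ : ℕ → Ω → RData) : Prop :=
  (∃ Γ : ℕ → Ω → Set ℂ, IsArithmeticTower Λ Γ ∧ ∀ A : Ω, HConv (fun n => Γ n A) (Ξ A)) ∧
    ¬ ArithmeticIndexZero Ξ Λ

/-- The class `Π₁^A` of problems solved in one limit by an arithmetic tower with error control
from above. -/
def InPiOneA {Ω : Type} (Ξ : Ω → Set ℂ) (Λ : ℕ → Ω → RData) : Prop :=
  ∃ Γ X : ℕ → Ω → Set ℂ, IsArithmeticTower Λ Γ ∧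
    (∀ A : Ω, HConv (fun n => Γ n A) (Ξ A)) ∧
    ∀ (A : Ω) (n : ℕ), 0 < n → IsCompact (X n A) ∧ Ξ A ⊆ X n A ∧
      Metric.hausdorffEDist (X n A) (Γ n A) ≤ ENNReal.ofReal ((1 / 2 : ℝ) ^ n)

/-- The evaluation set consisting of the bounds (index `0`) and of the nets with parameter `n`
(index `n ≥ 1`). -/
def evaluations (Bd : PsErg → Bounds) (Nt : PsErg → ℕ → Nets) (k : ℕ) (A : PsErg) : RData :=
  if k = 0 then encBounds (Bd A) else encNets (Nt A k)

end TridiagSpec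

end

open TridiagSpec

/-! Everything is expressed through approximate eigenvectors. By `mem_closedPseudospectrum_iff`, a
point `z` lies in the closed `ε`-pseudospectrum exactly when `A - z` or its adjoint has, for every
`δ > ε`, a vector `u ≠ 0` whose image has norm at most `δ ‖u‖`. Such vectors can be truncated to
finite support, and pseudoergodicity then plants a copy of them in any operator with the same three
sets (`PseudoergodicWrt.lowerBoundLE_of`). Hence spectrum and pseudospectra depend only on those
sets, which is the source of uniformity.

From matrices to the operator (`PseudoergodicWrt.lowerBoundLE_of_perMatrix`): a near-null vector of
a periodised matrix minus `z` extends quasi-periodically, with multiplier `conj t`, to a bounded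
sequence on which a periodic operator acts with the same relative error. Cutting to `m` periods
costs four boundary terms of bounded size against a norm of order `√m`. The cut-off vector is then
transferred to `A`.

From the operator to matrices (`exists_window`): an approximate eigenvector is tapered by a sine
profile on each window of length `n`. Summed over all window positions, the squared errors are
controlled by the profile alone, so some window satisfies the bound, with loss `(p + q) * 2 sin (π /
(2 n))`, where `p` and `q` bound the off-diagonals; `π < 22 / 7` turns this into `ε†ₙ`. The profile
changes sign across the ends of the window, so both corner terms are estimated by absolute values
and the phase `t` plays no role. If only the adjoint has approximate eigenvectors, the argument is
applied to it and the matrix is conjugate transposed, which for square matrices preserves the lower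
norm. Replacing entries by net points costs `1 / n`, moving `z` to the grid costs `3 / (2 n)`, and
`1 / (2 n)` is slack: this is the `3 / n`.

Convergence follows because closed pseudospectra shrink to the spectrum.

For computability, a lower norm is at most `e ≥ 0` exactly when the Gram matrix minus `e²` is not
positive definite. Successive Schur complements decide this with field operations and comparisons
only, without square roots. A small calculus (`IsComp`, `IsTest`) assembles the program.

Exact computation fails for a reason unrelated to computing: the bilateral shift is pseudoergodic,
its spectrum is the unit circle, and a circle is neither finite nor a union of finitely many discs
of a common positive radius. -/

noncomputable section

namespace TridiagSpec

/-! ### Typed computability for the machine model -/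

/-- Types whose elements are represented by finite trees. -/
class Enc (α : Type) where
  enc : α → RData

open Enc

instance : Enc RData := ⟨id⟩
instance : Enc ℝ := ⟨RData.num⟩
instance : Enc ℕ := ⟨fun n => RData.num n⟩
instance : Enc ℂ := ⟨encComplex⟩
instance {α β : Type} [Enc α] [Enc β] : Enc (α × β) := ⟨fun x => RData.pair (enc x.1) (enc x.2)⟩
instance {α : Type} [Enc α] : Enc (List α) :=
  ⟨fun l => l.foldr (fun a r => RData.pair (enc a) r) RData.nil⟩

theorem enc_real (r : ℝ) : enc r = RData.num r := rfl
theorem enc_nat (n : ℕ) : enc n = RData.num (n : ℝ) := rfl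
theorem enc_pair {α β : Type} [Enc α] [Enc β] (a : α) (b : β) :
    enc (a, b) = RData.pair (enc a) (enc b) := rfl
theorem enc_cons {α : Type} [Enc α] (a : α) (l : List α) :
    enc (a :: l) = RData.pair (enc a) (enc l) := rfl

theorem enc_list_complex (l : List ℂ) : enc l = encList l := by
  induction l with
  | nil => rfl
  | cons a l ih => rw [enc_cons, ih]; rfl

/-- The program halts on the given input with the given output. -/
def Halts (O : ℕ → RData) (p : Prog) (x y : RData) : Prop := ∃ N, Run O p x y N

namespace Halts

variable {O : ℕ → RData} {p q c : Prog} {x y z v : RData} {r : ℝ}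

theorem skip : Halts O .skip x x := ⟨_, .skip x⟩
theorem nil : Halts O .nil x .nil := ⟨_, .nil x⟩
theorem one : Halts O .one x (.num 1) := ⟨_, .one x⟩
theorem fst : Halts O .fst (.pair x y) x := ⟨_, .fst x y⟩
theorem snd : Halts O .snd (.pair x y) y := ⟨_, .snd x y⟩
theorem add (a b : ℝ) : Halts O .add (.pair (.num a) (.num b)) (.num (a + b)) := ⟨_, .add a b⟩
theorem sub (a b : ℝ) : Halts O .sub (.pair (.num a) (.num b)) (.num (a - b)) := ⟨_, .sub a b⟩
theorem mul (a b : ℝ) : Halts O .mul (.pair (.num a) (.num b)) (.num (a * b)) := ⟨_, .mul a b⟩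
theorem div (a b : ℝ) (hb : b ≠ 0) :
    Halts O .div (.pair (.num a) (.num b)) (.num (a / b)) := ⟨_, .div a b hb⟩
theorem query (k : ℕ) : Halts O .query (.num k) (O k) := ⟨_, .query k⟩

theorem pair (hp : Halts O p x y) (hq : Halts O q x z) : Halts O (.pair p q) x (.pair y z) :=
  let ⟨_, h⟩ := hp; let ⟨_, h'⟩ := hq; ⟨_, .pair h h'⟩

theorem comp (hp : Halts O p x y) (hq : Halts O q y z) : Halts O (.comp p q) x z :=
  let ⟨_, h⟩ := hp; let ⟨_, h'⟩ := hq; ⟨_, .comp h h'⟩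

theorem ifPos_true (hc : Halts O c x (.num r)) (hr : 0 < r) (hp : Halts O p x y) :
    Halts O (.ifPos c p q) x y :=
  let ⟨_, h⟩ := hc; let ⟨_, h'⟩ := hp; ⟨_, .ifPos_true h hr h'⟩

theorem ifPos_false (hc : Halts O c x (.num r)) (hr : r ≤ 0) (hq : Halts O q x y) :
    Halts O (.ifPos c p q) x y :=
  let ⟨_, h⟩ := hc; let ⟨_, h'⟩ := hq; ⟨_, .ifPos_false h hr h'⟩

theorem ifNil_true (hc : Halts O c x .nil) (hp : Halts O p x y) : Halts O (.ifNil c p q) x y :=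
  let ⟨_, h⟩ := hc; let ⟨_, h'⟩ := hp; ⟨_, .ifNil_true h h'⟩

theorem ifNil_false (hc : Halts O c x v) (hv : v ≠ .nil) (hq : Halts O q x y) :
    Halts O (.ifNil c p q) x y :=
  let ⟨_, h⟩ := hc; let ⟨_, h'⟩ := hq; ⟨_, .ifNil_false h hv h'⟩

theorem loop_stop (hc : Halts O c x (.num r)) (hr : r ≤ 0) : Halts O (.loop c p) x x :=
  let ⟨_, h⟩ := hc; ⟨_, Run.loop_stop h hr⟩

theorem loop_step (hc : Halts O c x (.num r)) (hr : 0 < r) (hb : Halts O p x y)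
    (hl : Halts O (.loop c p) y z) : Halts O (.loop c p) x z :=
  let ⟨_, h⟩ := hc; let ⟨_, h'⟩ := hb; let ⟨_, h''⟩ := hl; ⟨_, .loop_step h hr h' h''⟩

end Halts

/-- The function is computed by one oracle-free program. -/
def IsComp {α β : Type} [Enc α] [Enc β] (f : α → β) : Prop :=
  ∃ p, ∀ O a, Halts O p (enc a) (enc (f a))

/-- The predicate is decided by one oracle-free program, by the sign of its output. -/
def IsTest {α : Type} [Enc α] (c : α → Prop) : Prop :=
  ∃ f : α → ℝ, IsComp f ∧ ∀ a, 0 < f a ↔ c a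

variable {σ α β γ : Type} [Enc σ] [Enc α] [Enc β] [Enc γ]

namespace IsComp

theorem of_eq {f g : α → β} (hf : IsComp f) (h : ∀ a, f a = g a) : IsComp g := by
  rwa [← funext h]

/-- Programs see only encodings. A natural number is encoded as a real and a complex number as a
pair of reals, so a program for one type serves any other type with the same encodings. -/
theorem of_enc_eq {α' β' : Type} [Enc α'] [Enc β'] {f : α → β} (hf : IsComp f) {g : α' → β'}
    (e : α' → α) (he : ∀ a, enc (e a) = enc a) (h : ∀ a, enc (g a) = enc (f (e a))) :
    IsComp g := by
  obtain ⟨p, hp⟩ := hf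
  exact ⟨p, fun O a => by rw [h, ← he]; exact hp O _⟩

theorem id : IsComp (fun s : σ => s) := ⟨.skip, fun _ _ => Halts.skip⟩

theorem comp {f : β → γ} {g : α → β} (hf : IsComp f) (hg : IsComp g) :
    IsComp fun a => f (g a) := by
  obtain ⟨p, hp⟩ := hf
  obtain ⟨q, hq⟩ := hg
  exact ⟨.comp q p, fun O a => (hq O a).comp (hp O _)⟩

theorem pair {f : σ → α} {g : σ → β} (hf : IsComp f) (hg : IsComp g) :
    IsComp fun s => (f s, g s) := by
  obtain ⟨p, hp⟩ := hf
  obtain ⟨q, hq⟩ := hg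
  exact ⟨.pair p q, fun O a => (hp O a).pair (hq O a)⟩

theorem fst {f : σ → α × β} (hf : IsComp f) : IsComp fun s => (f s).1 := by
  obtain ⟨p, hp⟩ := hf
  exact ⟨.comp p .fst, fun O a => (hp O a).comp Halts.fst⟩

theorem snd {f : σ → α × β} (hf : IsComp f) : IsComp fun s => (f s).2 := by
  obtain ⟨p, hp⟩ := hf
  exact ⟨.comp p .snd, fun O a => (hp O a).comp Halts.snd⟩

theorem one : IsComp fun _ : σ => (1 : ℝ) := ⟨.one, fun _ _ => Halts.one⟩

theorem add {f g : σ → ℝ} (hf : IsComp f) (hg : IsComp g) : IsComp fun s => f s + g s := by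
  obtain ⟨p, hp⟩ := hf
  obtain ⟨q, hq⟩ := hg
  exact ⟨.comp (.pair p q) .add, fun O a => ((hp O a).pair (hq O a)).comp (Halts.add _ _)⟩

theorem sub {f g : σ → ℝ} (hf : IsComp f) (hg : IsComp g) : IsComp fun s => f s - g s := by
  obtain ⟨p, hp⟩ := hf
  obtain ⟨q, hq⟩ := hg
  exact ⟨.comp (.pair p q) .sub, fun O a => ((hp O a).pair (hq O a)).comp (Halts.sub _ _)⟩

theorem mul {f g : σ → ℝ} (hf : IsComp f) (hg : IsComp g) : IsComp fun s => f s * g s := by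
  obtain ⟨p, hp⟩ := hf
  obtain ⟨q, hq⟩ := hg
  exact ⟨.comp (.pair p q) .mul, fun O a => ((hp O a).pair (hq O a)).comp (Halts.mul _ _)⟩

theorem zero : IsComp fun _ : σ => (0 : ℝ) := (one.sub one).of_eq fun _ => sub_self _

theorem neg {f : σ → ℝ} (hf : IsComp f) : IsComp fun s => -f s :=
  (zero.sub hf).of_eq fun _ => zero_sub _

theorem natLit (n : ℕ) : IsComp fun _ : σ => (n : ℝ) := by
  induction n with
  | zero => exact zero.of_eq fun _ => by simp
  | succ n ih => exact (ih.add one).of_eq fun _ => by simp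

theorem nat (n : ℕ) : IsComp fun _ : σ => n :=
  (natLit (σ := σ) n).of_enc_eq (fun s => s) (fun _ => rfl) fun _ => rfl

theorem castNat {f : σ → ℕ} (hf : IsComp f) : IsComp fun s => (f s : ℝ) :=
  hf.of_enc_eq (fun s => s) (fun _ => rfl) fun _ => rfl

theorem succ {f : σ → ℕ} (hf : IsComp f) : IsComp fun s => f s + 1 :=
  (hf.castNat.add one).of_enc_eq (fun s => s) (fun _ => rfl) fun s => by
    simp [enc_nat, enc_real]

theorem ite {c : σ → Prop} [∀ s, Decidable (c s)] {f g : σ → α} (hc : IsTest c)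
    (hf : IsComp f) (hg : IsComp g) :
    IsComp fun s => if c s then f s else g s := by
  obtain ⟨t, ⟨r, hr⟩, ht⟩ := hc
  obtain ⟨p, hp⟩ := hf
  obtain ⟨q, hq⟩ := hg
  refine ⟨.ifPos r p q, fun O s => ?_⟩
  by_cases h : c s
  · simp only [h, if_true]
    exact Halts.ifPos_true (hr O s) ((ht s).2 h) (hp O s)
  · simp only [h, if_false]
    exact Halts.ifPos_false (hr O s) (not_lt.1 fun h' => h ((ht s).1 h')) (hq O s)

end IsComp

namespace IsTest

theorem congr {c d : σ → Prop} (hc : IsTest c) (h : ∀ s, c s ↔ d s) : IsTest d := by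
  obtain ⟨f, hf, h'⟩ := hc
  exact ⟨f, hf, fun s => (h' s).trans (h s)⟩

theorem lt {f g : σ → ℝ} (hf : IsComp f) (hg : IsComp g) : IsTest fun s => f s < g s :=
  ⟨_, hg.sub hf, fun _ => sub_pos⟩

open Classical in
theorem not {c : σ → Prop} (hc : IsTest c) : IsTest fun s => ¬ c s := by
  refine ⟨fun s => if c s then 0 else 1, IsComp.ite hc IsComp.zero IsComp.one, fun s => ?_⟩
  by_cases h : c s <;> simp [h]

open Classical in
theorem and {c d : σ → Prop} (hc : IsTest c) (hd : IsTest d) : IsTest fun s => c s ∧ d s := by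
  refine ⟨fun s => if c s then (if d s then 1 else 0) else 0,
    IsComp.ite hc (IsComp.ite hd IsComp.one IsComp.zero) IsComp.zero, fun s => ?_⟩
  by_cases h : c s <;> by_cases h' : d s <;> simp [h, h']

theorem natEq {f g : σ → ℕ} (hf : IsComp f) (hg : IsComp g) : IsTest fun s => f s = g s :=
  ((lt hf.castNat hg.castNat).not.and (lt hg.castNat hf.castNat).not).congr fun s => by
    simp only [Nat.cast_lt]; omega

end IsTest

namespace IsComp

open Classical in
theorem div {f g : σ → ℝ} (hf : IsComp f) (hg : IsComp g) : IsComp fun s => f s / g s := by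
  obtain ⟨p, hp⟩ := hf
  obtain ⟨q, hq⟩ := hg
  obtain ⟨q', hq'⟩ := IsComp.neg ⟨q, hq⟩
  obtain ⟨z, hz⟩ := IsComp.zero (σ := σ)
  have key : ∀ O s, g s ≠ 0 → Halts O (.comp (.pair p q) .div) (enc s) (enc (f s / g s)) :=
    fun O s h => ((hp O s).pair (hq O s)).comp (Halts.div _ _ h)
  -- The machine has no result for division by zero, whereas Lean returns `0`. The sign of the
  -- divisor is therefore tested in both directions, and `0` is output when both tests fail.
  refine ⟨.ifPos q (.comp (.pair p q) .div) (.ifPos q' (.comp (.pair p q) .div) z),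
    fun O s => ?_⟩
  rcases lt_trichotomy (g s) 0 with h | h | h
  · exact Halts.ifPos_false (hq O s) h.le
      (Halts.ifPos_true (hq' O s) (neg_pos.2 h) (key O s h.ne))
  · refine Halts.ifPos_false (hq O s) h.le (Halts.ifPos_false (hq' O s) (by simp [h]) ?_)
    simpa only [h, div_zero] using hz O s
  · exact Halts.ifPos_true (hq O s) h (key O s h.ne')

theorem inv {f : σ → ℝ} (hf : IsComp f) : IsComp fun s => (f s)⁻¹ :=
  (one.div hf).of_eq fun _ => one_div _

/-! Complex arithmetic. -/

theorem re {f : σ → ℂ} (hf : IsComp f) : IsComp fun s => (f s).re :=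
  IsComp.fst (f := fun s => ((f s).re, (f s).im))
    (hf.of_enc_eq (fun s => s) (fun _ => rfl) fun _ => rfl)

theorem im {f : σ → ℂ} (hf : IsComp f) : IsComp fun s => (f s).im :=
  IsComp.snd (f := fun s => ((f s).re, (f s).im))
    (hf.of_enc_eq (fun s => s) (fun _ => rfl) fun _ => rfl)

theorem mkComplex {f g : σ → ℝ} (hf : IsComp f) (hg : IsComp g) :
    IsComp fun s => (⟨f s, g s⟩ : ℂ) :=
  (hf.pair hg).of_enc_eq (fun s => s) (fun _ => rfl) fun _ => rfl

theorem ofReal {f : σ → ℝ} (hf : IsComp f) : IsComp fun s => (f s : ℂ) :=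
  (hf.mkComplex zero).of_eq fun _ => rfl

theorem czero : IsComp fun _ : σ => (0 : ℂ) := (ofReal zero).of_eq fun _ => Complex.ofReal_zero

theorem cadd {f g : σ → ℂ} (hf : IsComp f) (hg : IsComp g) : IsComp fun s => f s + g s :=
  ((hf.re.add hg.re).mkComplex (hf.im.add hg.im)).of_eq fun _ => rfl

theorem csub {f g : σ → ℂ} (hf : IsComp f) (hg : IsComp g) : IsComp fun s => f s - g s :=
  ((hf.re.sub hg.re).mkComplex (hf.im.sub hg.im)).of_eq fun _ => rfl

theorem cmul {f g : σ → ℂ} (hf : IsComp f) (hg : IsComp g) : IsComp fun s => f s * g s :=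
  (((hf.re.mul hg.re).sub (hf.im.mul hg.im)).mkComplex
    ((hf.re.mul hg.im).add (hf.im.mul hg.re))).of_eq fun _ => by
      apply Complex.ext <;> simp

theorem conj {f : σ → ℂ} (hf : IsComp f) : IsComp fun s => (starRingEnd ℂ) (f s) :=
  (hf.re.mkComplex hf.im.neg).of_eq fun _ => rfl

/-! Lists. -/

theorem nil : IsComp fun _ : σ => ([] : List α) := ⟨.nil, fun _ _ => Halts.nil⟩

theorem cons {f : σ → α} {g : σ → List α} (hf : IsComp f) (hg : IsComp g) :
    IsComp fun s => f s :: g s :=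
  (hf.pair hg).of_enc_eq (fun s => s) (fun _ => rfl) fun _ => rfl

theorem headD {f : σ → List α} {d : σ → α} (hf : IsComp f) (hd : IsComp d) :
    IsComp fun s => (f s).headD (d s) := by
  obtain ⟨p, hp⟩ := hf
  obtain ⟨q, hq⟩ := hd
  refine ⟨.ifNil p q (.comp p .fst), fun O s => ?_⟩
  have h := hp O s
  change Halts O _ _ (enc ((f s).headD (d s)))
  cases hl : f s with
  | nil => rw [hl] at h; exact h.ifNil_true (hq O s)
  | cons a l =>
    rw [hl, enc_cons] at h
    exact h.ifNil_false (by simp) (h.comp Halts.fst)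

theorem tail {f : σ → List α} (hf : IsComp f) : IsComp fun s => (f s).tail := by
  obtain ⟨p, hp⟩ := hf
  refine ⟨.ifNil p .nil (.comp p .snd), fun O s => ?_⟩
  have h := hp O s
  change Halts O _ _ (enc (f s).tail)
  cases hl : f s with
  | nil => rw [hl] at h; exact h.ifNil_true Halts.nil
  | cons a l =>
    rw [hl, enc_cons] at h
    exact h.ifNil_false (by simp) (h.comp Halts.snd)

/-- The only general iteration scheme over lists. The loop state carries the parameter unchanged,
the accumulator and the remaining list; the test gives `0` on the empty list and `1` otherwise. -/
theorem foldl {l : σ → List α} {i : σ → β} {f : σ → β → α → β} (hl : IsComp l) (hi : IsComp i)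
    (hf : IsComp fun q : σ × β × α => f q.1 q.2.1 q.2.2) :
    IsComp fun s => (l s).foldl (f s) (i s) := by
  obtain ⟨pl, hl⟩ := hl
  obtain ⟨pi, hi⟩ := hi
  obtain ⟨pf, hf⟩ := hf
  obtain ⟨pz, hz⟩ := IsComp.zero (σ := RData)
  have loop : ∀ O s (l : List α) (b : β),
      Halts O (.loop (.ifNil (.comp .snd .snd) pz .one)
        (.pair .fst (.pair
          (.comp (.pair .fst (.pair (.comp .snd .fst) (.comp (.comp .snd .snd) .fst))) pf)
          (.comp (.comp .snd .snd) .snd))))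
        (.pair (enc s) (.pair (enc b) (enc l)))
        (.pair (enc s) (.pair (enc (l.foldl (f s) b)) (enc ([] : List α)))) := by
    intro O s l
    induction l with
    | nil =>
      intro b
      exact Halts.loop_stop (Halts.ifNil_true (Halts.snd.comp Halts.snd) (hz O _)) le_rfl
    | cons a l ih =>
      intro b
      have h2 : ∀ y, Halts O (.comp .snd .snd) (.pair (enc s) (.pair (enc b) y)) y :=
        fun y => Halts.snd.comp Halts.snd
      refine Halts.loop_step ((h2 _).ifNil_false (by simp [enc_cons]) Halts.one) one_pos
        ?_ (ih (f s b a))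
      exact Halts.fst.pair (Halts.pair
        ((Halts.fst.pair ((Halts.snd.comp Halts.fst).pair ((h2 _).comp Halts.fst))).comp
          (hf O (s, b, a))) ((h2 _).comp Halts.snd))
  exact ⟨_, fun O s => ((Halts.skip.pair ((hi O s).pair (hl O s))).comp (loop O s _ _)).comp
    (Halts.snd.comp Halts.fst)⟩

theorem reverse {l : σ → List α} (hl : IsComp l) : IsComp fun s => (l s).reverse :=
  (foldl (f := fun _ acc a => a :: acc) hl nil (id.snd.snd.cons id.snd.fst)).of_eq fun s => by
    simp

theorem map {l : σ → List α} {f : σ → α → β} (hl : IsComp l)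
    (hf : IsComp fun q : σ × α => f q.1 q.2) : IsComp fun s => (l s).map (f s) := by
  refine (foldl (f := fun s acc a => f s a :: acc) hl.reverse nil
    ((hf.comp (id.fst.pair id.snd.snd)).cons id.snd.fst)).of_eq fun s => ?_
  rw [List.foldl_reverse]
  induction l s with
  | nil => rfl
  | cons a l ih => rw [List.foldr_cons, ih, List.map_cons]

theorem append {l m : σ → List α} (hl : IsComp l) (hm : IsComp m) :
    IsComp fun s => l s ++ m s := by
  refine (foldl (f := fun _ acc a => a :: acc) hl.reverse hm
    (id.snd.snd.cons id.snd.fst)).of_eq fun s => ?_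
  rw [List.foldl_reverse]
  induction l s with
  | nil => rfl
  | cons a l ih => rw [List.foldr_cons, ih, List.cons_append]

theorem flatMap {l : σ → List α} {f : σ → α → List β} (hl : IsComp l)
    (hf : IsComp fun q : σ × α => f q.1 q.2) : IsComp fun s => (l s).flatMap (f s) := by
  refine (foldl (f := fun s acc a => f s a ++ acc) hl.reverse nil
    ((hf.comp (id.fst.pair id.snd.snd)).append id.snd.fst)).of_eq fun s => ?_
  rw [List.foldl_reverse]
  induction l s with
  | nil => rfl
  | cons a l ih => rw [List.foldr_cons, ih, List.flatMap_cons]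

theorem filter {l : σ → List α} {c : σ → α → Prop} [∀ s a, Decidable (c s a)] (hl : IsComp l)
    (hc : IsTest fun q : σ × α => c q.1 q.2) : IsComp fun s => (l s).filter (c s ·) := by
  refine (flatMap (f := fun s a => if c s a then [a] else []) hl
    (ite hc (id.snd.cons nil) nil)).of_eq fun s => ?_
  induction l s with
  | nil => rfl
  | cons a l ih =>
    rw [List.flatMap_cons, ih, List.filter_cons]
    by_cases h : c s a <;> simp [h]

theorem csum {l : σ → List ℂ} (hl : IsComp l) : IsComp fun s => (l s).sum := by
  refine (foldl (f := fun _ acc a => a + acc) hl.reverse czero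
    (id.snd.snd.cadd id.snd.fst)).of_eq fun s => ?_
  rw [List.foldl_reverse]
  rfl

/-- The loop counts down and prepends, so the list comes out in increasing order and the counter
itself is the loop test. -/
theorem range {f : σ → ℕ} (hf : IsComp f) : IsComp fun s => List.range (f s) := by
  obtain ⟨p, hp⟩ := hf
  obtain ⟨q, loop⟩ : ∃ q, ∀ O (k : ℕ) (l : List ℕ),
      Halts O q (.pair (enc k) (enc l)) (.pair (enc 0) (enc (List.range k ++ l))) := by
    refine ⟨.loop .fst (.pair (.comp (.pair .fst .one) .sub)
      (.pair (.comp (.pair .fst .one) .sub) .snd)), fun O k => ?_⟩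
    induction k with
    | zero => exact fun l => Halts.loop_stop Halts.fst (by simp)
    | succ k ih =>
      intro l
      have h : Halts O (.comp (.pair .fst .one) .sub) (.pair (enc (k + 1)) (enc l)) (enc k) := by
        have := (Halts.fst.pair Halts.one).comp (Halts.sub (O := O) ((k + 1 : ℕ) : ℝ) 1)
          (x := .pair (enc (k + 1)) (enc l))
        simpa [enc_nat] using this
      have h' := ih (k :: l)
      rw [show List.range k ++ k :: l = List.range (k + 1) ++ l by simp [List.range_succ]] at h'
      exact Halts.loop_step Halts.fst (by positivity) (h.pair (h.pair Halts.snd)) h'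
  refine ⟨.comp (.comp (.pair p .nil) q) .snd, fun O s => ?_⟩
  have h := (((hp O s).pair Halts.nil).comp (loop O _ [])).comp Halts.snd
  rwa [List.append_nil] at h

/-- Rounding is not primitive: a counter goes up from `0` while it is below the given real. The
induction is on the remaining distance `d`. -/
theorem ceil {f : σ → ℝ} (hf : IsComp f) : IsComp fun s => ⌈f s⌉₊ := by
  obtain ⟨p, hp⟩ := hf
  obtain ⟨pz, hz⟩ := IsComp.zero (σ := σ)
  obtain ⟨q, loop⟩ : ∃ q, ∀ O (r : ℝ) (d k : ℕ), k + d = ⌈r⌉₊ →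
      Halts O q (.pair (enc k) (enc r)) (.pair (enc ⌈r⌉₊) (enc r)) := by
    refine ⟨.loop (.comp (.pair .snd .fst) .sub) (.pair (.comp (.pair .fst .one) .add) .snd),
      fun O r d => ?_⟩
    induction d with
    | zero =>
      intro k hk
      rw [← hk, add_zero]
      refine Halts.loop_stop ((Halts.snd.pair Halts.fst).comp (Halts.sub _ _)) ?_
      rw [sub_nonpos]
      exact Nat.ceil_le.1 (by omega)
    | succ d ih =>
      intro k hk
      refine Halts.loop_step ((Halts.snd.pair Halts.fst).comp (Halts.sub _ _)) ?_
        (((Halts.fst.pair Halts.one).comp (Halts.add _ _)).pair Halts.snd) ?_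
      · exact sub_pos.2 (Nat.lt_ceil.1 (by omega))
      · have := ih (k + 1) (by omega)
        simpa [enc_nat] using this
  refine ⟨.comp (.comp (.pair pz p) q) .fst, fun O s => ?_⟩
  have h0 : enc (0 : ℝ) = enc (0 : ℕ) := by simp [enc_real, enc_nat]
  exact (((h0 ▸ hz O s).pair (hp O s)).comp (loop O (f s) _ 0 (zero_add _))).comp Halts.fst

/-- Indexing is done by dropping one head per unit of the index and then reading the head. -/
theorem getD {l : σ → List α} {i : σ → ℕ} {d : σ → α} (hl : IsComp l) (hi : IsComp i)
    (hd : IsComp d) : IsComp fun s => (l s).getD (i s) (d s) := by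
  refine (headD (foldl (f := fun _ acc _ => acc.tail) hi.range hl id.snd.fst.tail) hd).of_eq
    fun s => ?_
  have : ∀ (k : ℕ) (l : List α),
      (List.range k).foldl (fun acc _ => acc.tail) l = l.drop k := by
    intro k l
    induction k with
    | zero => rfl
    | succ k ih => rw [List.range_succ, List.foldl_append, ih]; simp
  rw [this, List.getD_eq_getElem?_getD, List.headD_eq_head?_getD, List.head?_drop]

end IsComp

open Classical in
theorem IsTest.exists_mem {l : σ → List α} {c : σ → α → Prop} (hl : IsComp l)
    (hc : IsTest fun q : σ × α => c q.1 q.2) : IsTest fun s => ∃ a ∈ l s, c s a := by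
  -- A bounded search is a fold that sets a flag to `1` at the first success and never resets it.
  refine ⟨_, IsComp.foldl (f := fun s acc a => if c s a then 1 else acc) hl IsComp.zero
    (IsComp.ite (c := fun q : σ × ℝ × α => c q.1 q.2.2) ?_ IsComp.one IsComp.id.snd.fst), ?_⟩
  · obtain ⟨g, hg, h⟩ := hc
    exact ⟨_, hg.comp (IsComp.id.fst.pair IsComp.id.snd.snd), fun q => h (q.1, q.2.2)⟩
  · intro s
    have : ∀ (l : List α) (r : ℝ), 0 < l.foldl (fun acc a => if c s a then 1 else acc) r ↔
        0 < r ∨ ∃ a ∈ l, c s a := by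
      intro l
      induction l with
      | nil => simp
      | cons a l ih =>
        intro r
        rw [List.foldl_cons, ih]
        by_cases h : c s a <;> simp [h]
    rw [this]
    simp

/-! ### Positive definiteness by successive Schur complements -/

/-- The `n × n` table of the values of a function. -/
def table (n : ℕ) (f : ℕ → ℕ → ℂ) : List (List ℂ) :=
  (List.range n).map fun i => (List.range n).map fun j => f i j

/-- The entries of a table, extended by zero. -/
def tableGet (T : List (List ℂ)) (i j : ℕ) : ℂ := (T.getD i []).getD j 0

theorem tableGet_table (n : ℕ) (f : ℕ → ℕ → ℂ) (i j : ℕ) :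
    tableGet (table n f) i j = if i < n ∧ j < n then f i j else 0 := by
  unfold tableGet table
  by_cases hi : i < n <;> by_cases hj : j < n <;>
    simp [List.getD_eq_getElem?_getD, hi, hj]

/-- The Schur complement of the upper left entry, re-indexed from zero. -/
def schurStep (h : ℕ → ℕ → ℂ) (i j : ℕ) : ℂ :=
  h (i + 1) (j + 1) - h (i + 1) 0 * h 0 (j + 1) * (((h 0 0).re⁻¹ : ℝ) : ℂ)

/-- The Hermitian form of the upper left `n × n` block. -/
def blockForm (n : ℕ) (h : ℕ → ℕ → ℂ) (x : ℕ → ℂ) : ℂ :=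
  ∑ i ∈ Finset.range n, ∑ j ∈ Finset.range n, (starRingEnd ℂ) (x i) * h i j * x j

/-- The upper left `n × n` block is positive definite. -/
def BlockPosDef (n : ℕ) (h : ℕ → ℕ → ℂ) : Prop :=
  ∀ x : ℕ → ℂ, (∃ i < n, x i ≠ 0) → 0 < (blockForm n h x).re

theorem blockForm_congr {n : ℕ} {h h' : ℕ → ℕ → ℂ} (hh : ∀ i < n, ∀ j < n, h i j = h' i j)
    {x x' : ℕ → ℂ} (hx : ∀ i < n, x i = x' i) : blockForm n h x = blockForm n h' x' := by
  refine Finset.sum_congr rfl fun i hi => Finset.sum_congr rfl fun j hj => ?_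
  rw [Finset.mem_range] at hi hj
  rw [hh i hi j hj, hx i hi, hx j hj]

theorem BlockPosDef.congr {n : ℕ} {h h' : ℕ → ℕ → ℂ} (hh : ∀ i < n, ∀ j < n, h i j = h' i j) :
    BlockPosDef n h ↔ BlockPosDef n h' := by
  unfold BlockPosDef
  simp only [blockForm_congr hh fun _ _ => rfl]

theorem schurStep_conj {h : ℕ → ℕ → ℂ} (hh : ∀ i j, h j i = (starRingEnd ℂ) (h i j)) (i j : ℕ) :
    schurStep h j i = (starRingEnd ℂ) (schurStep h i j) := by
  simp only [schurStep, map_sub, map_mul, Complex.conj_ofReal, ← hh]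
  ring

/-- Completion of the square in the variable `x 0`. The Hermitian hypothesis makes the pivot real
and identifies the first column with the conjugate of the first row. -/
theorem blockForm_succ {h : ℕ → ℕ → ℂ} (hh : ∀ i j, h j i = (starRingEnd ℂ) (h i j))
    (h0 : (h 0 0).re ≠ 0) (n : ℕ) (x : ℕ → ℂ) :
    blockForm (n + 1) h x = blockForm n (schurStep h) (fun i => x (i + 1)) +
      (((h 0 0).re * Complex.normSq (x 0 +
        (∑ j ∈ Finset.range n, h 0 (j + 1) * x (j + 1)) * (((h 0 0).re⁻¹ : ℝ) : ℂ)) : ℝ) : ℂ) := by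
  have h00 : h 0 0 = ((h 0 0).re : ℂ) := (Complex.conj_eq_iff_re.1 (hh 0 0).symm).symm
  set a := (h 0 0).re with ha
  set v := ∑ j ∈ Finset.range n, h 0 (j + 1) * x (j + 1) with hv
  have hcv : (starRingEnd ℂ) v =
      ∑ i ∈ Finset.range n, (starRingEnd ℂ) (x (i + 1)) * h (i + 1) 0 := by
    rw [hv, map_sum]
    exact Finset.sum_congr rfl fun i _ => by rw [map_mul, hh 0 (i + 1), mul_comm]
  have e1 : blockForm n (schurStep h) (fun i => x (i + 1)) =
      (∑ i ∈ Finset.range n, ∑ j ∈ Finset.range n,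
        (starRingEnd ℂ) (x (i + 1)) * h (i + 1) (j + 1) * x (j + 1)) -
        (starRingEnd ℂ) v * v * ((a⁻¹ : ℝ) : ℂ) := by
    rw [hcv, hv, Finset.sum_mul_sum, Finset.sum_mul, ← Finset.sum_sub_distrib]
    refine Finset.sum_congr rfl fun i _ => ?_
    rw [Finset.sum_mul, ← Finset.sum_sub_distrib]
    refine Finset.sum_congr rfl fun j _ => ?_
    rw [schurStep]
    ring
  have e2 : blockForm (n + 1) h x = (∑ i ∈ Finset.range n, ∑ j ∈ Finset.range n,
        (starRingEnd ℂ) (x (i + 1)) * h (i + 1) (j + 1) * x (j + 1)) +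
        (starRingEnd ℂ) v * x 0 + ((starRingEnd ℂ) (x 0) * v +
          (starRingEnd ℂ) (x 0) * a * x 0) := by
    rw [blockForm, Finset.sum_range_succ']
    simp only [Finset.sum_range_succ']
    rw [Finset.sum_add_distrib, hcv, Finset.sum_mul, hv, Finset.mul_sum, h00]
    simp only [mul_assoc]
  have ha' : (a : ℂ) ≠ 0 := by exact_mod_cast h0
  have e3 : ((a * Complex.normSq (x 0 + v * ((a⁻¹ : ℝ) : ℂ)) : ℝ) : ℂ) =
      (a : ℂ) * ((starRingEnd ℂ) (x 0 + v * ((a⁻¹ : ℝ) : ℂ)) * (x 0 + v * ((a⁻¹ : ℝ) : ℂ))) := by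
    rw [Complex.ofReal_mul, Complex.normSq_eq_conj_mul_self]
  rw [e1, e2, e3, map_add, map_mul, Complex.conj_ofReal, Complex.ofReal_inv]
  field_simp
  ring

/-- The form is the Schur complement form plus the pivot times a square. Testing on the first basis
vector gives the pivot; choosing `x 0` so that the square vanishes gives the Schur complement.
Conversely, if all later coordinates vanish, the square alone is positive. -/
theorem blockPosDef_succ {h : ℕ → ℕ → ℂ} (hh : ∀ i j, h j i = (starRingEnd ℂ) (h i j)) (n : ℕ) :
    BlockPosDef (n + 1) h ↔ 0 < (h 0 0).re ∧ BlockPosDef n (schurStep h) := by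
  constructor
  · intro H
    have h0 : 0 < (h 0 0).re := by
      have := H (fun i => if i = 0 then 1 else 0) ⟨0, n.succ_pos, by simp⟩
      simpa [blockForm, Finset.sum_range_succ'] using this
    refine ⟨h0, fun x hx => ?_⟩
    obtain ⟨i, hi, hx⟩ := hx
    set v := ∑ j ∈ Finset.range n, h 0 (j + 1) * x j with hv
    have := H (fun i => if i = 0 then - (v * (((h 0 0).re⁻¹ : ℝ) : ℂ)) else x (i - 1))
      ⟨i + 1, by omega, by simpa using hx⟩
    rw [blockForm_succ hh h0.ne'] at this
    simpa [← hv] using this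
  · rintro ⟨h0, H⟩ x ⟨i, hi, hx⟩
    rw [blockForm_succ hh h0.ne', Complex.add_re, Complex.ofReal_re]
    by_cases hy : ∃ i < n, x (i + 1) ≠ 0
    · exact add_pos_of_pos_of_nonneg (H _ hy) (mul_nonneg h0.le (Complex.normSq_nonneg _))
    · push Not at hy
      have hx0 : x 0 ≠ 0 := by
        cases i with
        | zero => exact hx
        | succ i => exact absurd (hy i (by omega)) hx
      have e : ∑ j ∈ Finset.range n, h 0 (j + 1) * x (j + 1) = 0 :=
        Finset.sum_eq_zero fun j hj => by rw [hy j (Finset.mem_range.1 hj), mul_zero]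
      have e' : blockForm n (schurStep h) (fun i => x (i + 1)) = 0 :=
        Finset.sum_eq_zero fun i hi => Finset.sum_eq_zero fun j hj => by
          simp [hy j (Finset.mem_range.1 hj)]
      rw [e, e', zero_mul, add_zero, Complex.zero_re, zero_add]
      exact mul_pos h0 (Complex.normSq_pos.2 hx0)

/-- One elimination step on a table, together with a flag recording the sign of the pivot. -/
def pivotStep (n : ℕ) (q : List (List ℂ) × ℝ) : List (List ℂ) × ℝ :=
  (table n (schurStep (tableGet q.1)), if 0 < (tableGet q.1 0 0).re then q.2 else 0)

/-- The flag after `n` elimination steps: positive if all pivots are. -/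
def pivotFlag (n : ℕ) (T : List (List ℂ)) : ℝ :=
  ((List.range n).foldl (fun q _ => pivotStep n q) (T, 1)).2

/-- The table keeps its size `n` while the relevant block shrinks; `m ≤ n` keeps that block within
the table, where zero padding is harmless. A nonpositive pivot sets the flag to `0` for good, so
later entries no longer matter. -/
theorem pivotStep_iterate_pos (n : ℕ) {m : ℕ} (hm : m ≤ n) (T : List (List ℂ)) (r : ℝ)
    (hT : ∀ i j, tableGet T j i = (starRingEnd ℂ) (tableGet T i j)) :
    0 < ((pivotStep n)^[m] (T, r)).2 ↔ 0 < r ∧ BlockPosDef m (tableGet T) := by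
  induction m generalizing T r with
  | zero =>
    simp [BlockPosDef]
  | succ m ih =>
    rw [Function.iterate_succ_apply, pivotStep, ih (by omega), blockPosDef_succ hT]
    · have : BlockPosDef m (tableGet (table n (schurStep (tableGet T)))) ↔
          BlockPosDef m (schurStep (tableGet T)) :=
        BlockPosDef.congr fun i hi j hj => by
          rw [tableGet_table, if_pos ⟨by omega, by omega⟩]
      rw [this]
      by_cases h : 0 < (tableGet T 0 0).re <;> simp [h]
    · intro i j
      rw [tableGet_table, tableGet_table]
      by_cases hi : i < n <;> by_cases hj : j < n <;> simp [hi, hj, schurStep_conj hT i j]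

theorem pivotFlag_pos_iff (n : ℕ) (h : ℕ → ℕ → ℂ) (hh : ∀ i j, h j i = (starRingEnd ℂ) (h i j)) :
    0 < pivotFlag n (table n h) ↔ BlockPosDef n h := by
  rw [pivotFlag, List.foldl_const, List.length_range, pivotStep_iterate_pos n le_rfl]
  · rw [BlockPosDef.congr (h' := h) fun i hi j hj => by
      rw [tableGet_table, if_pos ⟨hi, hj⟩]]
    simp
  · intro i j
    rw [tableGet_table, tableGet_table]
    by_cases hi : i < n <;> by_cases hj : j < n <;> simp [hi, hj, hh i j]

/-! ### Lower norms of matrices -/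

theorem norm_sq_matOp {n : ℕ} (M : Matrix (Fin n) (Fin n) ℂ) (x : EuclideanSpace ℂ (Fin n)) :
    ‖matOp M x‖ ^ 2 = ∑ i, ‖∑ j, M i j * x j‖ ^ 2 := by
  rw [EuclideanSpace.norm_sq_eq]
  simp [Matrix.mulVec, dotProduct]

/-- By compactness of the unit sphere the infimum is attained, and scaling removes the
normalisation. With `n = 0` the sphere would be empty. -/
theorem lowerNorm_le_iff {n : ℕ} (hn : 0 < n) (M : Matrix (Fin n) (Fin n) ℂ) (e : ℝ) :
    lowerNorm M ≤ e ↔ ∃ x : EuclideanSpace ℂ (Fin n), x ≠ 0 ∧ ‖matOp M x‖ ≤ e * ‖x‖ := by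
  have : NeZero n := ⟨hn.ne'⟩
  have hS : {r : ℝ | ∃ x : EuclideanSpace ℂ (Fin n), ‖x‖ = 1 ∧ r = ‖matOp M x‖} =
      (fun x => ‖matOp M x‖) '' Metric.sphere 0 1 := by
    ext r; simp [eq_comm]
  have hc : IsCompact ((fun x => ‖matOp M x‖) '' Metric.sphere 0 1) :=
    (isCompact_sphere _ _).image (matOp M).continuous.norm
  have hb : BddBelow ((fun x => ‖matOp M x‖) '' Metric.sphere 0 1) :=
    ⟨0, by rintro _ ⟨x, -, rfl⟩; exact norm_nonneg _⟩
  unfold lowerNorm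
  rw [hS]
  constructor
  · intro h
    have hne : ((fun x => ‖matOp M x‖) '' Metric.sphere 0 1).Nonempty :=
      ((NormedSpace.sphere_nonempty (x := (0 : EuclideanSpace ℂ (Fin n)))).2 zero_le_one).image _
    obtain ⟨x, hx, hx'⟩ := hc.sInf_mem hne
    rw [mem_sphere_zero_iff_norm] at hx
    refine ⟨x, fun h0 => by simp [h0] at hx, ?_⟩
    rw [hx, mul_one]
    exact hx'.trans_le h
  · rintro ⟨x, hx, hx'⟩
    have hx0 : 0 < ‖x‖ := norm_pos_iff.2 hx
    refine (csInf_le hb ⟨((‖x‖⁻¹ : ℝ) : ℂ) • x, ?_, rfl⟩).trans ?_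
    · rw [mem_sphere_zero_iff_norm, norm_smul]
      simp [hx0.ne']
    · simp only [map_smul, norm_smul, Complex.norm_real, norm_inv, norm_norm]
      rw [inv_mul_le_iff₀ hx0, mul_comm]
      exact hx'

/-! ### Enumeration of words, matrices and grid points -/

/-- All words of length `n` over the given letters. -/
def words (L : List ℂ) (n : ℕ) : List (List ℂ) :=
  (List.range n).foldl (fun acc _ => acc.flatMap fun w => L.map fun a => a :: w) [[]]

theorem mem_words {L : List ℂ} {n : ℕ} {w : List ℂ} :
    w ∈ words L n ↔ w.length = n ∧ ∀ a ∈ w, a ∈ L := by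
  induction n generalizing w with
  | zero =>
    simp only [words, List.range_zero, List.foldl_nil, List.mem_singleton]
    constructor
    · rintro rfl; simp
    · exact fun h => List.length_eq_zero_iff.1 h.1
  | succ n ih =>
    have : words L (n + 1) = (words L n).flatMap fun w => L.map fun a => a :: w := by
      rw [words, List.range_succ, List.foldl_append]; rfl
    rw [this]
    simp only [List.mem_flatMap, List.mem_map, ih]
    constructor
    · rintro ⟨v, ⟨hv, hv'⟩, a, ha, rfl⟩
      exact ⟨by simp [hv], by simpa using ⟨ha, hv'⟩⟩
    · rintro ⟨hw, hw'⟩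
      match w, hw, hw' with
      | a :: v, hw, hw' =>
        exact ⟨v, ⟨by simpa using hw, fun b hb => hw' b (by simp [hb])⟩, a, hw' a (by simp), rfl⟩

/-- The entries of the periodised tridiagonal matrix whose diagonals, continued by the corner
entries, are the given words. -/
def perEntry (n : ℕ) (t : ℂ) (a b c : List ℂ) (i j : ℕ) : ℂ :=
  (if i = j + 1 then a.getD j 0 else 0) + (if i = j then b.getD i 0 else 0) +
    (if j = i + 1 then c.getD i 0 else 0) +
    ((if i = 0 ∧ j + 1 = n then t * a.getD j 0 else 0) +
      (if i + 1 = n ∧ j = 0 then (starRingEnd ℂ) t * c.getD i 0 else 0))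

/-- The periodised tridiagonal matrix given by three words. -/
def perMatrix (n : ℕ) (t : ℂ) (a b c : List ℂ) : Matrix (Fin n) (Fin n) ℂ :=
  Matrix.of fun i j => perEntry n t a b c i j

/-- The `n - 1` entries of an off-diagonal and its corner entry together form one word of length
`n`, with the corner as last letter. Subdiagonal letters are indexed by column and superdiagonal
letters by row, so in both cases the last index is the free one. -/
theorem mem_periodisedMatrices_iff {n : ℕ} (hn : 0 < n) {t : ℂ} {La Lb Lc : List ℂ}
    {B : Matrix (Fin n) (Fin n) ℂ} :
    B ∈ periodisedMatrices n t (listSet La) (listSet Lb) (listSet Lc) ↔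
      ∃ a ∈ words La n, ∃ b ∈ words Lb n, ∃ c ∈ words Lc n, B = perMatrix n t a b c := by
  have getD_ofFn : ∀ (f : Fin n → ℂ) (i : Fin n), (List.ofFn f).getD i 0 = f i := by
    intro f i; simp [List.getD_eq_getElem?_getD]
  have getD_mem : ∀ (l L : List ℂ) (_ : l ∈ words L n) (i : ℕ) (_ : i < n), l.getD i 0 ∈ L := by
    intro l L hl i hi
    rw [mem_words] at hl
    rw [List.getD_eq_getElem _ _ (by omega)]
    exact hl.2 _ (List.getElem_mem _)
  constructor
  · rintro ⟨M, hM, N, ⟨x, hx, y, hy, hN⟩, rfl⟩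
    let f : Fin n → ℂ := fun j => if h : (j : ℕ) + 1 < n then M ⟨j + 1, h⟩ j else x
    let g : Fin n → ℂ := fun j => M j j
    let k : Fin n → ℂ := fun i => if h : (i : ℕ) + 1 < n then M i ⟨i + 1, h⟩ else y
    refine ⟨List.ofFn f, ?_, List.ofFn g, ?_, List.ofFn k, ?_, ?_⟩
    · refine mem_words.2 ⟨by simp, fun a ha => ?_⟩
      obtain ⟨j, rfl⟩ := (List.mem_ofFn' _ _).1 ha
      by_cases h : (j : ℕ) + 1 < n
      · simp only [f, h, dif_pos]
        exact (hM ⟨j + 1, h⟩ j).1 rfl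
      · simp only [f, h, dif_neg, not_false_eq_true]
        exact hx
    · refine mem_words.2 ⟨by simp, fun a ha => ?_⟩
      obtain ⟨j, rfl⟩ := (List.mem_ofFn' _ _).1 ha
      exact (hM j j).2.1 rfl
    · refine mem_words.2 ⟨by simp, fun a ha => ?_⟩
      obtain ⟨i, rfl⟩ := (List.mem_ofFn' _ _).1 ha
      by_cases h : (i : ℕ) + 1 < n
      · simp only [k, h, dif_pos]
        exact (hM i ⟨i + 1, h⟩).2.2.1 rfl
      · simp only [k, h, dif_neg, not_false_eq_true]
        exact hy
    · ext i j
      simp only [perMatrix, perEntry, Matrix.of_apply, Matrix.add_apply, getD_ofFn, hN]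
      have e1 : (j : ℕ) + 1 = n → f j = x := fun h => dif_neg (by omega)
      have e2 : (i : ℕ) + 1 = n → k i = y := fun h => dif_neg (by omega)
      congr 1
      · by_cases h1 : (i : ℕ) = j + 1
        · have hi : (⟨(j : ℕ) + 1, by omega⟩ : Fin n) = i := Fin.ext h1.symm
          have : f j = M i j := by
            simp only [f]; rw [dif_pos (by omega), hi]
          rw [if_pos h1, if_neg (by omega), if_neg (by omega), this]; simp
        by_cases h2 : i = j
        · subst h2
          simp [g]
        by_cases h3 : (j : ℕ) = i + 1
        · have hj : (⟨(i : ℕ) + 1, by omega⟩ : Fin n) = j := Fin.ext h3.symm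
          have : k i = M i j := by
            simp only [k]; rw [dif_pos (by omega), hj]
          rw [if_neg h1, if_neg (by omega), if_pos h3, this]; simp
        rw [(hM i j).2.2.2 h1 h2 h3, if_neg h1, if_neg (fun h => h2 (Fin.ext h)), if_neg h3]
        simp
      · congr 1
        · by_cases h : (i : ℕ) = 0 ∧ (j : ℕ) + 1 = n
          · rw [if_pos h, if_pos h, e1 h.2]
          · rw [if_neg h, if_neg h]
        · by_cases h : (i : ℕ) + 1 = n ∧ (j : ℕ) = 0
          · rw [if_pos h, if_pos h, e2 h.1]
          · rw [if_neg h, if_neg h]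
  · rintro ⟨a, ha, b, hb, c, hc, rfl⟩
    refine ⟨Matrix.of fun i j : Fin n => (if (i : ℕ) = j + 1 then a.getD j 0 else 0) +
      (if (i : ℕ) = j then b.getD i 0 else 0) + (if (j : ℕ) = i + 1 then c.getD i 0 else 0), ?_,
      Matrix.of fun i j : Fin n =>
        ((if (i : ℕ) = 0 ∧ (j : ℕ) + 1 = n then t * a.getD j 0 else 0) +
        (if (i : ℕ) + 1 = n ∧ (j : ℕ) = 0 then (starRingEnd ℂ) t * c.getD i 0 else 0)),
      ⟨a.getD (n - 1) 0, getD_mem a La ha _ (by omega), c.getD (n - 1) 0,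
        getD_mem c Lc hc _ (by omega), ?_⟩, rfl⟩
    · intro i j
      simp only [Matrix.of_apply]
      refine ⟨fun h => ?_, fun h => ?_, fun h => ?_, fun h1 h2 h3 => ?_⟩
      · rw [if_pos h, if_neg (by omega), if_neg (by omega), add_zero, add_zero]
        exact getD_mem a La ha _ j.2
      · subst h
        rw [if_neg (by omega), if_pos rfl, if_neg (by omega), add_zero, zero_add]
        exact getD_mem b Lb hb _ i.2
      · rw [if_neg (by omega), if_neg (by omega), if_pos h, add_zero, zero_add]
        exact getD_mem c Lc hc _ i.2
      · rw [if_neg h1, if_neg (fun h => h2 (Fin.ext h)), if_neg h3, add_zero, add_zero]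
    · intro i j
      simp only [Matrix.of_apply]
      congr 1
      · by_cases h : (i : ℕ) = 0 ∧ (j : ℕ) + 1 = n
        · rw [if_pos h, if_pos h, show (j : ℕ) = n - 1 by omega]
        · rw [if_neg h, if_neg h]
      · by_cases h : (i : ℕ) + 1 = n ∧ (j : ℕ) = 0
        · rw [if_pos h, if_pos h, show (i : ℕ) = n - 1 by omega]
        · rw [if_neg h, if_neg h]

/-- The Gram matrix of the shifted periodised matrix, minus `e²` on the diagonal. -/
def gramEntry (n : ℕ) (t : ℂ) (a b c : List ℂ) (z : ℂ) (e : ℝ) (i j : ℕ) : ℂ :=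
  ((List.range n).map fun k =>
    (starRingEnd ℂ) (perEntry n t a b c k i - if k = i then z else 0) *
      (perEntry n t a b c k j - if k = j then z else 0)).sum -
        if i = j then ((e * e : ℝ) : ℂ) else 0

theorem gramEntry_conj (n : ℕ) (t : ℂ) (a b c : List ℂ) (z : ℂ) (e : ℝ) (i j : ℕ) :
    gramEntry n t a b c z e j i = (starRingEnd ℂ) (gramEntry n t a b c z e i j) := by
  unfold gramEntry
  rw [map_sub, map_list_sum, List.map_map]
  congr 2
  · refine List.map_congr_left fun k _ => ?_
    simp [mul_comm]
  · by_cases h : i = j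
    · rw [if_pos h, if_pos h.symm, Complex.conj_ofReal]
    · rw [if_neg h, if_neg (Ne.symm h), map_zero]

/-- The Hermitian form of the shifted Gram matrix at `y` is `‖M y‖² - (e ‖y‖)²`, and a nonzero
vector where it is nonpositive is what the lower norm asks for. Nonnegativity of `e` permits passing
between norms and squares. -/
theorem lowerNorm_perMatrix_le_iff {n : ℕ} (hn : 0 < n) (t : ℂ) (a b c : List ℂ) (z : ℂ) {e : ℝ}
    (he : 0 ≤ e) :
    lowerNorm (perMatrix n t a b c - z • (1 : Matrix (Fin n) (Fin n) ℂ)) ≤ e ↔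
      ¬ BlockPosDef n (gramEntry n t a b c z e) := by
  set M := perMatrix n t a b c - z • (1 : Matrix (Fin n) (Fin n) ℂ) with hM
  have hMe : ∀ i j : Fin n,
      M i j = perEntry n t a b c i j - if (i : ℕ) = j then z else 0 := by
    intro i j
    simp only [hM, perMatrix, Matrix.sub_apply, Matrix.of_apply, Matrix.smul_apply,
      Matrix.one_apply, smul_eq_mul, Fin.ext_iff]
    split_ifs <;> simp
  have key : ∀ (x : ℕ → ℂ) (y : EuclideanSpace ℂ (Fin n)), (∀ i : Fin n, y i = x i) →
      (blockForm n (gramEntry n t a b c z e) x).re = ‖matOp M y‖ ^ 2 - (e * ‖y‖) ^ 2 := by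
    intro x y hxy
    have e1 : blockForm n (gramEntry n t a b c z e) x =
        ∑ k : Fin n, (starRingEnd ℂ) (∑ i : Fin n, M k i * y i) * (∑ j : Fin n, M k j * y j) -
          ∑ i : Fin n, (starRingEnd ℂ) (y i) * ((e * e : ℝ) : ℂ) * y i := by
      have e2 : ∀ i j : Fin n, gramEntry n t a b c z e i j =
          (∑ k : Fin n, (starRingEnd ℂ) (M k i) * M k j) -
            if i = j then ((e * e : ℝ) : ℂ) else 0 := by
        intro i j
        simp only [gramEntry, hMe, Fin.ext_iff]
        congr 1
        exact Finset.sum_range fun k => (starRingEnd ℂ)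
          (perEntry n t a b c k i - if k = i then z else 0) *
            (perEntry n t a b c k j - if k = j then z else 0)
      rw [blockForm, Finset.sum_range]
      simp only [Finset.sum_range, e2, hxy, mul_sub, sub_mul, Finset.sum_sub_distrib]
      congr 1
      · simp only [map_sum, Finset.sum_mul, Finset.mul_sum, map_mul]
        have : ∀ i : Fin n, (∑ j : Fin n, ∑ k : Fin n,
            (starRingEnd ℂ) (x i) * ((starRingEnd ℂ) (M k i) * M k j) * x j) =
            ∑ k : Fin n, ∑ j : Fin n,
              (starRingEnd ℂ) (x i) * ((starRingEnd ℂ) (M k i) * M k j) * x j :=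
          fun i => Finset.sum_comm
        simp only [this]
        rw [Finset.sum_comm]
        refine Finset.sum_congr rfl fun k _ => ?_
        rw [Finset.sum_comm]
        refine Finset.sum_congr rfl fun i _ => Finset.sum_congr rfl fun j _ => by ring
      · refine Finset.sum_congr rfl fun i _ => ?_
        simp
    rw [e1, Complex.sub_re, norm_sq_matOp, mul_pow, EuclideanSpace.norm_sq_eq, Finset.mul_sum,
      Complex.re_sum, Complex.re_sum]
    congr 1
    · refine Finset.sum_congr rfl fun k _ => ?_
      rw [← Complex.normSq_eq_conj_mul_self, Complex.ofReal_re, Complex.normSq_eq_norm_sq]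
    · refine Finset.sum_congr rfl fun k _ => ?_
      rw [mul_right_comm, ← Complex.normSq_eq_conj_mul_self, ← Complex.ofReal_mul,
        Complex.ofReal_re, Complex.normSq_eq_norm_sq]
      ring
  rw [lowerNorm_le_iff hn]
  unfold BlockPosDef
  push Not
  constructor
  · rintro ⟨y, hy, hy'⟩
    refine ⟨fun i => if h : i < n then y ⟨i, h⟩ else 0, ?_, ?_⟩
    · by_contra hc
      push Not at hc
      refine hy ?_
      ext i
      simpa using hc i i.2
    · rw [key _ y fun i => by simp, sub_nonpos]
      exact pow_le_pow_left₀ (norm_nonneg _) hy' 2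
  · rintro ⟨x, ⟨i, hi, hx⟩, hx'⟩
    refine ⟨WithLp.toLp 2 fun i => x i, fun h => hx ?_, ?_⟩
    · exact congrArg (fun v : EuclideanSpace ℂ (Fin n) => v ⟨i, hi⟩) h
    · rw [key x (WithLp.toLp 2 fun i => x i) fun i => rfl, sub_nonpos] at hx'
      exact (pow_le_pow_iff_left₀ (norm_nonneg _) (by positivity) two_ne_zero).1 hx'

/-- The list of grid points in a disc. -/
def gridList (n : ℕ) (r : ℝ) : List ℂ :=
  ((((List.range (2 * ⌈n * r⌉₊ + 1)).map fun i : ℕ => ((i : ℝ) - ⌈n * r⌉₊) / n).flatMap fun x =>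
    ((List.range (2 * ⌈n * r⌉₊ + 1)).map fun i : ℕ => ((i : ℝ) - ⌈n * r⌉₊) / n).map fun y =>
      (⟨x, y⟩ : ℂ)).filter fun z => z.re * z.re + z.im * z.im < r * r)

theorem mem_gridList {n : ℕ} (hn : 0 < n) {r : ℝ} (hr : 0 < r) (z : ℂ) :
    z ∈ gridList n r ↔ z ∈ grid n r := by
  have hn' : (0 : ℝ) < n := by exact_mod_cast hn
  -- Moduli are compared through their squares because the machine has no square root.
  have hlt : z.re * z.re + z.im * z.im < r * r ↔ ‖z‖ < r := by
    rw [← Complex.normSq_apply, Complex.normSq_eq_norm_sq, ← sq,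
      pow_lt_pow_iff_left₀ (norm_nonneg _) hr.le two_ne_zero]
  have hz : ∀ a b : ℤ, z = ((a : ℂ) + (b : ℂ) * Complex.I) / (n : ℂ) ↔
      z.re = a / n ∧ z.im = b / n := by
    intro a b
    have : ((a : ℂ) + (b : ℂ) * Complex.I) / (n : ℂ) = ⟨(a : ℝ) / n, (b : ℝ) / n⟩ := by
      rw [← Complex.ofReal_natCast]
      apply Complex.ext
      · rw [Complex.div_ofReal_re]; simp
      · rw [Complex.div_ofReal_im]; simp
    rw [this, Complex.ext_iff]
  set K := ⌈n * r⌉₊ with hK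
  have coord : ∀ a : ℤ, |(a : ℝ) / n| < r → ∃ i < 2 * K + 1, ((i : ℝ) - K) / n = a / n := by
    intro a ha
    rw [abs_div, abs_of_pos hn', div_lt_iff₀ hn'] at ha
    have h1 : |(a : ℝ)| < K := ha.trans_le (by rw [mul_comm]; exact Nat.le_ceil _)
    rw [← Int.cast_abs, ← Int.cast_natCast (R := ℝ) K, Int.cast_lt, abs_lt] at h1
    refine ⟨(a + K).toNat, by omega, ?_⟩
    have : (((a + K).toNat : ℕ) : ℝ) = a + K := by
      have h2 : (((a + K).toNat : ℤ)) = a + K := Int.toNat_of_nonneg (by omega)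
      exact_mod_cast h2
    rw [this, add_sub_cancel_right]
  simp only [gridList, List.mem_filter, List.mem_flatMap, List.mem_map, List.mem_range,
    decide_eq_true_eq, hlt, grid, Set.mem_ofPred_eq, hz, ← hK]
  refine and_congr_left fun hzr => ?_
  constructor
  · rintro ⟨x, ⟨i, -, rfl⟩, y, ⟨j, -, rfl⟩, rfl⟩
    exact ⟨(i : ℤ) - K, (j : ℤ) - K, by push_cast; exact ⟨rfl, rfl⟩⟩
  · rintro ⟨a, b, ha, hb⟩
    obtain ⟨i, hi, hi'⟩ := coord a (ha ▸ (Complex.abs_re_le_norm z).trans_lt hzr)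
    obtain ⟨j, hj, hj'⟩ := coord b (hb ▸ (Complex.abs_im_le_norm z).trans_lt hzr)
    exact ⟨_, ⟨i, hi, rfl⟩, _, ⟨j, hj, rfl⟩, Complex.ext (hi'.trans ha.symm) (hj'.trans hb.symm)⟩

/-! ### The algorithm -/

/-- The list of the elements of the finite approximation, computed from the input. -/
def piFinList (n : ℕ) (t : ℂ) (b : ℝ × ℝ × ℝ) (s : List ℂ × List ℂ × List ℂ) : List ℂ :=
  open Classical in
  (gridList n (b.1 + b.2.1 + b.2.2)).filter fun z =>
    ∃ u ∈ words s.1 n, ∃ v ∈ words s.2.1 n, ∃ w ∈ words s.2.2 n,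
      ¬ 0 < pivotFlag n (table n (gramEntry n t u v w z
        ((b.1 + b.2.2) * (22 / (7 * (n : ℝ))) + 3 / (n : ℝ))))

theorem listSet_piFinList {n : ℕ} (hn : 0 < n) (t : ℂ) (b : Bounds) (s : Nets)
    (hb : 0 < b.radius) (hag : 0 ≤ b.α + b.γ) :
    listSet (piFinList n t (b.α, b.β, b.γ) (s.α, s.β, s.γ)) = piFin t n b s := by
  have he : 0 ≤ b.epsDag n + 3 / (n : ℝ) := by unfold Bounds.epsDag; positivity
  ext z
  simp only [listSet, piFinList, Set.mem_ofPred_eq, List.mem_filter, decide_eq_true_eq]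
  have hg : z ∈ gridList n (b.α + b.β + b.γ) ↔ z ∈ grid n b.radius := mem_gridList hn hb z
  rw [hg, piFin, Set.mem_inter_iff, and_comm]
  refine and_congr_left fun _ => ?_
  have : ∀ u v w, (¬ 0 < pivotFlag n (table n (gramEntry n t u v w z
      ((b.α + b.γ) * (22 / (7 * (n : ℝ))) + 3 / (n : ℝ))))) ↔
      lowerNorm (perMatrix n t u v w - z • (1 : Matrix (Fin n) (Fin n) ℂ)) ≤
        b.epsDag n + 3 / (n : ℝ) := by
    intro u v w
    rw [pivotFlag_pos_iff _ _ (gramEntry_conj n t u v w z _),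
      lowerNorm_perMatrix_le_iff hn _ _ _ _ _ he]
    rfl
  simp only [this, deltaFin, Set.mem_ofPred_eq, mem_periodisedMatrices_iff hn]
  constructor
  · rintro ⟨u, hu, v, hv, w, hw, h⟩
    exact ⟨_, ⟨u, hu, v, hv, w, hw, rfl⟩, h⟩
  · rintro ⟨_, ⟨u, hu, v, hv, w, hw, rfl⟩, h⟩
    exact ⟨u, hu, v, hv, w, hw, h⟩

/-! ### Computability of the ingredients of the algorithm -/

namespace IsComp

variable {σ : Type} [Enc σ]

theorem table {n : σ → ℕ} {f : σ → ℕ → ℕ → ℂ} (hn : IsComp n)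
    (hf : IsComp fun q : (σ × ℕ) × ℕ => f q.1.1 q.1.2 q.2) :
    IsComp fun s => table (n s) (f s) :=
  map (f := fun s i => (List.range (n s)).map fun j => f s i j) hn.range
    (map (f := fun (q : σ × ℕ) j => f q.1 q.2 j) (hn.comp id.fst).range hf)

theorem tableGet {T : σ → List (List ℂ)} {i j : σ → ℕ} (hT : IsComp T) (hi : IsComp i)
    (hj : IsComp j) : IsComp fun s => tableGet (T s) (i s) (j s) :=
  (hT.getD hi nil).getD hj czero

theorem schurStep {T : σ → List (List ℂ)} {i j : σ → ℕ} (hT : IsComp T) (hi : IsComp i)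
    (hj : IsComp j) : IsComp fun s => schurStep (TridiagSpec.tableGet (T s)) (i s) (j s) :=
  (hT.tableGet hi.succ hj.succ).csub (((hT.tableGet hi.succ (nat 0)).cmul
    (hT.tableGet (nat 0) hj.succ)).cmul (hT.tableGet (nat 0) (nat 0)).re.inv.ofReal)

theorem pivotFlag {n : σ → ℕ} {T : σ → List (List ℂ)} (hn : IsComp n) (hT : IsComp T) :
    IsComp fun s => pivotFlag (n s) (T s) := by
  refine (foldl (f := fun s q _ => pivotStep (n s) q) hn.range (hT.pair one) ?_).snd
  refine pair (table (f := fun (q : σ × (List (List ℂ) × ℝ) × ℕ) =>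
    TridiagSpec.schurStep (TridiagSpec.tableGet q.2.1.1)) (hn.comp id.fst) ?_) ?_
  · exact schurStep id.fst.fst.snd.fst.fst id.fst.snd id.snd
  · exact ite (IsTest.lt zero (tableGet id.snd.fst.fst (nat 0) (nat 0)).re) id.snd.fst.snd zero

theorem words {L : σ → List ℂ} {n : σ → ℕ} (hL : IsComp L) (hn : IsComp n) :
    IsComp fun s => words (L s) (n s) :=
  foldl (f := fun s (acc : List (List ℂ)) _ => acc.flatMap fun w => (L s).map fun a => a :: w)
    hn.range (nil.cons nil)
    (flatMap (f := fun (q : σ × List (List ℂ) × ℕ) w => (L q.1).map fun a => a :: w) id.snd.fst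
      (map (f := fun (q : (σ × List (List ℂ) × ℕ) × List ℂ) a => a :: q.2)
        (hL.comp id.fst.fst) (id.snd.cons id.fst.snd)))

theorem perEntry {n i j : σ → ℕ} {t : σ → ℂ} {a b c : σ → List ℂ} (hn : IsComp n)
    (ht : IsComp t) (ha : IsComp a) (hb : IsComp b) (hc : IsComp c) (hi : IsComp i)
    (hj : IsComp j) : IsComp fun s => perEntry (n s) (t s) (a s) (b s) (c s) (i s) (j s) :=
  (((ite (IsTest.natEq hi hj.succ) (ha.getD hj czero) czero).cadd
    (ite (IsTest.natEq hi hj) (hb.getD hi czero) czero)).cadd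
    (ite (IsTest.natEq hj hi.succ) (hc.getD hi czero) czero)).cadd
    ((ite ((IsTest.natEq hi (nat 0)).and (IsTest.natEq hj.succ hn))
      (ht.cmul (ha.getD hj czero)) czero).cadd
    (ite ((IsTest.natEq hi.succ hn).and (IsTest.natEq hj (nat 0)))
      (ht.conj.cmul (hc.getD hi czero)) czero))

theorem gramEntry {n i j : σ → ℕ} {t z : σ → ℂ} {a b c : σ → List ℂ} {e : σ → ℝ} (hn : IsComp n)
    (ht : IsComp t) (ha : IsComp a) (hb : IsComp b) (hc : IsComp c) (hz : IsComp z)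
    (he : IsComp e) (hi : IsComp i) (hj : IsComp j) :
    IsComp fun s => gramEntry (n s) (t s) (a s) (b s) (c s) (z s) (e s) (i s) (j s) := by
  have h : ∀ {k : σ → ℕ}, IsComp k → IsComp fun q : σ × ℕ =>
      TridiagSpec.perEntry (n q.1) (t q.1) (a q.1) (b q.1) (c q.1) q.2 (k q.1) -
        if q.2 = k q.1 then z q.1 else 0 := fun hk =>
    (perEntry (hn.comp id.fst) (ht.comp id.fst) (ha.comp id.fst) (hb.comp id.fst)
      (hc.comp id.fst) id.snd (hk.comp id.fst)).csub
      (ite (IsTest.natEq id.snd (hk.comp id.fst)) (hz.comp id.fst) czero)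
  exact (csum (map (f := fun s k =>
    (starRingEnd ℂ) (TridiagSpec.perEntry (n s) (t s) (a s) (b s) (c s) k (i s) -
      if k = i s then z s else 0) *
      (TridiagSpec.perEntry (n s) (t s) (a s) (b s) (c s) k (j s) - if k = j s then z s else 0))
    hn.range ((h hi).conj.cmul (h hj)))).csub
    (ite (IsTest.natEq hi hj) (he.mul he).ofReal czero)

theorem gridList {n : σ → ℕ} {r : σ → ℝ} (hn : IsComp n) (hr : IsComp r) :
    IsComp fun s => gridList (n s) (r s) := by
  have hK : IsComp fun s => ⌈(n s : ℝ) * r s⌉₊ := (hn.castNat.mul hr).ceil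
  have hK' : IsComp fun s => 2 * ⌈(n s : ℝ) * r s⌉₊ + 1 :=
    succ ((hK.castNat.add hK.castNat).of_enc_eq (fun s => s) (fun _ => rfl) fun s => by
      simp [enc_nat, enc_real, two_mul])
  have hL : IsComp fun s => (List.range (2 * ⌈(n s : ℝ) * r s⌉₊ + 1)).map
      fun i : ℕ => ((i : ℝ) - ⌈(n s : ℝ) * r s⌉₊) / n s :=
    map (f := fun s (i : ℕ) => ((i : ℝ) - ⌈(n s : ℝ) * r s⌉₊) / n s) hK'.range
      ((id.snd.castNat.sub (hK.castNat.comp id.fst)).div (hn.castNat.comp id.fst))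
  refine filter (c := fun s (z : ℂ) => z.re * z.re + z.im * z.im < r s * r s) ?_
    (IsTest.lt ((id.snd.re.mul id.snd.re).add (id.snd.im.mul id.snd.im))
      ((hr.mul hr).comp id.fst))
  exact flatMap hL (map (hL.comp id.fst) (mkComplex id.fst.snd id.snd))

theorem piFinList : IsComp fun s : ℕ × ℂ × (ℝ × ℝ × ℝ) × (List ℂ × List ℂ × List ℂ) =>
    piFinList s.1 s.2.1 s.2.2.1 s.2.2.2 := by
  have hn : IsComp fun s : ℕ × ℂ × (ℝ × ℝ × ℝ) × (List ℂ × List ℂ × List ℂ) => s.1 := id.fst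
  have ht : IsComp fun s : ℕ × ℂ × (ℝ × ℝ × ℝ) × (List ℂ × List ℂ × List ℂ) => s.2.1 := id.snd.fst
  have hb : IsComp fun s : ℕ × ℂ × (ℝ × ℝ × ℝ) × (List ℂ × List ℂ × List ℂ) => s.2.2.1 :=
    id.snd.snd.fst
  have hs : IsComp fun s : ℕ × ℂ × (ℝ × ℝ × ℝ) × (List ℂ × List ℂ × List ℂ) => s.2.2.2 :=
    id.snd.snd.snd
  have he : IsComp fun s : ℕ × ℂ × (ℝ × ℝ × ℝ) × (List ℂ × List ℂ × List ℂ) =>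
      (s.2.2.1.1 + s.2.2.1.2.2) * (22 / (7 * (s.1 : ℝ))) + 3 / (s.1 : ℝ) :=
    ((hb.fst.add hb.snd.snd).mul ((natLit 22).div ((natLit 7).mul hn.castNat))).add
      ((natLit 3).div hn.castNat)
  refine filter (gridList hn ((hb.fst.add hb.snd.fst).add hb.snd.snd)) ?_
  refine IsTest.exists_mem (words (hs.fst.comp id.fst) (hn.comp id.fst)) ?_
  refine IsTest.exists_mem (words (hs.snd.fst.comp id.fst.fst) (hn.comp id.fst.fst)) ?_
  refine IsTest.exists_mem (words (hs.snd.snd.comp id.fst.fst.fst) (hn.comp id.fst.fst.fst)) ?_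
  refine (IsTest.lt zero (pivotFlag (hn.comp id.fst.fst.fst.fst) (table
    (hn.comp id.fst.fst.fst.fst) ?_))).not
  exact gramEntry (hn.comp id.fst.fst.fst.fst.fst.fst) (ht.comp id.fst.fst.fst.fst.fst.fst)
    id.fst.fst.fst.fst.snd id.fst.fst.fst.snd id.fst.fst.snd id.fst.fst.fst.fst.fst.snd
    (he.comp id.fst.fst.fst.fst.fst.fst) id.fst.snd id.snd

end IsComp

theorem encInput_eq (n : ℕ) (t : ℂ) (b : Bounds) (s : Nets) :
    encInput n t b s = Enc.enc (n, t, (b.α, b.β, b.γ), (s.α, s.β, s.γ)) := by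
  simp only [encInput, enc_pair, encNets, ← enc_list_complex]
  rfl

/-- One program computes the finite approximation from the input, with any oracle. -/
theorem exists_prog_piFin : ∃ p : Prog, ∀ (O : ℕ → RData) (n : ℕ) (t : ℂ) (b : Bounds) (s : Nets),
    Halts O p (encInput n t b s)
      (encList (piFinList n t (b.α, b.β, b.γ) (s.α, s.β, s.γ))) := by
  obtain ⟨p, hp⟩ := IsComp.piFinList
  refine ⟨p, fun O n t b s => ?_⟩
  rw [encInput_eq, ← enc_list_complex]
  exact hp O (n, t, (b.α, b.β, b.γ), (s.α, s.β, s.γ))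

/-! ### Square summable sequences -/

theorem hasSum_norm_sq (v : E) : HasSum (fun i => ‖v i‖ ^ 2) (‖v‖ ^ 2) := by
  have h := lp.hasSum_norm (p := 2) (by norm_num) v
  simpa using h

theorem memlp_two_iff {f : ℤ → ℂ} : Memℓp f 2 ↔ Summable fun i => ‖f i‖ ^ 2 := by
  rw [memℓp_gen_iff (by norm_num)]
  simp

theorem hasSum_norm_sq_shift (v : E) (k : ℤ) :
    HasSum (fun i => ‖v (i + k)‖ ^ 2) (‖v‖ ^ 2) := by
  have h := (Equiv.hasSum_iff (f := fun i => ‖v i‖ ^ 2) (Equiv.addRight k)).2 (hasSum_norm_sq v)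
  exact h

theorem memlp_shift (v : E) (k : ℤ) : Memℓp (fun i => v (i + k)) 2 := by
  rw [memlp_two_iff]
  exact (hasSum_norm_sq_shift v k).summable

/-- The translation of sequences, `(shiftE k v) i = v (i + k)`. -/
def shiftE (k : ℤ) : E ≃ₗᵢ[ℂ] E where
  toFun v := ⟨fun i => v (i + k), memlp_shift v k⟩
  invFun v := ⟨fun i => v (i + -k), memlp_shift v (-k)⟩
  left_inv v := by
    ext i
    change v (i + -k + k) = v i
    rw [neg_add_cancel_right]
  right_inv v := by
    ext i
    change v (i + k + -k) = v i
    rw [add_neg_cancel_right]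
  map_add' _ _ := rfl
  map_smul' _ _ := rfl
  norm_map' v := by
    refine (pow_left_inj₀ (norm_nonneg _) (norm_nonneg _) two_ne_zero).1 ?_
    refine (hasSum_norm_sq _).unique ?_
    exact hasSum_norm_sq_shift v k

theorem norm_le_of_forall_norm_le {f g : E} {c : ℝ} (hc : 0 ≤ c) (h : ∀ i, ‖f i‖ ≤ c * ‖g i‖) :
    ‖f‖ ≤ c * ‖g‖ := by
  refine (pow_le_pow_iff_left₀ (norm_nonneg _) (by positivity) two_ne_zero).1 ?_
  rw [mul_pow]
  refine hasSum_le (fun i => ?_) (hasSum_norm_sq f) ((hasSum_norm_sq g).mul_left (c ^ 2))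
  rw [← mul_pow]
  exact pow_le_pow_left₀ (norm_nonneg _) (h i) 2

/-- The sequence of moduli of `v` is again square summable with the same norm, and `f` is dominated
by a combination of it and its two translates; the triangle inequality finishes. -/
theorem norm_le_of_forall_three_term {f v : E} {p q r : ℝ} (hp : 0 ≤ p) (hq : 0 ≤ q) (hr : 0 ≤ r)
    (h : ∀ i, ‖f i‖ ≤ p * ‖v (i - 1)‖ + q * ‖v i‖ + r * ‖v (i + 1)‖) :
    ‖f‖ ≤ (p + q + r) * ‖v‖ := by
  have hV : Memℓp (fun i => (‖v i‖ : ℂ)) 2 := by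
    rw [memlp_two_iff]
    simpa using (hasSum_norm_sq v).summable
  let V : E := ⟨_, hV⟩
  have hVi : ∀ i, V i = (‖v i‖ : ℂ) := fun _ => rfl
  have hVn : ‖V‖ = ‖v‖ := by
    refine (pow_left_inj₀ (norm_nonneg _) (norm_nonneg _) two_ne_zero).1 ?_
    refine (hasSum_norm_sq V).unique ?_
    simpa [hVi] using hasSum_norm_sq v
  let W : E := (p : ℂ) • shiftE (-1) V + (q : ℂ) • V + (r : ℂ) • shiftE 1 V
  have hW : ‖W‖ ≤ (p + q + r) * ‖v‖ := by
    refine (norm_add₃_le).trans ?_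
    rw [norm_smul, norm_smul, norm_smul, LinearIsometryEquiv.norm_map,
      LinearIsometryEquiv.norm_map, hVn, Complex.norm_real, Complex.norm_real, Complex.norm_real,
      Real.norm_of_nonneg hp, Real.norm_of_nonneg hq, Real.norm_of_nonneg hr]
    exact le_of_eq (by ring)
  refine le_trans ?_ hW
  have := norm_le_of_forall_norm_le (f := f) (g := W) zero_le_one fun i => ?_
  · rwa [one_mul] at this
  rw [one_mul]
  refine (h i).trans ?_
  have : W i = ((p * ‖v (i - 1)‖ + q * ‖v i‖ + r * ‖v (i + 1)‖ : ℝ) : ℂ) := by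
    push_cast
    rfl
  rw [this, Complex.norm_real]
  exact le_abs_self _

/-! ### Tridiagonal operators -/

instance : Nontrivial E :=
  ⟨⟨lp.single 2 (0 : ℤ) (1 : ℂ), 0, fun h => by
    simpa using congrArg (fun v : E => v 0) h⟩⟩

/-- A vector is the norm limit of its finite coordinate sums, so continuity gives a series over
matrix columns, of which only three meet row `i`. -/
theorem IsTridiagonal.apply {A : E →L[ℂ] E} (hA : IsTridiagonal A) (v : E) (i : ℤ) :
    A v i = subdiag A (i - 1) * v (i - 1) + diagonal A i * v i +
      superdiag A (i + 1) * v (i + 1) := by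
  have h1 := ((lp.hasSum_single (p := 2) (by norm_num) v).mapL A).mapL
    (lp.evalCLM ℂ (fun _ : ℤ => ℂ) 2 i)
  have h2 : HasSum (fun j => entry A i j * v j) (A v i) := by
    have e : ∀ j, lp.evalCLM ℂ (fun _ : ℤ => ℂ) 2 i (A (lp.single 2 j (v j))) =
        entry A i j * v j := by
      intro j
      have : (lp.single 2 j (v j) : E) = v j • lp.single 2 j (1 : ℂ) := by
        rw [← lp.single_smul, smul_eq_mul, mul_one]
      rw [this, map_smul, map_smul, smul_eq_mul, mul_comm]
      rfl
    simp only [e] at h1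
    exact h1
  have h3 : HasSum (fun j => entry A i j * v j)
      (∑ j ∈ {i - 1, i, i + 1}, entry A i j * v j) := by
    refine hasSum_sum_of_ne_finset_zero fun j hj => ?_
    simp only [Finset.mem_insert, Finset.mem_singleton, not_or] at hj
    rw [hA i j ?_, zero_mul]
    rw [lt_abs]
    omega
  rw [h2.unique h3, Finset.sum_insert, Finset.sum_insert, Finset.sum_singleton]
  · simp only [subdiag, diagonal, superdiag, sub_add_cancel, add_sub_cancel_right]
    ring
  · simp
  · simp only [Finset.mem_insert, Finset.mem_singleton]
    omega

theorem entry_adjoint (A : E →L[ℂ] E) (i j : ℤ) :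
    entry (ContinuousLinearMap.adjoint A) i j = (starRingEnd ℂ) (entry A j i) := by
  have h : ∀ (B : E →L[ℂ] E) (i j : ℤ), entry B i j =
      inner ℂ (lp.single 2 i (1 : ℂ) : E) (B (lp.single 2 j (1 : ℂ))) := by
    intro B i j
    rw [lp.inner_single_left]
    simp [entry]
  rw [h, h, ContinuousLinearMap.adjoint_inner_right, inner_conj_symm]

theorem matOp_conjTranspose {n : ℕ} (M : Matrix (Fin n) (Fin n) ℂ) :
    matOp M.conjTranspose = ContinuousLinearMap.adjoint (matOp M) := by
  rw [← ContinuousLinearMap.star_eq_adjoint, ← map_star, Matrix.star_eq_conjTranspose]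

theorem norm_entry_le {n : ℕ} (M : Matrix (Fin n) (Fin n) ℂ) (i j : Fin n) :
    ‖M i j‖ ≤ ‖matOp M‖ := by
  have h := (matOp M).le_opNorm (EuclideanSpace.single j 1)
  rw [PiLp.norm_single, norm_one, mul_one] at h
  refine le_trans ?_ ((PiLp.norm_apply_le (matOp M (EuclideanSpace.single j 1)) i).trans h)
  simp [Matrix.mulVec_single]

/-- Conjugate transposition exchanges the two off-diagonals and preserves the operator norm of every
window, so statements about approximate eigenvectors also apply to the adjoint. -/
theorem PseudoergodicWrt.adjoint {A : E →L[ℂ] E} {Sα Sβ Sγ : Set ℂ}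
    (h : PseudoergodicWrt A Sα Sβ Sγ) :
    PseudoergodicWrt (ContinuousLinearMap.adjoint A) (starRingEnd ℂ '' Sγ) (starRingEnd ℂ '' Sβ)
      (starRingEnd ℂ '' Sα) where
  tridiagonal i j hij := by
    rw [entry_adjoint, h.tridiagonal j i (by rwa [abs_sub_comm]), map_zero]
  compact := ⟨h.compact.2.2.image Complex.continuous_conj,
    h.compact.2.1.image Complex.continuous_conj,
    h.compact.1.image Complex.continuous_conj⟩
  nonempty := ⟨h.nonempty.2.2.image _, h.nonempty.2.1.image _, h.nonempty.1.image _⟩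
  entries_mem j := by
    simp only [subdiag, diagonal, superdiag, entry_adjoint]
    refine ⟨⟨_, ?_, rfl⟩, ⟨_, (h.entries_mem j).2.1, rfl⟩, ⟨_, ?_, rfl⟩⟩
    · simpa [superdiag] using (h.entries_mem (j + 1)).2.2
    · simpa [subdiag] using (h.entries_mem (j - 1)).1
  approx ε hε n hn B hB := by
    have mem : ∀ {S : Set ℂ} {z : ℂ}, z ∈ starRingEnd ℂ '' S → (starRingEnd ℂ) z ∈ S := by
      rintro S _ ⟨w, hw, rfl⟩
      simpa using hw
    obtain ⟨k, hk⟩ := h.approx ε hε n hn B.conjTranspose fun i j => by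
      obtain ⟨h1, h2, h3, h4⟩ := hB j i
      simp only [Matrix.conjTranspose_apply]
      refine ⟨fun e => mem (h3 e), fun e => mem (h2 e.symm), fun e => mem (h1 e),
        fun e1 e2 e3 => ?_⟩
      rw [h4 e3 (Ne.symm e2) e1, star_zero]
    refine ⟨k, ?_⟩
    have : finiteSection (ContinuousLinearMap.adjoint A) n k - B =
        (finiteSection A n k - B.conjTranspose).conjTranspose := by
      ext i j
      simp [finiteSection, entry_adjoint]
    rw [this, matOp_conjTranspose, LinearIsometryEquiv.norm_map]
    exact hk

/-- Every choice of entries from the three sets occurs approximately on a window of any size. -/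
theorem PseudoergodicWrt.exists_close {A : E →L[ℂ] E} {Sα Sβ Sγ : Set ℂ}
    (h : PseudoergodicWrt A Sα Sβ Sγ) {a b c : ℤ → ℂ} (ha : ∀ j, a j ∈ Sα) (hb : ∀ j, b j ∈ Sβ)
    (hc : ∀ j, c j ∈ Sγ) {ε : ℝ} (hε : 0 < ε) (N : ℕ) :
    ∃ k : ℤ, ∀ j : ℤ, |j| ≤ N → ‖subdiag A (j + k) - a j‖ ≤ ε ∧ ‖diagonal A (j + k) - b j‖ ≤ ε ∧
      ‖superdiag A (j + k) - c j‖ ≤ ε := by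
  let B : Matrix (Fin (2 * N + 3)) (Fin (2 * N + 3)) ℂ := Matrix.of fun i j =>
    if (i : ℕ) = j + 1 then a ((j : ℤ) - N - 1) else if (i : ℕ) = j then b ((j : ℤ) - N - 1) else
      if (j : ℕ) = i + 1 then c ((j : ℤ) - N - 1) else 0
  obtain ⟨k, hk⟩ := h.approx ε hε (2 * N + 3) (by omega) B fun i j => by
    simp only [B, Matrix.of_apply]
    refine ⟨fun e => ?_, fun e => ?_, fun e => ?_, fun e1 e2 e3 => ?_⟩
    · rw [if_pos e]; exact ha _
    · rw [if_neg (by omega), if_pos (by omega)]; exact hb _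
    · rw [if_neg (by omega), if_neg (by omega), if_pos e]; exact hc _
    · rw [if_neg e1, if_neg (fun e => e2 (Fin.ext e)), if_neg e3]
  -- Size `2 N + 3` holds the columns with `|j| ≤ N` together with one further row on each side.
  -- Column `j` sits at index `m = j + N + 1`, and the window starts at `k + 1`, hence the offset.
  refine ⟨k + N + 2, fun j hj => ?_⟩
  rw [abs_le] at hj
  have hm : ((j + N + 1).toNat : ℤ) = j + N + 1 := Int.toNat_of_nonneg (by omega)
  set m := (j + N + 1).toNat with hmdef
  have key : ∀ i j : Fin (2 * N + 3), ‖entry A (k + 1 + (i : ℕ)) (k + 1 + (j : ℕ)) - B i j‖ ≤ ε :=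
    fun i j => (norm_entry_le (finiteSection A (2 * N + 3) k - B) i j).trans hk.le
  have e1 := key ⟨m + 1, by omega⟩ ⟨m, by omega⟩
  have e2 := key ⟨m, by omega⟩ ⟨m, by omega⟩
  have e3 := key ⟨m - 1, by omega⟩ ⟨m, by omega⟩
  simp only [B, Matrix.of_apply] at e1 e2 e3
  rw [if_pos trivial] at e1
  rw [if_neg (by omega), if_pos trivial] at e2
  rw [if_neg (by omega), if_neg (by omega), if_pos (by omega)] at e3
  have hj' : (m : ℤ) - N - 1 = j := by omega
  rw [hj'] at e1 e2 e3
  have i1 : k + 1 + (m : ℤ) = j + (k + N + 2) := by omega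
  have i2 : k + 1 + ((m + 1 : ℕ) : ℤ) = j + (k + N + 2) + 1 := by omega
  have i3 : k + 1 + ((m - 1 : ℕ) : ℤ) = j + (k + N + 2) - 1 := by omega
  rw [i1] at e1 e2 e3
  rw [i2] at e1
  rw [i3] at e3
  exact ⟨e1, e2, e3⟩

/-! ### Approximate eigenvectors and pseudospectra -/

/-- The infimum of `‖(T - z) u‖ / ‖u‖` over `u ≠ 0` is at most `c`. -/
def LowerBoundLE (T : E →L[ℂ] E) (z : ℂ) (c : ℝ) : Prop :=
  ∀ δ > c, ∃ u : E, u ≠ 0 ∧ ‖T u - z • u‖ ≤ δ * ‖u‖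

theorem LowerBoundLE.mono {T : E →L[ℂ] E} {z : ℂ} {c d : ℝ} (h : LowerBoundLE T z c)
    (hcd : c ≤ d) : LowerBoundLE T z d := fun δ hδ => h δ (hcd.trans_lt hδ)

/-- Transfer of a finitely supported approximate eigenvector to a pseudoergodic operator. -/
theorem PseudoergodicWrt.exists_of_finite_support {A : E →L[ℂ] E} {Sα Sβ Sγ : Set ℂ}
    (h : PseudoergodicWrt A Sα Sβ Sγ) {a b c : ℤ → ℂ} (ha : ∀ j, a j ∈ Sα) (hb : ∀ j, b j ∈ Sβ)
    (hc : ∀ j, c j ∈ Sγ) {z : ℂ} {v w : E} (hv : v ≠ 0) {N : ℕ} (hN : ∀ j : ℤ, N < |j| → v j = 0)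
    (hw : ∀ i, w i = a (i - 1) * v (i - 1) + b i * v i + c (i + 1) * v (i + 1) - z * v i)
    {d δ : ℝ} (hd : ‖w‖ ≤ d * ‖v‖) (hδ : d < δ) :
    ∃ u : E, u ≠ 0 ∧ ‖A u - z • u‖ ≤ δ * ‖u‖ := by
  -- The gap `δ - d` is shared equally between the three diagonals. Only columns in the support of
  -- `v` matter, so a window of finite size suffices.
  obtain ⟨k, hk⟩ := h.exists_close ha hb hc (ε := (δ - d) / 3) (by linarith) N
  have hε : 0 ≤ (δ - d) / 3 := by linarith
  have hmul : ∀ (x : ℂ) (j : ℤ), (|j| ≤ N → ‖x‖ ≤ (δ - d) / 3) →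
      ‖x * v j‖ ≤ (δ - d) / 3 * ‖v j‖ := by
    intro x j hx
    rw [norm_mul]
    by_cases hj : |j| ≤ N
    · exact mul_le_mul_of_nonneg_right (hx hj) (norm_nonneg _)
    · rw [hN j (not_le.1 hj), norm_zero, mul_zero, mul_zero]
  let u : E := shiftE (-k) v
  refine ⟨u, fun hu => hv ((LinearIsometryEquiv.map_eq_zero_iff _).1 hu), ?_⟩
  have hun : ‖u‖ = ‖v‖ := LinearIsometryEquiv.norm_map _ _
  have hu : ∀ i, u i = v (i + -k) := fun _ => rfl
  have h1 : ‖shiftE k (A u - z • u) - w‖ ≤ ((δ - d) / 3 + (δ - d) / 3 + (δ - d) / 3) * ‖v‖ := by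
    refine norm_le_of_forall_three_term hε hε hε fun i => ?_
    have : (shiftE k (A u - z • u) - w : E) i =
        (subdiag A (i - 1 + k) - a (i - 1)) * v (i - 1) + (diagonal A (i + k) - b i) * v i +
          (superdiag A (i + 1 + k) - c (i + 1)) * v (i + 1) := by
      have e : (shiftE k (A u - z • u) - w : E) i = A u (i + k) - z * u (i + k) - w i := rfl
      rw [e, h.tridiagonal.apply, hw, hu, hu, hu, show i + k - 1 = i - 1 + k by ring,
        show i + k + 1 = i + 1 + k by ring, add_neg_cancel_right, add_neg_cancel_right,
        add_neg_cancel_right]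
      ring
    rw [this]
    exact (norm_add₃_le).trans (add_le_add_three (hmul _ _ fun hj => (hk _ hj).1)
      (hmul _ _ fun hj => (hk _ hj).2.1) (hmul _ _ fun hj => (hk _ hj).2.2))
  have h2 : ‖A u - z • u‖ ≤ ‖shiftE k (A u - z • u) - w‖ + ‖w‖ := by
    rw [← LinearIsometryEquiv.norm_map (shiftE k) (A u - z • u)]
    simpa using norm_add_le (shiftE k (A u - z • u) - w) w
  rw [hun]
  linarith

/-- Truncation of a sequence to a finite window. -/
theorem exists_finite_support_approx (T : E →L[ℂ] E) {z : ℂ} {c : ℝ} (h : LowerBoundLE T z c)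
    {δ : ℝ} (hδ : c < δ) : ∃ (v : E) (N : ℕ), v ≠ 0 ∧ (∀ j : ℤ, N < |j| → v j = 0) ∧
      ‖T v - z • v‖ ≤ δ * ‖v‖ := by
  obtain ⟨u, hu, hu'⟩ := h ((c + δ) / 2) (by linarith)
  have hlt : ‖T u - z • u‖ < δ * ‖u‖ :=
    hu'.trans_lt (mul_lt_mul_of_pos_right (by linarith) (norm_pos_iff.2 hu))
  have hs := lp.hasSum_single (p := 2) (by norm_num) u
  -- The strict inequality for `u` is an open condition, so it persists for some finite coordinate
  -- sum that is still nonzero.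
  have hcont : Continuous fun x : E => δ * ‖x‖ - ‖T x - z • x‖ :=
    (continuous_const.mul continuous_norm).sub (T.continuous.sub (continuous_const_smul z)).norm
  have hev := ((hcont.tendsto u).comp hs).eventually (lt_mem_nhds (sub_pos.2 hlt))
  have hne := hs.eventually (isOpen_ne.mem_nhds hu)
  obtain ⟨s, hs1, hs2⟩ := (hev.and hne).exists
  refine ⟨_, s.sup Int.natAbs, hs2, fun j hj => ?_, by simpa using (sub_pos.1 hs1).le⟩
  have hjs : j ∉ s := fun hjs => by
    have := Finset.le_sup (f := Int.natAbs) hjs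
    rw [Int.abs_eq_natAbs] at hj
    omega
  rw [lp.coeFn_sum, Finset.sum_apply]
  exact Finset.sum_eq_zero fun i hi => lp.single_apply_ne _ _ _ fun e => hjs (e ▸ hi)

/-- The entries of `A` themselves are admissible choices from the three sets, so a truncated
approximate eigenvector of `A` is reproduced by `A'` in a suitable window. -/
theorem PseudoergodicWrt.lowerBoundLE_of {A A' : E →L[ℂ] E} {Sα Sβ Sγ : Set ℂ}
    (hA : PseudoergodicWrt A Sα Sβ Sγ) (hA' : PseudoergodicWrt A' Sα Sβ Sγ) {z : ℂ} {c : ℝ}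
    (h : LowerBoundLE A z c) : LowerBoundLE A' z c := by
  intro δ hδ
  obtain ⟨v, N, hv, hN, hle⟩ := exists_finite_support_approx A h
    (show c < (c + δ) / 2 by linarith)
  refine hA'.exists_of_finite_support (fun j => (hA.entries_mem j).1)
    (fun j => (hA.entries_mem j).2.1) (fun j => (hA.entries_mem j).2.2) hv hN (w := A v - z • v)
    (fun i => ?_) hle (by linarith)
  change A v i - z * v i = _
  rw [hA.tridiagonal.apply]

/-- A lower bound gives injectivity and closed range; injectivity of the adjoint makes the range
dense. -/
theorem isUnit_of_bounds {T : E →L[ℂ] E} {c d : ℝ} (hc : 0 < c) (hd : 0 < d)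
    (h : ∀ u, c * ‖u‖ ≤ ‖T u‖) (h' : ∀ u, d * ‖u‖ ≤ ‖ContinuousLinearMap.adjoint T u‖) :
    IsUnit T := by
  rw [ContinuousLinearMap.isUnit_iff_bijective,
    ContinuousLinearMap.bijective_iff_dense_range_and_antilipschitz]
  refine ⟨?_, ⟨_, T.antilipschitz_of_bound (K := (Real.toNNReal c)⁻¹) fun u => ?_⟩⟩
  · rw [Submodule.topologicalClosure_eq_top_iff, ContinuousLinearMap.orthogonal_range,
      LinearMap.ker_eq_bot']
    intro u hu
    have h1 := h' u
    rw [show ContinuousLinearMap.adjoint T u = 0 from hu, norm_zero] at h1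
    exact norm_le_zero_iff.1 (nonpos_of_mul_nonpos_right h1 hd)
  · rw [NNReal.coe_inv, Real.coe_toNNReal _ hc.le, inv_mul_eq_div, le_div_iff₀ hc, mul_comm]
    exact h u

theorem norm_sub_apply (A : E →L[ℂ] E) (z : ℂ) (u : E) :
    ‖(algebraMap ℂ (E →L[ℂ] E) z - A) u‖ = ‖A u - z • u‖ := by
  rw [norm_sub_rev]
  simp [Algebra.algebraMap_eq_smul_one]

theorem norm_adjoint_sub_apply (A : E →L[ℂ] E) (z : ℂ) (u : E) :
    ‖ContinuousLinearMap.adjoint (algebraMap ℂ (E →L[ℂ] E) z - A) u‖ =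
      ‖ContinuousLinearMap.adjoint A u - (starRingEnd ℂ) z • u‖ := by
  rw [← norm_sub_apply]
  congr 2
  rw [map_sub, ← ContinuousLinearMap.star_eq_adjoint, ← ContinuousLinearMap.star_eq_adjoint,
    ← algebraMap_star_comm]
  rfl

theorem exists_bound_of_not_lowerBoundLE {T : E →L[ℂ] E} {z : ℂ} {c : ℝ}
    (h : ¬ LowerBoundLE T z c) : ∃ δ > c, ∀ u, δ * ‖u‖ ≤ ‖T u - z • u‖ := by
  unfold LowerBoundLE at h
  push Not at h
  obtain ⟨δ, hδ, h⟩ := h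
  refine ⟨δ, hδ, fun u => ?_⟩
  by_cases hu : u = 0
  · simp [hu]
  · exact (h u hu).le

/-- Otherwise both `A - z` and its adjoint would be bounded below, hence invertible. Both
alternatives are needed, since invertibility may fail by lack of surjectivity alone. -/
theorem lowerBoundLE_of_mem_spectrum {A : E →L[ℂ] E} {z : ℂ} (hz : z ∈ spectrum ℂ A) :
    LowerBoundLE A z 0 ∨ LowerBoundLE (ContinuousLinearMap.adjoint A) ((starRingEnd ℂ) z) 0 := by
  by_contra hcon
  rw [not_or] at hcon
  obtain ⟨c, hc, h⟩ := exists_bound_of_not_lowerBoundLE hcon.1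
  obtain ⟨d, hd, h'⟩ := exists_bound_of_not_lowerBoundLE hcon.2
  exact hz (isUnit_of_bounds hc hd (fun u => by rw [norm_sub_apply]; exact h u)
    fun u => by rw [norm_adjoint_sub_apply]; exact h' u)

/-- Applying `R` to `T u` recovers `u`, so an almost annihilated `u` forces `1 ≤ ‖R‖ δ`. -/
theorem inv_norm_le_of_left_inverse {R T : E →L[ℂ] E} (hRT : R * T = 1) {ε : ℝ}
    (h : ∀ δ > ε, ∃ u : E, u ≠ 0 ∧ ‖T u‖ ≤ δ * ‖u‖) : ‖R‖⁻¹ ≤ ε := by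
  refine le_of_forall_gt_imp_ge_of_dense fun δ hδ => ?_
  obtain ⟨u, hu, hu'⟩ := h δ hδ
  have hu0 : 0 < ‖u‖ := norm_pos_iff.2 hu
  have h1 : ‖u‖ ≤ ‖R‖ * ‖T u‖ := by
    have := R.le_opNorm (T u)
    rwa [← mul_apply_eq_comp, hRT, one_apply_eq_self] at this
  have h2 : ‖u‖ ≤ ‖R‖ * δ * ‖u‖ := by
    rw [mul_assoc]
    exact h1.trans (mul_le_mul_of_nonneg_left hu' (norm_nonneg _))
  have h3 : 1 ≤ ‖R‖ * δ := by
    by_contra hlt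
    nlinarith
  have hR : 0 < ‖R‖ := by
    rcases (norm_nonneg R).eq_or_lt with h0 | h0
    · rw [← h0, zero_mul] at h3; linarith
    · exact h0
  rw [inv_le_iff_one_le_mul₀ hR, mul_comm]
  exact h3

/-- Off the spectrum, `‖resolvent‖⁻¹` is the lower norm of `A - z`, and equally that of the adjoint;
on the spectrum both sides hold. This replaces the resolvent by approximate eigenvectors, which can
be moved between operators. -/
theorem mem_closedPseudospectrum_iff {A : E →L[ℂ] E} {z : ℂ} {ε : ℝ} (hε : 0 ≤ ε) :
    z ∈ closedPseudospectrum ε A ↔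
      LowerBoundLE A z ε ∨ LowerBoundLE (ContinuousLinearMap.adjoint A) ((starRingEnd ℂ) z) ε := by
  by_cases hz : z ∈ spectrum ℂ A
  · refine iff_of_true ?_ ((lowerBoundLE_of_mem_spectrum hz).imp (·.mono hε) (·.mono hε))
    have : resolvent A z = 0 := Ring.inverse_non_unit _ hz
    simpa [closedPseudospectrum, this] using hε
  have hu : IsUnit (algebraMap ℂ (E →L[ℂ] E) z - A) := not_not.1 hz
  have hRT : resolvent A z * (algebraMap ℂ (E →L[ℂ] E) z - A) = 1 := Ring.inverse_mul_cancel _ hu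
  have hTR : (algebraMap ℂ (E →L[ℂ] E) z - A) * resolvent A z = 1 := Ring.mul_inverse_cancel _ hu
  constructor
  · intro h
    change ‖resolvent A z‖⁻¹ ≤ ε at h
    refine Or.inl (by_contra fun hcon => ?_)
    obtain ⟨δ, hδ, hb⟩ := exists_bound_of_not_lowerBoundLE hcon
    have hδ0 : 0 < δ := hε.trans_lt hδ
    have hR : ‖resolvent A z‖ ≤ δ⁻¹ := by
      refine ContinuousLinearMap.opNorm_le_bound _ (by positivity) fun y => ?_
      have h1 := hb (resolvent A z y)
      rw [← norm_sub_apply, ← mul_apply_eq_comp, hTR,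
        one_apply_eq_self] at h1
      rw [inv_mul_eq_div, le_div_iff₀ hδ0, mul_comm]
      exact h1
    have hR0 : 0 < ‖resolvent A z‖ := by
      rw [norm_pos_iff]
      intro h0
      rw [h0, zero_mul] at hRT
      exact zero_ne_one hRT
    have := (le_inv_comm₀ hR0 hδ0).1 hR
    linarith
  · rintro (h | h)
    · refine inv_norm_le_of_left_inverse hRT fun δ hδ => ?_
      obtain ⟨u, hu, hu'⟩ := h δ hδ
      exact ⟨u, hu, by rwa [norm_sub_apply]⟩
    · change ‖resolvent A z‖⁻¹ ≤ ε
      rw [← LinearIsometryEquiv.norm_map ContinuousLinearMap.adjoint (resolvent A z)]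
      refine inv_norm_le_of_left_inverse
        (T := ContinuousLinearMap.adjoint (algebraMap ℂ (E →L[ℂ] E) z - A)) ?_ fun δ hδ => ?_
      · rw [← ContinuousLinearMap.star_eq_adjoint, ← ContinuousLinearMap.star_eq_adjoint,
          ← star_mul, hTR, star_one]
      · obtain ⟨u, hu, hu'⟩ := h δ hδ
        exact ⟨u, hu, by rwa [norm_adjoint_sub_apply]⟩

theorem closedPseudospectrum_zero (A : E →L[ℂ] E) : closedPseudospectrum 0 A = spectrum ℂ A := by
  ext z
  constructor
  · intro h hz
    have hu : IsUnit (algebraMap ℂ (E →L[ℂ] E) z - A) := hz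
    have hRT : resolvent A z * (algebraMap ℂ (E →L[ℂ] E) z - A) = 1 :=
      Ring.inverse_mul_cancel _ hu
    have h0 : ‖resolvent A z‖ = 0 :=
      inv_eq_zero.1 (le_antisymm h (inv_nonneg.2 (norm_nonneg _)))
    rw [norm_eq_zero.1 h0, zero_mul] at hRT
    exact zero_ne_one hRT
  · intro h
    exact (mem_closedPseudospectrum_iff le_rfl).2 (lowerBoundLE_of_mem_spectrum h)

/-- The pseudospectra of a pseudoergodic operator only depend on the three sets. -/
theorem PseudoergodicWrt.closedPseudospectrum_eq {A A' : E →L[ℂ] E} {Sα Sβ Sγ : Set ℂ}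
    (hA : PseudoergodicWrt A Sα Sβ Sγ) (hA' : PseudoergodicWrt A' Sα Sβ Sγ) {ε : ℝ}
    (hε : 0 ≤ ε) : closedPseudospectrum ε A = closedPseudospectrum ε A' := by
  ext z
  rw [mem_closedPseudospectrum_iff hε, mem_closedPseudospectrum_iff hε]
  exact or_congr ⟨hA.lowerBoundLE_of hA', hA'.lowerBoundLE_of hA⟩
    ⟨hA.adjoint.lowerBoundLE_of hA'.adjoint, hA'.adjoint.lowerBoundLE_of hA.adjoint⟩

/-- The closed pseudospectra shrink to the spectrum. -/
theorem exists_closedPseudospectrum_subset (A : E →L[ℂ] E) {d : ℝ} (hd : 0 < d) :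
    ∃ ε > 0, closedPseudospectrum ε A ⊆ addDisc (spectrum ℂ A) d := by
  -- Near infinity the resolvent is small; in the remaining closed disc, outside the thickened
  -- spectrum, it is continuous on a compact set. It is thus bounded away from the spectrum.
  have hfar : ∀ᶠ z in Bornology.cobounded ℂ, ‖resolvent A z‖ < 1 := by
    have := (spectrum.resolvent_tendsto_cobounded (𝕜 := ℂ) A).norm
    rw [norm_zero] at this
    exact this.eventually (gt_mem_nhds one_pos)
  obtain ⟨r, -, hr⟩ := (Metric.hasBasis_cobounded_compl_closedBall (0 : ℂ)).eventually_iff.1 hfar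
  have hnot : ∀ z, z ∉ Metric.thickening d (spectrum ℂ A) →
      IsUnit (algebraMap ℂ (E →L[ℂ] E) z - A) :=
    fun z hz => not_not.1 fun h => hz (Metric.self_subset_thickening hd _ h)
  have hK : IsCompact (Metric.closedBall (0 : ℂ) r \ Metric.thickening d (spectrum ℂ A)) :=
    (isCompact_closedBall _ _).diff Metric.isOpen_thickening
  have hcont : ContinuousOn (resolvent A)
      (Metric.closedBall (0 : ℂ) r \ Metric.thickening d (spectrum ℂ A)) := by
    intro z hz
    obtain ⟨u, hu⟩ := hnot z hz.2
    have h1 : ContinuousAt (fun z : ℂ => algebraMap ℂ (E →L[ℂ] E) z - A) z :=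
      ((continuous_algebraMap ℂ (E →L[ℂ] E)).sub continuous_const).continuousAt
    have h2 : ContinuousAt Ring.inverse (algebraMap ℂ (E →L[ℂ] E) z - A) :=
      hu ▸ NormedRing.inverse_continuousAt u
    exact (ContinuousAt.comp (f := fun z : ℂ => algebraMap ℂ (E →L[ℂ] E) z - A) h2
      h1).continuousWithinAt
  obtain ⟨C, hC⟩ := hK.exists_bound_of_continuousOn hcont
  -- The added `1` puts `ε` strictly below the reciprocal of the resolvent bound, so such a `z`
  -- cannot lie in the pseudospectrum.
  refine ⟨(max C 1 + 1)⁻¹, by positivity, fun z hz => ?_⟩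
  by_contra hcon
  have hz' : z ∉ Metric.thickening d (spectrum ℂ A) := by
    intro h
    obtain ⟨w, hw, hzw⟩ := Metric.mem_thickening_iff.1 h
    exact hcon ⟨w, hw, by rw [← dist_eq_norm]; exact hzw.le⟩
  have hle : ‖resolvent A z‖ ≤ max C 1 := by
    by_cases h : z ∈ Metric.closedBall (0 : ℂ) r
    · exact (hC z ⟨h, hz'⟩).trans (le_max_left _ _)
    · exact (hr h).le.trans (le_max_right _ _)
  have hR0 : 0 < ‖resolvent A z‖ := by
    rw [norm_pos_iff]
    exact (spectrum.isUnit_resolvent.1 (hnot z hz')).ne_zero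
  have h1 := (inv_le_inv₀ hR0 (by positivity)).1 (show ‖resolvent A z‖⁻¹ ≤ (max C 1 + 1)⁻¹ from hz)
  linarith

/-! ### Periodised matrices -/

/-- The product of a periodised matrix with a vector. -/
theorem sum_perEntry_mul {n i : ℕ} (hi : i < n) (t : ℂ) (a b c : List ℂ) (X : ℕ → ℂ) :
    ∑ j : Fin n, perEntry n t a b c i j * X j =
      (if i = 0 then t * a.getD (n - 1) 0 * X (n - 1) else a.getD (i - 1) 0 * X (i - 1)) +
      b.getD i 0 * X i +
      (if i + 1 = n then (starRingEnd ℂ) t * c.getD i 0 * X 0 else c.getD i 0 * X (i + 1)) := by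
  rw [← Finset.sum_range (fun j => perEntry n t a b c i j * X j)]
  -- The subdiagonal and its corner are summed together: each row then has exactly one contributing
  -- column, its cyclic predecessor.
  have e1 : ∑ j ∈ Finset.range n, ((if i = j + 1 then a.getD j 0 else 0) +
      (if i = 0 ∧ j + 1 = n then t * a.getD j 0 else 0)) * X j =
      if i = 0 then t * a.getD (n - 1) 0 * X (n - 1) else a.getD (i - 1) 0 * X (i - 1) := by
    by_cases h : i = 0
    · rw [if_pos h, Finset.sum_eq_single (n - 1)]
      · rw [if_neg (by omega), if_pos ⟨h, by omega⟩, zero_add]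
      · intro j hj hne
        rw [Finset.mem_range] at hj
        rw [if_neg (by omega), if_neg (by omega), zero_add, zero_mul]
      · intro hn
        exact absurd (Finset.mem_range.2 (by omega)) hn
    · rw [if_neg h, Finset.sum_eq_single (i - 1)]
      · rw [if_pos (by omega), if_neg (by omega), add_zero]
      · intro j hj hne
        rw [if_neg (by omega), if_neg (by omega), zero_add, zero_mul]
      · intro hn
        exact absurd (Finset.mem_range.2 (by omega)) hn
  have e2 : ∑ j ∈ Finset.range n, (if i = j then b.getD i 0 else 0) * X j = b.getD i 0 * X i := by
    rw [Finset.sum_eq_single i]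
    · rw [if_pos rfl]
    · intro j _ hne
      rw [if_neg (Ne.symm hne), zero_mul]
    · intro hn
      exact absurd (Finset.mem_range.2 hi) hn
  have e3 : ∑ j ∈ Finset.range n, ((if j = i + 1 then c.getD i 0 else 0) +
      (if i + 1 = n ∧ j = 0 then (starRingEnd ℂ) t * c.getD i 0 else 0)) * X j =
      if i + 1 = n then (starRingEnd ℂ) t * c.getD i 0 * X 0 else c.getD i 0 * X (i + 1) := by
    by_cases h : i + 1 = n
    · rw [if_pos h, Finset.sum_eq_single 0]
      · rw [if_neg (by omega), if_pos ⟨h, rfl⟩, zero_add]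
      · intro j hj hne
        rw [Finset.mem_range] at hj
        rw [if_neg (by omega), if_neg (by omega), zero_add, zero_mul]
      · intro hn
        exact absurd (Finset.mem_range.2 (by omega)) hn
    · rw [if_neg h, Finset.sum_eq_single (i + 1)]
      · rw [if_pos rfl, if_neg (by omega), add_zero]
      · intro j hj hne
        rw [if_neg (by omega), if_neg (by omega), zero_add, zero_mul]
      · intro hn
        exact absurd (Finset.mem_range.2 (by omega)) hn
  rw [← e1, ← e2, ← e3, ← Finset.sum_add_distrib, ← Finset.sum_add_distrib]
  refine Finset.sum_congr rfl fun j _ => ?_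
  rw [perEntry]
  ring

/-- Words are indexed so that the off-diagonals exchange without a shift, and conjugating `conj t *
c` gives the corner `t * conj c`: the family with phase `t` is closed under adjoints with the same
`t`. -/
theorem perMatrix_conjTranspose (n : ℕ) (t : ℂ) (a b c : List ℂ) :
    (perMatrix n t a b c).conjTranspose =
      perMatrix n t (c.map (starRingEnd ℂ)) (b.map (starRingEnd ℂ)) (a.map (starRingEnd ℂ)) := by
  have hm : ∀ (l : List ℂ) (i : ℕ), (l.map (starRingEnd ℂ)).getD i 0 =
      (starRingEnd ℂ) (l.getD i 0) := by
    intro l i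
    simp only [List.getD_eq_getElem?_getD, List.getElem?_map]
    cases l[i]? <;> simp
  ext i j
  simp only [Matrix.conjTranspose_apply, perMatrix, Matrix.of_apply, perEntry, hm,
    ← starRingEnd_apply, apply_ite (starRingEnd ℂ), map_mul, map_add, map_zero, Complex.conj_conj]
  have hand : ∀ (P Q : Prop) [Decidable P] [Decidable Q] (x : ℂ),
      (if P ∧ Q then x else 0) = if Q ∧ P then x else 0 := by
    intros
    simp only [and_comm]
  rw [hand ((j : ℕ) = 0), hand ((j : ℕ) + 1 = n)]
  have : (if (j : ℕ) = i then (starRingEnd ℂ) (b.getD j 0) else 0) =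
      if (i : ℕ) = j then (starRingEnd ℂ) (b.getD i 0) else 0 := by
    by_cases h : (i : ℕ) = j
    · rw [if_pos h, if_pos h.symm, h]
    · rw [if_neg h, if_neg (Ne.symm h)]
  rw [this]
  ring

/-- If the adjoint is surjective, solve `M* y = x` for a near-null vector `x` of `M`; pairing with
`x` gives `‖x‖² ≤ e ‖y‖ ‖x‖`. If not, it has a kernel by equality of dimensions. -/
theorem lowerNorm_conjTranspose_le {n : ℕ} (hn : 0 < n) {M : Matrix (Fin n) (Fin n) ℂ} {e : ℝ}
    (he : 0 ≤ e) (h : lowerNorm M ≤ e) : lowerNorm M.conjTranspose ≤ e := by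
  rw [lowerNorm_le_iff hn] at h ⊢
  obtain ⟨x, hx, hle⟩ := h
  by_cases hs : Function.Surjective (matOp M.conjTranspose)
  · obtain ⟨y, hy⟩ := hs x
    refine ⟨y, fun h0 => hx (by rw [← hy, h0, map_zero]), ?_⟩
    rw [hy]
    have h1 : ‖x‖ * ‖x‖ ≤ e * ‖y‖ * ‖x‖ := by
      calc ‖x‖ * ‖x‖ = ‖inner ℂ (matOp M.conjTranspose y) x‖ := by
            rw [hy, inner_self_eq_norm_sq_to_K]; simp [sq]
        _ = ‖inner ℂ y (matOp M x)‖ := by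
            rw [matOp_conjTranspose, ContinuousLinearMap.adjoint_inner_left]
        _ ≤ ‖y‖ * ‖matOp M x‖ := norm_inner_le_norm _ _
        _ ≤ ‖y‖ * (e * ‖x‖) := mul_le_mul_of_nonneg_left hle (norm_nonneg _)
        _ = e * ‖y‖ * ‖x‖ := by ring
    exact le_of_mul_le_mul_right h1 (norm_pos_iff.2 hx)
  · have hi : ¬ Function.Injective (matOp M.conjTranspose) := fun hi =>
      hs ((LinearMap.injective_iff_surjective (f := (matOp M.conjTranspose :
        EuclideanSpace ℂ (Fin n) →ₗ[ℂ] EuclideanSpace ℂ (Fin n)))).1 hi)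
    rw [injective_iff_map_eq_zero] at hi
    push Not at hi
    obtain ⟨y, hy, hy0⟩ := hi
    exact ⟨y, hy0, by rw [hy, norm_zero]; positivity⟩

theorem sum_range_pred {n : ℕ} (hn : 0 < n) (f : ℕ → ℝ) :
    ∑ i ∈ Finset.range n, f (if i = 0 then n - 1 else i - 1) = ∑ i ∈ Finset.range n, f i := by
  obtain ⟨m, rfl⟩ : ∃ m, n = m + 1 := ⟨n - 1, by omega⟩
  rw [Finset.sum_range_succ', Finset.sum_range_succ]
  simp

theorem sum_range_next {n : ℕ} (hn : 0 < n) (f : ℕ → ℝ) :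
    ∑ i ∈ Finset.range n, f (if i + 1 = n then 0 else i + 1) = ∑ i ∈ Finset.range n, f i := by
  obtain ⟨m, rfl⟩ : ∃ m, n = m + 1 := ⟨n - 1, by omega⟩
  rw [Finset.sum_range_succ, Finset.sum_range_succ', if_pos rfl]
  refine congrArg (· + f 0) (Finset.sum_congr rfl fun i hi => ?_)
  rw [Finset.mem_range] at hi
  rw [if_neg (by omega)]

theorem norm_le_of_sum_sq_le {n : ℕ} {u x : EuclideanSpace ℂ (Fin n)} {η : ℝ} (hη : 0 ≤ η)
    (f : ℕ → ℝ) (hf : ∀ i : Fin n, ‖u i‖ ≤ η * f i)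
    (hs : ∑ i ∈ Finset.range n, f i ^ 2 = ‖x‖ ^ 2) : ‖u‖ ≤ η * ‖x‖ := by
  refine (pow_le_pow_iff_left₀ (norm_nonneg _) (by positivity) two_ne_zero).1 ?_
  rw [mul_pow, ← hs, EuclideanSpace.norm_sq_eq, Finset.mul_sum, Finset.sum_range]
  refine Finset.sum_le_sum fun i _ => ?_
  rw [← mul_pow]
  exact pow_le_pow_left₀ (norm_nonneg _) (hf i) 2

/-- Perturbation of the lower norm of a periodised matrix. -/
theorem lowerNorm_perMatrix_perturb {n : ℕ} (hn : 0 < n) {t : ℂ} (ht : ‖t‖ = 1)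
    {a b c a' b' c' : List ℂ} {η : ℝ}
    (ha : ∀ i < n, ‖a'.getD i 0 - a.getD i 0‖ ≤ η) (hb : ∀ i < n, ‖b'.getD i 0 - b.getD i 0‖ ≤ η)
    (hc : ∀ i < n, ‖c'.getD i 0 - c.getD i 0‖ ≤ η) {z : ℂ} {e : ℝ}
    (h : lowerNorm (perMatrix n t a b c - z • (1 : Matrix (Fin n) (Fin n) ℂ)) ≤ e) (z' : ℂ) :
    lowerNorm (perMatrix n t a' b' c' - z' • (1 : Matrix (Fin n) (Fin n) ℂ)) ≤
      e + 3 * η + ‖z - z'‖ := by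
  have hη : 0 ≤ η := (norm_nonneg _).trans (ha 0 hn)
  rw [lowerNorm_le_iff hn] at h ⊢
  obtain ⟨x, hx, hle⟩ := h
  refine ⟨x, hx, ?_⟩
  let X : ℕ → ℂ := fun i => if h : i < n then x ⟨i, h⟩ else 0
  have hX : ∀ i : Fin n, x i = X i := fun i => by simp [X]
  have hXs : ∑ i ∈ Finset.range n, ‖X i‖ ^ 2 = ‖x‖ ^ 2 := by
    rw [EuclideanSpace.norm_sq_eq, Finset.sum_range]
    simp only [hX]
  have happ : ∀ (a b c : List ℂ) (z : ℂ) (i : Fin n),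
      (matOp (perMatrix n t a b c - z • (1 : Matrix (Fin n) (Fin n) ℂ)) x) i =
      (∑ j : Fin n, perEntry n t a b c i j * X j) - z * X i := by
    intro a b c z i
    have : matOp (perMatrix n t a b c - z • (1 : Matrix (Fin n) (Fin n) ℂ)) =
        matOp (perMatrix n t a b c) - z • 1 := by
      unfold matOp
      rw [map_sub, map_smul, map_one]
    rw [this]
    simp [Matrix.mulVec, dotProduct, perMatrix, hX]
  let u : EuclideanSpace ℂ (Fin n) := WithLp.toLp 2 fun i : Fin n => if (i : ℕ) = 0 then
    t * (a'.getD (n - 1) 0 - a.getD (n - 1) 0) * X (n - 1) else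
    (a'.getD (i - 1) 0 - a.getD (i - 1) 0) * X (i - 1)
  let v : EuclideanSpace ℂ (Fin n) := WithLp.toLp 2 fun i : Fin n =>
    (b'.getD i 0 - b.getD i 0) * X i
  let w : EuclideanSpace ℂ (Fin n) := WithLp.toLp 2 fun i : Fin n => if (i : ℕ) + 1 = n then
    (starRingEnd ℂ) t * (c'.getD i 0 - c.getD i 0) * X 0 else
    (c'.getD i 0 - c.getD i 0) * X (i + 1)
  -- The difference of the two matrices is a weighted cyclic shift in each direction plus a
  -- diagonal; because `|t| = 1`, each piece has norm at most `η`, corners included.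
  have hdec : matOp (perMatrix n t a' b' c' - z' • (1 : Matrix (Fin n) (Fin n) ℂ)) x =
      matOp (perMatrix n t a b c - z • (1 : Matrix (Fin n) (Fin n) ℂ)) x + (u + v + w) +
        (z - z') • x := by
    ext i
    simp only [PiLp.add_apply, PiLp.smul_apply, happ, sum_perEntry_mul i.2, u, v, w, smul_eq_mul,
      hX]
    split_ifs <;> ring
  have hu : ‖u‖ ≤ η * ‖x‖ := by
    refine norm_le_of_sum_sq_le hη (fun i => ‖X (if i = 0 then n - 1 else i - 1)‖) (fun i => ?_) ?_
    · simp only [u]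
      by_cases h : (i : ℕ) = 0
      · rw [if_pos h, if_pos h, norm_mul, norm_mul, ht, one_mul]
        exact mul_le_mul_of_nonneg_right (ha _ (by omega)) (norm_nonneg _)
      · rw [if_neg h, if_neg h, norm_mul]
        exact mul_le_mul_of_nonneg_right (ha _ (by omega)) (norm_nonneg _)
    · rw [sum_range_pred hn (fun i => ‖X i‖ ^ 2), hXs]
  have hv : ‖v‖ ≤ η * ‖x‖ := by
    refine norm_le_of_sum_sq_le hη (fun i => ‖X i‖) (fun i => ?_) hXs
    simp only [v]
    rw [norm_mul]
    exact mul_le_mul_of_nonneg_right (hb _ i.2) (norm_nonneg _)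
  have hw : ‖w‖ ≤ η * ‖x‖ := by
    refine norm_le_of_sum_sq_le hη (fun i => ‖X (if i + 1 = n then 0 else i + 1)‖) (fun i => ?_) ?_
    · simp only [w]
      by_cases h : (i : ℕ) + 1 = n
      · rw [if_pos h, if_pos h, norm_mul, norm_mul, RCLike.norm_conj, ht, one_mul]
        exact mul_le_mul_of_nonneg_right (hc _ i.2) (norm_nonneg _)
      · rw [if_neg h, if_neg h, norm_mul]
        exact mul_le_mul_of_nonneg_right (hc _ i.2) (norm_nonneg _)
    · rw [sum_range_next hn (fun i => ‖X i‖ ^ 2), hXs]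
  rw [hdec]
  refine (norm_add₃_le).trans ?_
  rw [norm_smul]
  have := norm_add₃_le (a := u) (b := v) (c := w)
  linarith

/-! ### Points of the grid -/

/-- Rounding towards zero never increases the modulus, which keeps the grid points within the disc.
-/
theorem exists_int_abs_le (y : ℝ) : ∃ a : ℤ, |(a : ℝ)| ≤ |y| ∧ |y - a| ≤ 1 := by
  rcases le_total 0 y with h | h
  · refine ⟨⌊y⌋, ?_, ?_⟩
    · rw [abs_of_nonneg h, abs_of_nonneg (by exact_mod_cast Int.floor_nonneg.2 h)]
      exact Int.floor_le y
    · rw [abs_le]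
      constructor <;> linarith [Int.floor_le y, Int.lt_floor_add_one y]
  · refine ⟨⌈y⌉, ?_, ?_⟩
    · rw [abs_of_nonpos h, abs_of_nonpos (by exact_mod_cast Int.ceil_nonpos.2 h)]
      linarith [Int.le_ceil y]
    · rw [abs_le]
      constructor <;> linarith [Int.le_ceil y, Int.ceil_lt_add_one y]

/-- The point may lie on the boundary circle while the grid uses the open disc. It is first
contracted by `1 - d`, at a cost of at most `1 / (20 n)`, and its coordinates are then rounded
towards zero, at a cost of at most `√2 / n ≤ 29 / (20 n)`. -/
theorem exists_grid_near {n : ℕ} (hn : 0 < n) {r : ℝ} (hr : 0 < r) {z : ℂ} (hz : ‖z‖ ≤ r) :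
    ∃ w ∈ grid n r, ‖z - w‖ ≤ 3 / 2 / n := by
  have hn' : (0 : ℝ) < n := by exact_mod_cast hn
  set d : ℝ := min 1 (1 / 20 / (n * r)) with hd
  have hd0 : 0 < d := lt_min one_pos (by positivity)
  have hd1 : d ≤ 1 := min_le_left _ _
  have hdr : d * r ≤ 1 / 20 / n := by
    calc d * r ≤ 1 / 20 / (n * r) * r := mul_le_mul_of_nonneg_right (min_le_right _ _) hr.le
      _ = 1 / 20 / n := by field_simp
  obtain ⟨a, ha, ha'⟩ := exists_int_abs_le (n * ((1 - d) * z.re))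
  obtain ⟨b, hb, hb'⟩ := exists_int_abs_le (n * ((1 - d) * z.im))
  set w : ℂ := ((a : ℂ) + (b : ℂ) * Complex.I) / (n : ℂ) with hw
  have hwe : w = ⟨(a : ℝ) / n, (b : ℝ) / n⟩ := by
    rw [hw, ← Complex.ofReal_natCast]
    apply Complex.ext
    · rw [Complex.div_ofReal_re]; simp
    · rw [Complex.div_ofReal_im]; simp
  have hsq : ∀ {x y : ℝ}, |x| ≤ |y| → x * x ≤ y * y := fun h => by
    simpa [sq] using sq_le_sq.2 h
  refine ⟨w, ⟨⟨a, b, rfl⟩, ?_⟩, ?_⟩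
  · have h1 : ‖w‖ ≤ (1 - d) * ‖z‖ := by
      refine (pow_le_pow_iff_left₀ (norm_nonneg _) (mul_nonneg (by linarith) (norm_nonneg _))
        two_ne_zero).1 ?_
      rw [mul_pow, ← Complex.normSq_eq_norm_sq, ← Complex.normSq_eq_norm_sq, Complex.normSq_apply,
        Complex.normSq_apply, hwe]
      have h2 := hsq ha
      have h3 := hsq hb
      have : (a : ℝ) / n * (a / n) + b / n * (b / n) = (a * a + b * b) / (n * n) := by
        field_simp
      rw [this, div_le_iff₀ (by positivity)]
      nlinarith
    have : (1 - d) * ‖z‖ < r := by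
      rcases (norm_nonneg z).eq_or_lt with h | h
      · rw [← h, mul_zero]; exact hr
      · nlinarith
    exact h1.trans_lt this
  · have h1 : ‖(((1 - d : ℝ) : ℂ)) * z - w‖ ≤ 29 / 20 / n := by
      refine (pow_le_pow_iff_left₀ (norm_nonneg _) (by positivity) two_ne_zero).1 ?_
      rw [← Complex.normSq_eq_norm_sq, Complex.normSq_apply, hwe, Complex.sub_re, Complex.sub_im,
        Complex.re_ofReal_mul, Complex.im_ofReal_mul]
      have h2 := hsq (ha'.trans_eq abs_one.symm)
      have h3 := hsq (hb'.trans_eq abs_one.symm)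
      have : ((1 - d) * z.re - a / n) * ((1 - d) * z.re - a / n) +
          ((1 - d) * z.im - b / n) * ((1 - d) * z.im - b / n) =
          ((n * ((1 - d) * z.re) - a) * (n * ((1 - d) * z.re) - a) +
            (n * ((1 - d) * z.im) - b) * (n * ((1 - d) * z.im) - b)) / n ^ 2 := by
        field_simp
      change ((1 - d) * z.re - a / n) * ((1 - d) * z.re - a / n) +
          ((1 - d) * z.im - b / n) * ((1 - d) * z.im - b / n) ≤ _
      rw [this, div_pow, div_le_div_iff_of_pos_right (by positivity)]
      norm_num
      linarith
    have h2 : ‖z - ((1 - d : ℝ) : ℂ) * z‖ ≤ 1 / 20 / n := by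
      have : z - ((1 - d : ℝ) : ℂ) * z = (d : ℂ) * z := by push_cast; ring
      rw [this, norm_mul, Complex.norm_real, Real.norm_of_nonneg hd0.le]
      exact (mul_le_mul_of_nonneg_left hz hd0.le).trans hdr
    calc ‖z - w‖ = ‖(z - ((1 - d : ℝ) : ℂ) * z) + (((1 - d : ℝ) : ℂ) * z - w)‖ := by
          congr 1; ring
      _ ≤ 1 / 20 / n + 29 / 20 / n := (norm_add_le _ _).trans (add_le_add h2 h1)
      _ = 3 / 2 / n := by ring

/-! ### Approximate eigenvectors from periodised matrices -/

/-- The restriction of a sequence to a finite set of indices. -/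
def truncE (L : Finset ℤ) (f : ℤ → ℂ) : E := ∑ j ∈ L, lp.single 2 j (f j)

theorem truncE_apply (L : Finset ℤ) (f : ℤ → ℂ) (j : ℤ) :
    truncE L f j = if j ∈ L then f j else 0 := by
  rw [truncE, lp.coeFn_sum, Finset.sum_apply]
  by_cases h : j ∈ L
  · rw [if_pos h, Finset.sum_eq_single j]
    · exact lp.single_apply_self _ _ _
    · exact fun i _ hne => lp.single_apply_ne _ _ _ (Ne.symm hne)
    · exact fun h' => absurd h h'
  · rw [if_neg h]
    exact Finset.sum_eq_zero fun i hi => lp.single_apply_ne _ _ _ fun e => h (e ▸ hi)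

theorem norm_sq_truncE (L : Finset ℤ) (f : ℤ → ℂ) : ‖truncE L f‖ ^ 2 = ∑ j ∈ L, ‖f j‖ ^ 2 := by
  have := lp.norm_sum_single (p := 2) (by norm_num) f L
  simpa [truncE] using this

theorem sum_range_mul_mod (m : ℕ) {n : ℕ} (f : ℕ → ℝ) :
    ∑ k ∈ Finset.range (m * n), f (k % n) = m * ∑ k ∈ Finset.range n, f k := by
  induction m with
  | zero => simp
  | succ m ih =>
    rw [Nat.succ_mul, Finset.sum_range_add, ih, Nat.cast_succ, add_one_mul]
    congr 1
    refine Finset.sum_congr rfl fun k hk => ?_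
    rw [Nat.add_comm, Nat.add_mul_mod_self_right, Nat.mod_eq_of_lt (Finset.mem_range.1 hk)]

/-- The extension of a vector to a sequence with `n`-step multiplier `s`. -/
def quasiPeriodic (n : ℕ) (s : ℂ) (X : ℕ → ℂ) (j : ℤ) : ℂ := s ^ (j / n) * X (j % n).toNat

/-- The `n`-periodic extension of a list. -/
def listPeriodic (n : ℕ) (a : List ℂ) (j : ℤ) : ℂ := a.getD (j % n).toNat 0

/-- Crossing into the next period multiplies by `conj t`, and into the previous one by its inverse
`t`. These are the factors at the two corners, so the periodic operator acts on the extension as the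
periodised matrix acts on one period. -/
theorem quasiPeriodic_recurrence {n : ℕ} (hn : 0 < n) {t : ℂ} (ht : ‖t‖ = 1) (a b c : List ℂ)
    (X : ℕ → ℂ) (j : ℤ) :
    listPeriodic n a (j - 1) * quasiPeriodic n ((starRingEnd ℂ) t) X (j - 1) +
      listPeriodic n b j * quasiPeriodic n ((starRingEnd ℂ) t) X j +
      listPeriodic n c j * quasiPeriodic n ((starRingEnd ℂ) t) X (j + 1) =
    quasiPeriodic n ((starRingEnd ℂ) t)
      (fun i => ∑ k : Fin n, perEntry n t a b c i k * X k) j := by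
  have hn' : (0 : ℤ) < n := by exact_mod_cast hn
  have htt : t * (starRingEnd ℂ) t = 1 := by
    rw [Complex.mul_conj, Complex.normSq_eq_norm_sq, ht]; simp
  have hs : (starRingEnd ℂ) t ≠ 0 := right_ne_zero_of_mul_eq_one htt
  have hinv : ((starRingEnd ℂ) t)⁻¹ = t := inv_eq_of_mul_eq_one_left htt
  have hqr : ∀ (q : ℤ) (i : ℕ), i < n → ∀ k : ℤ, k = i + n * q → k / n = q ∧ (k % n).toNat = i := by
    intro q i hi k hk
    have h := (Int.ediv_emod_unique (r := i) (q := q) (a := k) hn').2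
      ⟨hk.symm, by omega, by exact_mod_cast hi⟩
    exact ⟨h.1, by rw [h.2]; exact Int.toNat_natCast i⟩
  obtain ⟨q, i, hi, hj⟩ : ∃ (q : ℤ) (i : ℕ), i < n ∧ j = i + n * q := by
    have h1 := Int.emod_nonneg j hn'.ne'
    have h2 := Int.emod_lt_of_pos j hn'
    refine ⟨j / n, (j % n).toNat, by omega, ?_⟩
    rw [Int.toNat_of_nonneg h1]
    exact (Int.emod_add_mul_ediv j n).symm
  obtain ⟨e1, e2⟩ := hqr q i hi j hj
  simp only [quasiPeriodic, listPeriodic, e1, e2, sum_perEntry_mul hi]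
  have hprev : a.getD ((j - 1) % n).toNat 0 *
      ((starRingEnd ℂ) t ^ ((j - 1) / n) * X ((j - 1) % n).toNat) =
      (starRingEnd ℂ) t ^ q * if i = 0 then t * a.getD (n - 1) 0 * X (n - 1) else
        a.getD (i - 1) 0 * X (i - 1) := by
    by_cases h : i = 0
    · obtain ⟨f1, f2⟩ := hqr (q - 1) (n - 1) (by omega) (j - 1) (by
        rw [hj, h, Nat.cast_sub hn]; push_cast; ring)
      rw [if_pos h, f1, f2, zpow_sub_one₀ hs, hinv]
      ring
    · obtain ⟨f1, f2⟩ := hqr q (i - 1) (by omega) (j - 1) (by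
        rw [hj, Nat.cast_sub (by omega)]; push_cast; ring)
      rw [if_neg h, f1, f2]
      ring
  have hnext : c.getD i 0 * ((starRingEnd ℂ) t ^ ((j + 1) / n) * X ((j + 1) % n).toNat) =
      (starRingEnd ℂ) t ^ q * if i + 1 = n then (starRingEnd ℂ) t * c.getD i 0 * X 0 else
        c.getD i 0 * X (i + 1) := by
    by_cases h : i + 1 = n
    · obtain ⟨f1, f2⟩ := hqr (q + 1) 0 hn (j + 1) (by
        rw [hj, ← h]; push_cast; ring)
      rw [if_pos h, f1, f2, zpow_add_one₀ hs]
      ring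
    · obtain ⟨f1, f2⟩ := hqr q (i + 1) (by omega) (j + 1) (by
        rw [hj]; push_cast; ring)
      rw [if_neg h, f1, f2]
      ring
  rw [hprev, hnext]
  ring

theorem norm_sq_truncE_quasiPeriodic (m : ℕ) {n : ℕ} {s : ℂ} (hs : ‖s‖ = 1)
    (X : ℕ → ℂ) :
    ‖truncE ((Finset.range (m * n)).map Nat.castEmbedding) (quasiPeriodic n s X)‖ ^ 2 =
      m * ∑ i ∈ Finset.range n, ‖X i‖ ^ 2 := by
  rw [norm_sq_truncE, Finset.sum_map, ← sum_range_mul_mod]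
  refine Finset.sum_congr rfl fun k _ => ?_
  rw [quasiPeriodic, norm_mul, norm_zpow, hs, one_zpow, one_mul]
  congr 3

/-- Over `m` periods the extended vector has norm `√m ‖x‖` and its interior residual is at most `√m
e ‖x‖`, while the cut adds at most `4 K ‖x‖` whatever `m` is. For large `m` the relative error
approaches `e`. -/
theorem PseudoergodicWrt.lowerBoundLE_of_perMatrix {A : E →L[ℂ] E} {Sα Sβ Sγ : Set ℂ}
    (h : PseudoergodicWrt A Sα Sβ Sγ) {n : ℕ} (hn : 0 < n) {t : ℂ} (ht : ‖t‖ = 1)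
    {a b c : List ℂ} (ha : ∀ i < n, a.getD i 0 ∈ Sα) (hb : ∀ i < n, b.getD i 0 ∈ Sβ)
    (hc : ∀ i < n, c.getD i 0 ∈ Sγ) {z : ℂ} {e : ℝ}
    (he : lowerNorm (perMatrix n t a b c - z • (1 : Matrix (Fin n) (Fin n) ℂ)) ≤ e) :
    LowerBoundLE A z e := by
  intro δ hδ
  rw [lowerNorm_le_iff hn] at he
  obtain ⟨x, hx, hle⟩ := he
  have hx0 : 0 < ‖x‖ := norm_pos_iff.2 hx
  set s : ℂ := (starRingEnd ℂ) t with hs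
  have hs1 : ‖s‖ = 1 := by rw [hs, RCLike.norm_conj, ht]
  let X : ℕ → ℂ := fun i => if h : i < n then x ⟨i, h⟩ else 0
  have hX : ∀ i : Fin n, x i = X i := fun i => by simp [X]
  have hXs : ∑ i ∈ Finset.range n, ‖X i‖ ^ 2 = ‖x‖ ^ 2 := by
    rw [EuclideanSpace.norm_sq_eq, Finset.sum_range]
    simp only [hX]
  have hXle : ∀ i, ‖X i‖ ≤ ‖x‖ := by
    intro i
    by_cases h : i < n
    · rw [← hX ⟨i, h⟩]; exact PiLp.norm_apply_le x _
    · simp [X, h]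
  let Y : ℕ → ℂ := fun i => (∑ j : Fin n, perEntry n t a b c i j * X j) - z * X i
  have hYs : ∑ i ∈ Finset.range n, ‖Y i‖ ^ 2 ≤ (e * ‖x‖) ^ 2 := by
    refine le_trans (le_of_eq ?_) (pow_le_pow_left₀ (norm_nonneg _) hle 2)
    rw [EuclideanSpace.norm_sq_eq, Finset.sum_range]
    refine Finset.sum_congr rfl fun i _ => ?_
    have : matOp (perMatrix n t a b c - z • (1 : Matrix (Fin n) (Fin n) ℂ)) =
        matOp (perMatrix n t a b c) - z • 1 := by
      unfold matOp
      rw [map_sub, map_smul, map_one]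
    rw [this]
    simp [Matrix.mulVec, dotProduct, perMatrix, hX, Y]
  have he0 : 0 ≤ e := nonneg_of_mul_nonneg_left ((norm_nonneg _).trans hle) hx0
  -- the extended sequences
  have hmod : ∀ j : ℤ, (j % n).toNat < n := fun j => by
    have h1 := Int.emod_nonneg j (show (n : ℤ) ≠ 0 by omega)
    have h2 := Int.emod_lt_of_pos j (show (0 : ℤ) < n by omega)
    omega
  set u := quasiPeriodic n s X with hu
  set y := quasiPeriodic n s Y with hy
  set α := listPeriodic n a with hα
  set β := listPeriodic n b with hβ
  set γ := listPeriodic n c with hγ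
  have hule : ∀ j, ‖u j‖ ≤ ‖x‖ := fun j => by
    rw [hu, quasiPeriodic, norm_mul, norm_zpow, hs1, one_zpow, one_mul]
    exact hXle _
  have hrec : ∀ j, y j = α (j - 1) * u (j - 1) + β j * u j + γ j * u (j + 1) - z * u j := by
    intro j
    rw [quasiPeriodic_recurrence hn ht a b c X j, hy, hu]
    simp only [quasiPeriodic, Y]
    ring
  set K : ℝ := ∑ i ∈ Finset.range n, (‖a.getD i 0‖ + ‖c.getD i 0‖) with hK
  have hKle : ∀ i < n, ‖a.getD i 0‖ + ‖c.getD i 0‖ ≤ K := fun i hi =>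
    Finset.single_le_sum (f := fun i => ‖a.getD i 0‖ + ‖c.getD i 0‖)
      (fun i _ => by positivity) (Finset.mem_range.2 hi)
  have hαu : ∀ i j, ‖α i * u j‖ ≤ K * ‖x‖ := fun i j => by
    rw [norm_mul]
    have := hKle _ (hmod i)
    have hle' : ‖α i‖ ≤ K := by
      rw [hα, listPeriodic]
      exact (le_add_of_nonneg_right (norm_nonneg _)).trans this
    exact mul_le_mul hle' (hule j) (norm_nonneg _)
      ((add_nonneg (norm_nonneg _) (norm_nonneg _)).trans this)
  have hγu : ∀ i j, ‖γ i * u j‖ ≤ K * ‖x‖ := fun i j => by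
    rw [norm_mul]
    have := hKle _ (hmod i)
    have hle' : ‖γ i‖ ≤ K := by
      rw [hγ, listPeriodic]
      exact (le_add_of_nonneg_left (norm_nonneg _)).trans this
    exact mul_le_mul hle' (hule j) (norm_nonneg _)
      ((add_nonneg (norm_nonneg _) (norm_nonneg _)).trans this)
  -- the number of periods
  set d : ℝ := (e + δ) / 2 with hd
  -- Large enough for the four boundary terms to be absorbed by `(d - e) √m`; the added `1`
  -- guarantees `m > 0`.
  obtain ⟨m, hm⟩ := exists_nat_ge ((4 * K / (d - e)) ^ 2 + 1)
  have hde : 0 < d - e := by rw [hd]; linarith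
  have hmsq : 4 * K ≤ (d - e) * √m := by
    rw [mul_comm (d - e), ← div_le_iff₀ hde]
    exact Real.le_sqrt_of_sq_le (by linarith)
  have hm0 : 0 < m := by
    rw [Nat.pos_iff_ne_zero]
    rintro rfl
    have := sq_nonneg (4 * K / (d - e))
    norm_num at hm
    linarith
  have hmn : (0 : ℤ) < m * n := by exact_mod_cast Nat.mul_pos hm0 hn
  set L : Finset ℤ := (Finset.range (m * n)).map Nat.castEmbedding with hL
  have hmem : ∀ j : ℤ, j ∈ L ↔ 0 ≤ j ∧ j < m * n := by
    intro j
    simp only [hL, Finset.mem_map, Finset.mem_range, Nat.castEmbedding_apply]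
    constructor
    · rintro ⟨k, hk, rfl⟩
      exact ⟨by omega, by exact_mod_cast hk⟩
    · rintro ⟨h1, h2⟩
      refine ⟨j.toNat, ?_, Int.toNat_of_nonneg h1⟩
      zify
      rwa [Int.toNat_of_nonneg h1]
  have hvn : ‖truncE L u‖ = √m * ‖x‖ := by
    refine (pow_left_inj₀ (norm_nonneg _) (by positivity) two_ne_zero).1 ?_
    rw [hL, hu, norm_sq_truncE_quasiPeriodic m hs1, hXs, mul_pow, Real.sq_sqrt (by positivity)]
  have hyn : ‖truncE L y‖ ≤ √m * (e * ‖x‖) := by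
    refine (pow_le_pow_iff_left₀ (norm_nonneg _) (by positivity) two_ne_zero).1 ?_
    rw [hL, hy, norm_sq_truncE_quasiPeriodic m hs1, mul_pow, Real.sq_sqrt (by positivity)]
    exact mul_le_mul_of_nonneg_left hYs (by positivity)
  -- The residual of the cut-off sequence: the first and last rows lose a neighbour, and the two
  -- rows just outside the support each gain one term.
  let w : E := truncE L y - truncE {0} (fun i => α (i - 1) * u (i - 1)) -
    truncE {(m * n : ℤ) - 1} (fun i => γ i * u (i + 1)) +
    truncE {-1} (fun i => γ i * u (i + 1)) +
    truncE {(m * n : ℤ)} (fun i => α (i - 1) * u (i - 1))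
  have hsingle : ∀ (k : ℤ) (f : ℤ → ℂ), ‖f k‖ ≤ K * ‖x‖ → ‖truncE {k} f‖ ≤ K * ‖x‖ := by
    intro k f hf
    rw [truncE, Finset.sum_singleton, lp.norm_single (by norm_num)]
    exact hf
  -- The words index the superdiagonal by row, the operator by column, hence the shift `γ (j - 1)`.
  refine h.exists_of_finite_support (a := α) (b := β) (c := fun j => γ (j - 1))
    (fun j => ha _ (hmod j)) (fun j => hb _ (hmod j)) (fun j => hc _ (hmod _)) (v := truncE L u)
    (w := w) (N := m * n) (z := z) (d := d) ?_ ?_ ?_ ?_ (by rw [hd]; linarith)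
  · rw [← norm_pos_iff, hvn]
    have : (0 : ℝ) < m := by exact_mod_cast hm0
    positivity
  · intro j hj
    rw [truncE_apply, if_neg]
    rw [hmem]
    rintro ⟨h1, h2⟩
    rw [abs_of_nonneg h1] at hj
    push_cast at hj
    omega
  · intro i
    have hwi : w i = truncE L y i - truncE {0} (fun i => α (i - 1) * u (i - 1)) i -
        truncE {(m * n : ℤ) - 1} (fun i => γ i * u (i + 1)) i +
        truncE {-1} (fun i => γ i * u (i + 1)) i +
        truncE {(m * n : ℤ)} (fun i => α (i - 1) * u (i - 1)) i := rfl
    rw [hwi]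
    simp only [truncE_apply, Finset.mem_singleton, hmem, add_sub_cancel_right, hrec]
    generalize (m * n : ℤ) = l at hmn
    by_cases h1 : 0 ≤ i - 1 ∧ i - 1 < l <;> by_cases h2 : 0 ≤ i ∧ i < l <;>
      by_cases h3 : 0 ≤ i + 1 ∧ i + 1 < l
    · rw [if_pos h1, if_pos h2, if_pos h3, if_neg (by omega), if_neg (by omega),
        if_neg (by omega), if_neg (by omega), if_pos h2]
      ring
    · rw [if_pos h1, if_pos h2, if_neg h3, if_neg (by omega), if_pos (by omega),
        if_neg (by omega), if_neg (by omega), if_pos h2]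
      ring
    · omega
    · rw [if_pos h1, if_neg h2, if_neg h3, if_neg (by omega), if_neg (by omega),
        if_neg (by omega), if_pos (by omega), if_neg h2]
      ring
    · rw [if_neg h1, if_pos h2, if_pos h3, if_pos (by omega), if_neg (by omega),
        if_neg (by omega), if_neg (by omega), if_pos h2]
      ring
    · rw [if_neg h1, if_pos h2, if_neg h3, if_pos (by omega), if_pos (by omega),
        if_neg (by omega), if_neg (by omega), if_pos h2]
      ring
    · rw [if_neg h1, if_neg h2, if_pos h3, if_neg (by omega), if_neg (by omega),
        if_pos (by omega), if_neg (by omega), if_neg h2]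
      ring
    · rw [if_neg h1, if_neg h2, if_neg h3, if_neg (by omega), if_neg (by omega),
        if_neg (by omega), if_neg (by omega), if_neg h2]
      ring
  · have h1 := hsingle 0 (fun i => α (i - 1) * u (i - 1)) (hαu _ _)
    have h2 := hsingle ((m * n : ℤ) - 1) (fun i => γ i * u (i + 1)) (hγu _ _)
    have h3 := hsingle (-1) (fun i => γ i * u (i + 1)) (hγu _ _)
    have h4 := hsingle (m * n : ℤ) (fun i => α (i - 1) * u (i - 1)) (hαu _ _)
    have hwn : ‖w‖ ≤ ‖truncE L y‖ + K * ‖x‖ + K * ‖x‖ + K * ‖x‖ + K * ‖x‖ :=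
      (norm_add_le _ _).trans (add_le_add ((norm_add_le _ _).trans (add_le_add
        ((norm_sub_le _ _).trans (add_le_add ((norm_sub_le _ _).trans
          (add_le_add le_rfl h1)) h2)) h3)) h4)
    rw [hvn]
    have h5 : 4 * K * ‖x‖ ≤ (d - e) * √m * ‖x‖ := mul_le_mul_of_nonneg_right hmsq hx0.le
    calc ‖w‖ ≤ √m * (e * ‖x‖) + 4 * K * ‖x‖ := by linarith
      _ ≤ √m * (e * ‖x‖) + (d - e) * √m * ‖x‖ := by linarith
      _ = d * (√m * ‖x‖) := by ring

/-! ### Windows of approximate eigenvectors -/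

/-- The discrete sine profile `sin ((2 i - 1) π / (2 n))`. -/
def sineProfile (n i : ℕ) : ℝ := Real.sin ((2 * i - 1) * (Real.pi / (2 * n)))

/-- The rate of variation of the sine profile, `2 sin (π / (2 n))`. -/
def sineRate (n : ℕ) : ℝ := 2 * Real.sin (Real.pi / (2 * n))

/-! ### Summation identities for the sine profile -/

section sine

variable {n : ℕ}

theorem sineProfile_one (n : ℕ) : sineProfile n 1 = Real.sin (Real.pi / (2 * n)) := by
  rw [sineProfile]; congr 1; push_cast; ring

theorem sineProfile_zero (n : ℕ) : sineProfile n 0 = -sineProfile n 1 := by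
  rw [sineProfile_one, sineProfile, ← Real.sin_neg]; congr 1; push_cast; ring

theorem sineProfile_self (hn : 0 < n) : sineProfile n n = sineProfile n 1 := by
  have : (n : ℝ) ≠ 0 := by positivity
  rw [sineProfile_one, sineProfile, ← Real.sin_pi_sub]; congr 1; field_simp; ring

theorem sineProfile_succ_self (hn : 0 < n) : sineProfile n (n + 1) = -sineProfile n 1 := by
  have : (n : ℝ) ≠ 0 := by positivity
  rw [sineProfile_one, sineProfile, ← Real.sin_add_pi]; congr 1; push_cast; field_simp; ring

theorem sineProfile_pos {i : ℕ} (hi : 0 < i) (hin : i ≤ n) : 0 < sineProfile n i := by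
  have h1 : (1 : ℝ) ≤ i := by exact_mod_cast hi
  have h2 : (i : ℝ) ≤ n := by exact_mod_cast hin
  have hn : (0 : ℝ) < n := by linarith
  refine Real.sin_pos_of_pos_of_lt_pi (mul_pos (by linarith) (by positivity)) ?_
  rw [← mul_div_assoc, div_lt_iff₀ (by positivity), mul_comm]
  exact mul_lt_mul_of_pos_left (by linarith) Real.pi_pos

/-- The profile is an eigenvector of the discrete Laplacian; the eigenvalue is `2 - 2 cos (π / n) =
4 sin² (π / (2 n))`, the square of `sineRate`. -/
theorem sineProfile_recurrence (n i : ℕ) :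
    sineProfile n (i + 2) = (2 - sineRate n ^ 2) * sineProfile n (i + 1) - sineProfile n i := by
  set θ := Real.pi / (2 * n) with hθ
  have h1 : sineProfile n (i + 2) = Real.sin ((2 * i + 1) * θ + 2 * θ) := by
    rw [sineProfile]; congr 1; push_cast; ring
  have h2 : sineProfile n i = Real.sin ((2 * i + 1) * θ - 2 * θ) := by
    rw [sineProfile]; congr 1; ring
  have h3 : sineProfile n (i + 1) = Real.sin ((2 * i + 1) * θ) := by
    rw [sineProfile]; congr 1; push_cast; ring
  rw [h1, h2, h3, sineRate, Real.sin_add, Real.sin_sub, Real.cos_two_mul, Real.cos_sq']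
  ring

theorem sineRate_pos (hn : 0 < n) : 0 < sineRate n := by
  rw [sineRate, ← sineProfile_one]
  exact mul_pos two_pos (sineProfile_pos one_pos hn)

/-- This is where the constant `22 / 7` enters, as a rational upper bound for `π`. -/
theorem sineRate_le (hn : 0 < n) : sineRate n ≤ 22 / (7 * n) := by
  have hn' : (0 : ℝ) < n := by exact_mod_cast hn
  calc sineRate n ≤ 2 * (Real.pi / (2 * n)) :=
        mul_le_mul_of_nonneg_left (Real.sin_le (by positivity)) two_pos.le
    _ = Real.pi / n := by field_simp
    _ ≤ (22 / 7) / n := by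
        gcongr
        have := Real.pi_lt_d4
        norm_num at this ⊢
        linarith
    _ = 22 / (7 * n) := by field_simp

/-- Summation by parts: by the recurrence the difference of the summands telescopes, and the
boundary values at `0` and `n` agree because the profile changes sign across both ends. -/
theorem sum_sq_sineProfile_sub (hn : 0 < n) :
    ∑ i ∈ Finset.range n, (sineProfile n (i + 1) - sineProfile n i) ^ 2 =
      sineRate n ^ 2 * ∑ i ∈ Finset.range n, sineProfile n (i + 1) ^ 2 := by
  have h := Finset.sum_range_sub
    (fun i => sineProfile n (i + 1) * sineProfile n i - sineProfile n i ^ 2) n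
  have h' : ∀ i, sineProfile n (i + 1 + 1) * sineProfile n (i + 1) - sineProfile n (i + 1) ^ 2 -
      (sineProfile n (i + 1) * sineProfile n i - sineProfile n i ^ 2) =
      (sineProfile n (i + 1) - sineProfile n i) ^ 2 -
        sineRate n ^ 2 * sineProfile n (i + 1) ^ 2 := by
    intro i
    rw [sineProfile_recurrence]
    ring
  simp only [h', Finset.sum_sub_distrib, ← Finset.mul_sum] at h
  rw [sineProfile_succ_self hn, sineProfile_self hn, zero_add, sineProfile_zero] at h
  linarith

theorem sum_sq_sineProfile_sub_succ (hn : 0 < n) :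
    ∑ i ∈ Finset.range n, (sineProfile n (i + 2) - sineProfile n (i + 1)) ^ 2 =
      sineRate n ^ 2 * ∑ i ∈ Finset.range n, sineProfile n (i + 1) ^ 2 := by
  have h := Finset.sum_range_sub
    (fun i => sineProfile n (i + 1) ^ 2 - sineProfile n (i + 1) * sineProfile n i) n
  have h' : ∀ i, sineProfile n (i + 1 + 1) ^ 2 - sineProfile n (i + 1 + 1) * sineProfile n (i + 1) -
      (sineProfile n (i + 1) ^ 2 - sineProfile n (i + 1) * sineProfile n i) =
      (sineProfile n (i + 2) - sineProfile n (i + 1)) ^ 2 -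
        sineRate n ^ 2 * sineProfile n (i + 1) ^ 2 := by
    intro i
    rw [sineProfile_recurrence]
    ring
  simp only [h', Finset.sum_sub_distrib, ← Finset.mul_sum] at h
  rw [sineProfile_succ_self hn, sineProfile_self hn, zero_add, sineProfile_zero] at h
  linarith

theorem sum_sq_sineProfile_pos (hn : 0 < n) :
    0 < ∑ i ∈ Finset.range n, sineProfile n (i + 1) ^ 2 :=
  Finset.sum_pos (fun i hi => pow_pos (sineProfile_pos i.succ_pos
    (Finset.mem_range.1 hi)) 2) ⟨0, Finset.mem_range.2 hn⟩

/-- Cauchy–Schwarz with weights `r`, `p σ`, `q σ`, where `σ` is the rate. After summation each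
difference term contributes `σ²` times the sum of squares of the profile, so the factor `r + (p + q)
σ` appears twice. -/
theorem sum_sq_sineProfile_combination_le (hn : 0 < n) {r p q : ℝ} (hr : 0 ≤ r) (hp : 0 ≤ p)
    (hq : 0 ≤ q) :
    ∑ i ∈ Finset.range n, (r * sineProfile n (i + 1) +
        p * |sineProfile n (i + 1) - sineProfile n i| +
        q * |sineProfile n (i + 2) - sineProfile n (i + 1)|) ^ 2 ≤
      (r + (p + q) * sineRate n) ^ 2 * ∑ i ∈ Finset.range n, sineProfile n (i + 1) ^ 2 := by
  have hσ := sineRate_pos hn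
  set σ := sineRate n with hσd
  have key : ∀ w x y : ℝ, (r * w + p * |x| + q * |y|) ^ 2 ≤
      (r + (p + q) * σ) * (r * w ^ 2 + p / σ * x ^ 2 + q / σ * y ^ 2) := by
    intro w x y
    -- Scaling the differences by `σ` makes the gap in Cauchy–Schwarz an explicit sum of squares,
    -- valid also when some weights vanish.
    obtain ⟨e, he⟩ : ∃ e, |x| = σ * e := ⟨|x| / σ, by field_simp⟩
    obtain ⟨f, hf⟩ : ∃ f, |y| = σ * f := ⟨|y| / σ, by field_simp⟩
    rw [← sq_abs x, ← sq_abs y, he, hf]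
    have : (r + (p + q) * σ) * (r * w ^ 2 + p / σ * (σ * e) ^ 2 + q / σ * (σ * f) ^ 2) -
        (r * w + p * (σ * e) + q * (σ * f)) ^ 2 =
        r * p * σ * (w - e) ^ 2 + r * q * σ * (w - f) ^ 2 + p * q * σ ^ 2 * (e - f) ^ 2 := by
      field_simp
      ring
    have h2 : 0 ≤ r * p * σ * (w - e) ^ 2 + r * q * σ * (w - f) ^ 2 +
        p * q * σ ^ 2 * (e - f) ^ 2 := by positivity
    linarith
  refine (Finset.sum_le_sum fun i _ => key _ _ _).trans (le_of_eq ?_)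
  rw [← Finset.mul_sum, Finset.sum_add_distrib, Finset.sum_add_distrib, ← Finset.mul_sum,
    ← Finset.mul_sum, ← Finset.mul_sum, sum_sq_sineProfile_sub hn, sum_sq_sineProfile_sub_succ hn,
    ← hσd]
  field_simp
  ring

end sine

/-- The subdiagonal entries of `A` on a window of length `n`. -/
def windowSub (A : E →L[ℂ] E) (n : ℕ) (k : ℤ) : List ℂ :=
  List.ofFn fun j : Fin n => subdiag A (k + (j : ℕ))

/-- The diagonal entries of `A` on a window of length `n`. -/
def windowDiag (A : E →L[ℂ] E) (n : ℕ) (k : ℤ) : List ℂ :=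
  List.ofFn fun j : Fin n => diagonal A (k + (j : ℕ))

/-- The superdiagonal entries of `A` on a window of length `n`, in cyclic order. -/
def windowSuper (A : E →L[ℂ] E) (n : ℕ) (k : ℤ) : List ℂ :=
  List.ofFn fun j : Fin n => superdiag A (if (j : ℕ) + 1 = n then k else k + (j : ℕ) + 1)

theorem getD_ofFn {n i : ℕ} (hi : i < n) (f : ℕ → ℂ) :
    (List.ofFn fun j : Fin n => f j).getD i 0 = f i := by
  simp [List.getD_eq_getElem?_getD, hi]

theorem exists_mul_apply {f : ℤ → ℂ} {p : ℝ} (hf : ∀ j, ‖f j‖ ≤ p) (x : E) :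
    ∃ g : E, (∀ j, g j = f j * x j) ∧ ‖g‖ ≤ p * ‖x‖ := by
  have hp : 0 ≤ p := (norm_nonneg _).trans (hf 0)
  have hb : ∀ j, ‖f j * x j‖ ≤ p * ‖x j‖ := fun j => by
    rw [norm_mul]; exact mul_le_mul_of_nonneg_right (hf j) (norm_nonneg _)
  have hm : Memℓp (fun j => f j * x j) 2 := by
    rw [memlp_two_iff]
    refine Summable.of_nonneg_of_le (fun _ => by positivity) (fun j => ?_)
      ((hasSum_norm_sq x).summable.mul_left (p ^ 2))
    rw [← mul_pow]
    exact pow_le_pow_left₀ (norm_nonneg _) (hb j) 2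
  exact ⟨⟨_, hm⟩, fun _ => rfl, norm_le_of_forall_norm_le hp hb⟩

/-- Tapering commutes with the operator up to differences of the profile. Each corner pairs an entry
of `A` with the coordinate it multiplies in `A` (columns `k + n - 1` and `k`), so all errors are
values of the globally square summable sequences `G` and `H`. -/
theorem window_row (A : E →L[ℂ] E) {x G H : ℤ → ℂ} {n : ℕ} (t : ℂ) (V : ℕ → ℝ)
    (hG : ∀ j, G j = subdiag A j * x j) (hH : ∀ j, H j = superdiag A j * x j) (z : ℂ) (k : ℤ)
    {i : ℕ} (hi : i < n) :
    (∑ j : Fin n, perEntry n t (windowSub A n k) (windowDiag A n k)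
      (windowSuper A n k) i j * ((V ((j : ℕ) + 1) : ℂ) * x (k + (j : ℕ)))) -
        z * (V (i + 1) * x (k + i)) =
      V (i + 1) * (G (k + i - 1) + diagonal A (k + i) * x (k + i) + H (k + i + 1) - z * x (k + i)) +
      (if i = 0 then t * V n * G (k + (n - 1)) - V 1 * G (k + -1)
        else (V i - V (i + 1)) * G (k + (i - 1))) +
      (if i + 1 = n then (starRingEnd ℂ) t * V 1 * H k - V n * H (k + n)
        else (V (i + 2) - V (i + 1)) * H (k + (i + 1))) := by
  rw [sum_perEntry_mul hi t _ _ _ (fun j => (V (j + 1) : ℂ) * x (k + (j : ℕ))), windowSub,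
    windowDiag, windowSuper,
    getD_ofFn hi (fun j => diagonal A (k + (j : ℕ))),
    getD_ofFn hi (fun j => superdiag A (if j + 1 = n then k else k + (j : ℕ) + 1)),
    getD_ofFn (show n - 1 < n by omega) (fun j => subdiag A (k + (j : ℕ))),
    getD_ofFn (show i - 1 < n by omega) (fun j => subdiag A (k + (j : ℕ)))]
  have e1 : (if i = 0 then t * subdiag A (k + (n - 1 : ℕ)) * (V (n - 1 + 1) * x (k + (n - 1 : ℕ)))
      else subdiag A (k + (i - 1 : ℕ)) * (V (i - 1 + 1) * x (k + (i - 1 : ℕ)))) =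
      (if i = 0 then t * V n * G (k + (n - 1)) - V 1 * G (k + -1)
        else (V i - V (i + 1)) * G (k + (i - 1))) + V (i + 1) * G (k + i - 1) := by
    by_cases h0 : i = 0
    · have hn1 : n - 1 + 1 = n := by omega
      have hn2 : ((n - 1 : ℕ) : ℤ) = n - 1 := by omega
      rw [if_pos h0, if_pos h0, h0, hn1, hn2, hG (k + (n - 1)), Nat.cast_zero, add_zero,
        ← sub_eq_add_neg]
      ring
    · have hi1 : i - 1 + 1 = i := by omega
      have hi2 : ((i - 1 : ℕ) : ℤ) = i - 1 := by omega
      rw [if_neg h0, if_neg h0, hi1, hi2, ← add_sub_assoc, hG]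
      ring
  have e2 : (if i + 1 = n then (starRingEnd ℂ) t *
        superdiag A (if i + 1 = n then k else k + (i : ℕ) + 1) * (V (0 + 1) * x (k + (0 : ℕ)))
      else superdiag A (if i + 1 = n then k else k + (i : ℕ) + 1) *
        (V (i + 1 + 1) * x (k + (i + 1 : ℕ)))) =
      (if i + 1 = n then (starRingEnd ℂ) t * V 1 * H k - V n * H (k + n)
        else (V (i + 2) - V (i + 1)) * H (k + (i + 1))) + V (i + 1) * H (k + i + 1) := by
    by_cases h0 : i + 1 = n
    · have h1 : k + (i : ℤ) + 1 = k + n := by omega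
      rw [if_pos h0, if_pos h0, if_pos h0, h1, h0, hH k, Nat.cast_zero, add_zero, zero_add]
      ring
    · rw [if_neg h0, if_neg h0, if_neg h0, Nat.cast_succ, ← add_assoc, hH (k + i + 1)]
      ring
  rw [e1, e2]
  ring

/-- For fixed row `i`, the error as a function of the window position `k` is a combination of
translates, so its norm over all positions follows from the triangle inequality. The two corner
contributions have total weight `V n + V 1 = 2 V 1`, equal to the jump of the profile at that end;
only `|t| = 1` is used. -/
theorem exists_window_residual {d G H : E} {r p q X : ℝ} {n : ℕ} (hn : 0 < n) {t : ℂ}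
    (ht : ‖t‖ = 1) (hd : ‖d‖ ≤ r * X)
    (hGn : ‖G‖ ≤ p * X) (hHn : ‖H‖ ≤ q * X) :
    ∃ F : ℕ → E, (∀ (k : ℤ) (i : ℕ), F i k = (sineProfile n (i + 1) : ℂ) * d (k + i) +
      (if i = 0 then t * sineProfile n n * G (k + (n - 1)) - sineProfile n 1 * G (k + -1)
        else (sineProfile n i - sineProfile n (i + 1)) * G (k + (i - 1))) +
      (if i + 1 = n then (starRingEnd ℂ) t * sineProfile n 1 * H k - sineProfile n n * H (k + n)
        else (sineProfile n (i + 2) - sineProfile n (i + 1)) * H (k + (i + 1)))) ∧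
      ∀ i < n, ‖F i‖ ≤ (r * sineProfile n (i + 1) + p * |sineProfile n (i + 1) - sineProfile n i| +
        q * |sineProfile n (i + 2) - sineProfile n (i + 1)|) * X := by
  set V := sineProfile n with hV
  have hV0 : V 0 = -V 1 := sineProfile_zero n
  have hVn : V n = V 1 := sineProfile_self hn
  have hVn1 : V (n + 1) = -V 1 := sineProfile_succ_self hn
  have hV1 : 0 < V 1 := sineProfile_pos one_pos hn
  have hVpos : ∀ i < n, 0 < V (i + 1) := fun i hi => sineProfile_pos i.succ_pos hi
  let F₁ : ℕ → E := fun i => if i = 0 then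
      (t * V n) • shiftE (n - 1 : ℤ) G - (V 1 : ℂ) • shiftE (-1) G
    else ((V i : ℂ) - V (i + 1)) • shiftE (i - 1 : ℤ) G
  let F₂ : ℕ → E := fun i => if i + 1 = n then
      ((starRingEnd ℂ) t * V 1) • H - (V n : ℂ) • shiftE (n : ℤ) H
    else ((V (i + 2) : ℂ) - V (i + 1)) • shiftE (i + 1 : ℤ) H
  let F : ℕ → E := fun i => (V (i + 1) : ℂ) • shiftE (i : ℤ) d + F₁ i + F₂ i
  have hV1n : ‖(V 1 : ℂ)‖ = V 1 := by rw [Complex.norm_real, Real.norm_of_nonneg hV1.le]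
  have hF₁ : ∀ i, ‖F₁ i‖ ≤ p * |V (i + 1) - V i| * X := by
    intro i
    by_cases h0 : i = 0
    · simp only [F₁, if_pos h0]
      refine (norm_sub_le _ _).trans ?_
      rw [norm_smul, norm_smul, norm_mul, ht, hVn, hV1n, LinearIsometryEquiv.norm_map,
        LinearIsometryEquiv.norm_map, h0, zero_add, hV0, sub_neg_eq_add, abs_of_pos (by linarith)]
      nlinarith
    · simp only [F₁, if_neg h0]
      rw [norm_smul, LinearIsometryEquiv.norm_map, ← Complex.ofReal_sub, Complex.norm_real,
        Real.norm_eq_abs, abs_sub_comm]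
      nlinarith [abs_nonneg (V (i + 1) - V i)]
  have hF₂ : ∀ i, ‖F₂ i‖ ≤ q * |V (i + 2) - V (i + 1)| * X := by
    intro i
    by_cases h0 : i + 1 = n
    · simp only [F₂, if_pos h0]
      refine (norm_sub_le _ _).trans ?_
      have h2 : i + 2 = n + 1 := by omega
      rw [norm_smul, norm_smul, norm_mul, RCLike.norm_conj, ht, h2, h0, hVn1, hVn, hV1n,
        LinearIsometryEquiv.norm_map, abs_of_neg (by linarith)]
      nlinarith
    · simp only [F₂, if_neg h0]
      rw [norm_smul, LinearIsometryEquiv.norm_map, ← Complex.ofReal_sub, Complex.norm_real,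
        Real.norm_eq_abs]
      nlinarith [abs_nonneg (V (i + 2) - V (i + 1))]
  have hF : ∀ i < n, ‖F i‖ ≤ (r * V (i + 1) + p * |V (i + 1) - V i| +
      q * |V (i + 2) - V (i + 1)|) * X := by
    intro i hi
    refine norm_add₃_le.trans ?_
    have : ‖(V (i + 1) : ℂ) • shiftE (i : ℤ) d‖ ≤ r * V (i + 1) * X := by
      rw [norm_smul, LinearIsometryEquiv.norm_map, Complex.norm_real,
        Real.norm_of_nonneg (hVpos i hi).le]
      nlinarith [hVpos i hi]
    have h1 := hF₁ i
    have h2 := hF₂ i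
    linarith
  refine ⟨F, fun k i => ?_, hF⟩
  have a1 : F i k = V (i + 1) * d (k + i) + F₁ i k + F₂ i k := rfl
  have a2 : F₁ i k = if i = 0 then t * V n * G (k + (n - 1)) - V 1 * G (k + -1)
      else (V i - V (i + 1)) * G (k + (i - 1)) := by
    by_cases h0 : i = 0
    · simp only [F₁, if_pos h0]; rfl
    · simp only [F₁, if_neg h0]; rfl
  have a3 : F₂ i k = if i + 1 = n then (starRingEnd ℂ) t * V 1 * H k - V n * H (k + n)
      else (V (i + 2) - V (i + 1)) * H (k + (i + 1)) := by
    by_cases h0 : i + 1 = n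
    · simp only [F₂, if_pos h0]; rfl
    · simp only [F₂, if_neg h0]; rfl
  rw [a1, a2, a3]

set_option maxHeartbeats 400000 in
/-- An approximate eigenvector of a tridiagonal operator can be cut off, by the sine profile, to an
approximate eigenvector of some periodised window, with a loss controlled by the rate of the
profile. -/
theorem exists_window {A : E →L[ℂ] E} (hA : IsTridiagonal A) {p q : ℝ}
    (hp : ∀ j, ‖subdiag A j‖ ≤ p) (hq : ∀ j, ‖superdiag A j‖ ≤ q) {x : E} (hx : x ≠ 0) {z : ℂ}
    {r c : ℝ} (hr : 0 ≤ r) (hxr : ‖A x - z • x‖ ≤ r * ‖x‖) {n : ℕ} (hn : 0 < n) {t : ℂ}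
    (ht : ‖t‖ = 1) (hc : r + (p + q) * sineRate n < c) :
    ∃ k, lowerNorm (perMatrix n t (windowSub A n k) (windowDiag A n k) (windowSuper A n k) -
      z • (1 : Matrix (Fin n) (Fin n) ℂ)) ≤ c := by
  have hp0 : 0 ≤ p := (norm_nonneg _).trans (hp 0)
  have hq0 : 0 ≤ q := (norm_nonneg _).trans (hq 0)
  have hx0 : 0 < ‖x‖ := norm_pos_iff.2 hx
  have hσ := sineRate_pos hn
  obtain ⟨G, hG, hGn⟩ := exists_mul_apply hp x
  obtain ⟨H, hH, hHn⟩ := exists_mul_apply hq x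
  set d : E := A x - z • x with hd
  have hdi : ∀ i, d i = G (i - 1) + diagonal A i * x i + H (i + 1) - z * x i := by
    intro i
    rw [hG, hH, ← hA.apply x i]
    rfl
  set V := sineProfile n with hV
  have hV0 : V 0 = -V 1 := sineProfile_zero n
  have hVn : V n = V 1 := sineProfile_self hn
  have hVn1 : V (n + 1) = -V 1 := sineProfile_succ_self hn
  have hV1 : 0 < V 1 := sineProfile_pos one_pos hn
  have hVpos : ∀ i < n, 0 < V (i + 1) := fun i hi => sineProfile_pos i.succ_pos hi
  obtain ⟨F, hFk, hF⟩ := exists_window_residual hn ht hxr hGn hHn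
  rw [← hV] at hF hFk
  set S := ∑ i ∈ Finset.range n, V (i + 1) ^ 2 with hS
  have hS0 : 0 < S := sum_sq_sineProfile_pos hn
  have hFS : ∑ i ∈ Finset.range n, ‖F i‖ ^ 2 ≤ (r + (p + q) * sineRate n) ^ 2 * S * ‖x‖ ^ 2 := by
    refine (Finset.sum_le_sum fun i hi => pow_le_pow_left₀ (norm_nonneg _)
      (hF i (Finset.mem_range.1 hi)) 2).trans ?_
    simp only [mul_pow _ ‖x‖]
    rw [← Finset.sum_mul]
    exact mul_le_mul_of_nonneg_right (sum_sq_sineProfile_combination_le hn hr hp0 hq0)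
      (by positivity)
  let Y : ℤ → ℕ → ℂ := fun k i => V (i + 1) * x (k + i)
  have hrow : ∀ k : ℤ, ∀ i < n, (∑ j : Fin n, perEntry n t (windowSub A n k) (windowDiag A n k)
      (windowSuper A n k) i j * Y k j) - z * Y k i = F i k := by
    intro k i hi
    rw [hFk, hdi]
    exact window_row A (G := G) (H := H) t V hG hH z k hi
  -- Averaging over windows: if all failed, adding their inequalities over `k` would give `c² S ‖x‖²
  -- ≤ (r + (p + q) σ)² S ‖x‖²`, against the choice of `c`. Windows on which `x` vanishes do no
  -- harm, as the inequality below is not normalised.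
  by_contra! hcon
  have hc0 : 0 ≤ c := by
    have : 0 ≤ (p + q) * sineRate n := by positivity
    linarith
  have hk : ∀ k, c ^ 2 * ∑ i ∈ Finset.range n, V (i + 1) ^ 2 * ‖x (k + i)‖ ^ 2 ≤
      ∑ i ∈ Finset.range n, ‖F i k‖ ^ 2 := by
    intro k
    let y : EuclideanSpace ℂ (Fin n) := WithLp.toLp 2 fun i => Y k i
    have hyn : ‖y‖ ^ 2 = ∑ i ∈ Finset.range n, V (i + 1) ^ 2 * ‖x (k + i)‖ ^ 2 := by
      rw [EuclideanSpace.norm_sq_eq, Finset.sum_range]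
      refine Finset.sum_congr rfl fun i _ => ?_
      simp [y, Y, mul_pow]
    have hMy : ‖matOp (perMatrix n t (windowSub A n k) (windowDiag A n k) (windowSuper A n k) -
        z • (1 : Matrix (Fin n) (Fin n) ℂ)) y‖ ^ 2 = ∑ i ∈ Finset.range n, ‖F i k‖ ^ 2 := by
      rw [EuclideanSpace.norm_sq_eq, Finset.sum_range]
      refine Finset.sum_congr rfl fun i _ => ?_
      rw [← hrow k i i.2]
      have : ∀ M : Matrix (Fin n) (Fin n) ℂ, matOp (M - z • (1 : Matrix (Fin n) (Fin n) ℂ)) =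
          matOp M - z • 1 := by
        intro M
        unfold matOp
        rw [map_sub, map_smul, map_one]
      rw [this]
      simp [Matrix.mulVec, dotProduct, perMatrix, y]
    rw [← hyn, ← hMy, ← mul_pow]
    refine pow_le_pow_left₀ (by positivity) ?_ 2
    by_cases hy : y = 0
    · simp [hy]
    · by_contra! hlt
      exact absurd ((lowerNorm_le_iff hn _ _).2 ⟨y, hy, hlt.le⟩) (hcon k).not_ge
  have h1 : HasSum (fun k => ∑ i ∈ Finset.range n, ‖F i k‖ ^ 2)
      (∑ i ∈ Finset.range n, ‖F i‖ ^ 2) := hasSum_sum fun i _ => hasSum_norm_sq (F i)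
  have h2 : ∀ i : ℕ, HasSum (fun k : ℤ => V (i + 1) ^ 2 * ‖x (k + i)‖ ^ 2)
      (V (i + 1) ^ 2 * ‖x‖ ^ 2) := fun i =>
    HasSum.mul_left (V (i + 1) ^ 2) (hasSum_norm_sq_shift x (i : ℤ))
  have h2' : HasSum (fun k : ℤ => ∑ i ∈ Finset.range n, V (i + 1) ^ 2 * ‖x (k + i)‖ ^ 2)
      (∑ i ∈ Finset.range n, V (i + 1) ^ 2 * ‖x‖ ^ 2) := hasSum_sum fun i _ => h2 i
  have h3 := (hasSum_le hk (h2'.mul_left (c ^ 2)) h1).trans hFS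
  rw [← Finset.sum_mul, ← hS, mul_assoc _ S] at h3
  have h4 : (r + (p + q) * sineRate n) ^ 2 < c ^ 2 :=
    pow_lt_pow_left₀ hc (add_nonneg hr (mul_nonneg (add_nonneg hp0 hq0) hσ.le)) two_ne_zero
  exact h4.not_ge (le_of_mul_le_mul_right h3 (mul_pos hS0 (pow_pos hx0 2)))

/-! ### Inclusions between the spectrum and the finite approximations -/

theorem exists_word_near {f : ℕ → ℂ} {L : List ℂ} {η : ℝ} (h : ∀ j, ∃ w ∈ L, ‖w - f j‖ ≤ η)
    (n : ℕ) : ∃ a ∈ words L n, ∀ i < n,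
      ‖a.getD i 0 - (List.ofFn fun j : Fin n => f j).getD i 0‖ ≤ η := by
  choose g hg hgf using h
  refine ⟨List.ofFn fun j : Fin n => g j, mem_words.2 ⟨by simp, ?_⟩, fun i hi => ?_⟩
  · intro a ha
    obtain ⟨j, rfl⟩ := (List.mem_ofFn' _ _).1 ha
    exact hg _
  · rw [getD_ofFn hi, getD_ofFn hi]
    exact hgf i

/-- A window is chosen first and its entries are then rounded to the nets, at a cost of `η` per
diagonal. The slack `s` is needed because the infimum over vectors need not be attained; half of it
goes to the approximate eigenvector. -/
theorem exists_words_lowerNorm_le {A : E →L[ℂ] E} (hA : IsTridiagonal A) {p q : ℝ}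
    (hp : ∀ j, ‖subdiag A j‖ ≤ p) (hq : ∀ j, ‖superdiag A j‖ ≤ q) {z : ℂ}
    (hz : LowerBoundLE A z 0) {n : ℕ} (hn : 0 < n) {t : ℂ} (ht : ‖t‖ = 1) {La Lb Lc : List ℂ}
    {η s : ℝ} (hs : 0 < s)
    (ha : ∀ j, ∃ w ∈ La, ‖w - subdiag A j‖ ≤ η) (hb : ∀ j, ∃ w ∈ Lb, ‖w - diagonal A j‖ ≤ η)
    (hc : ∀ j, ∃ w ∈ Lc, ‖w - superdiag A j‖ ≤ η) :
    ∃ a ∈ words La n, ∃ b ∈ words Lb n, ∃ c ∈ words Lc n,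
      lowerNorm (perMatrix n t a b c - z • (1 : Matrix (Fin n) (Fin n) ℂ)) ≤
        (p + q) * (22 / (7 * n)) + s + 3 * η := by
  have hp0 : 0 ≤ p := (norm_nonneg _).trans (hp 0)
  have hq0 : 0 ≤ q := (norm_nonneg _).trans (hq 0)
  obtain ⟨x, hx, hxr⟩ := hz (s / 2) (by positivity)
  have hσ : (p + q) * sineRate n ≤ (p + q) * (22 / (7 * n)) :=
    mul_le_mul_of_nonneg_left (sineRate_le hn) (add_nonneg hp0 hq0)
  obtain ⟨k, hk⟩ := exists_window hA hp hq hx (by positivity) hxr hn ht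
    (c := (p + q) * (22 / (7 * n)) + s) (by linarith)
  obtain ⟨a, haw, ha'⟩ := exists_word_near (fun j : ℕ => ha (k + j)) n
  obtain ⟨b, hbw, hb'⟩ := exists_word_near (fun j : ℕ => hb (k + j)) n
  obtain ⟨c, hcw, hc'⟩ := exists_word_near
    (fun j : ℕ => hc (if j + 1 = n then k else k + (j : ℕ) + 1)) n
  refine ⟨a, haw, b, hbw, c, hcw, ?_⟩
  refine (lowerNorm_perMatrix_perturb hn ht (a := windowSub A n k) (b := windowDiag A n k)
    (c := windowSuper A n k) ha' hb' hc' hk z).trans (le_of_eq ?_)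
  simp

theorem subdiag_adjoint (A : E →L[ℂ] E) (j : ℤ) :
    subdiag (ContinuousLinearMap.adjoint A) j = (starRingEnd ℂ) (superdiag A (j + 1)) := by
  rw [subdiag, entry_adjoint, superdiag, add_sub_cancel_right]

theorem diagonal_adjoint (A : E →L[ℂ] E) (j : ℤ) :
    diagonal (ContinuousLinearMap.adjoint A) j = (starRingEnd ℂ) (diagonal A j) := by
  rw [diagonal, entry_adjoint, diagonal]

theorem superdiag_adjoint (A : E →L[ℂ] E) (j : ℤ) :
    superdiag (ContinuousLinearMap.adjoint A) j = (starRingEnd ℂ) (subdiag A (j - 1)) := by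
  rw [superdiag, entry_adjoint, subdiag, sub_add_cancel]

theorem IsTridiagonal.adjoint {A : E →L[ℂ] E} (hA : IsTridiagonal A) :
    IsTridiagonal (ContinuousLinearMap.adjoint A) := fun i j hij => by
  rw [entry_adjoint, hA j i (by rwa [abs_sub_comm]), map_zero]

theorem exists_conj_near {L : List ℂ} {v : ℂ} {η : ℝ} (h : ∃ w ∈ L, ‖w - v‖ ≤ η) :
    ∃ w ∈ L.map (starRingEnd ℂ), ‖w - (starRingEnd ℂ) v‖ ≤ η := by
  obtain ⟨w, hw, hv⟩ := h
  exact ⟨_, List.mem_map_of_mem hw, by rwa [← map_sub, RCLike.norm_conj]⟩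

theorem map_conj_mem_words {L : List ℂ} {n : ℕ} {w : List ℂ}
    (h : w ∈ words (L.map (starRingEnd ℂ)) n) : w.map (starRingEnd ℂ) ∈ words L n := by
  rw [mem_words] at h ⊢
  refine ⟨by simpa using h.1, fun a ha => ?_⟩
  obtain ⟨b, hb, rfl⟩ := List.mem_map.1 ha
  obtain ⟨d, hd, rfl⟩ := List.mem_map.1 (h.2 b hb)
  simpa using hd

/-- If the approximate eigenvectors belong to the adjoint, the construction is run for it with
conjugated nets and exchanged off-diagonals, and the resulting matrix is conjugate transposed back.
-/
theorem exists_words_of_mem_spectrum {A : E →L[ℂ] E} (hA : IsTridiagonal A) {p q : ℝ}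
    (hp : ∀ j, ‖subdiag A j‖ ≤ p) (hq : ∀ j, ‖superdiag A j‖ ≤ q) {z : ℂ}
    (hz : z ∈ spectrum ℂ A) {n : ℕ} (hn : 0 < n) {t : ℂ} (ht : ‖t‖ = 1) {La Lb Lc : List ℂ}
    {η s : ℝ} (hs : 0 < s)
    (ha : ∀ j, ∃ w ∈ La, ‖w - subdiag A j‖ ≤ η) (hb : ∀ j, ∃ w ∈ Lb, ‖w - diagonal A j‖ ≤ η)
    (hc : ∀ j, ∃ w ∈ Lc, ‖w - superdiag A j‖ ≤ η) :
    ∃ a ∈ words La n, ∃ b ∈ words Lb n, ∃ c ∈ words Lc n,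
      lowerNorm (perMatrix n t a b c - z • (1 : Matrix (Fin n) (Fin n) ℂ)) ≤
        (p + q) * (22 / (7 * n)) + s + 3 * η := by
  rcases lowerBoundLE_of_mem_spectrum hz with h | h
  · exact exists_words_lowerNorm_le hA hp hq h hn ht hs ha hb hc
  · have hp0 : 0 ≤ p := (norm_nonneg _).trans (hp 0)
    have hq0 : 0 ≤ q := (norm_nonneg _).trans (hq 0)
    have hη : 0 ≤ η := by
      obtain ⟨w, -, hw⟩ := ha 0
      exact (norm_nonneg _).trans hw
    obtain ⟨a, haw, b, hbw, c, hcw, hle⟩ := exists_words_lowerNorm_le hA.adjoint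
      (p := q) (q := p) (fun j => by rw [subdiag_adjoint, RCLike.norm_conj]; exact hq _)
      (fun j => by rw [superdiag_adjoint, RCLike.norm_conj]; exact hp _) h hn ht hs
      (La := Lc.map (starRingEnd ℂ)) (Lb := Lb.map (starRingEnd ℂ)) (Lc := La.map (starRingEnd ℂ))
      (η := η) (fun j => by rw [subdiag_adjoint]; exact exists_conj_near (hc _))
      (fun j => by rw [diagonal_adjoint]; exact exists_conj_near (hb _))
      (fun j => by rw [superdiag_adjoint]; exact exists_conj_near (ha _))
    refine ⟨_, map_conj_mem_words hcw, _, map_conj_mem_words hbw, _, map_conj_mem_words haw, ?_⟩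
    have h1 := lowerNorm_conjTranspose_le hn (by positivity) hle
    rw [Matrix.conjTranspose_sub, Matrix.conjTranspose_smul, Matrix.conjTranspose_one,
      perMatrix_conjTranspose] at h1
    simpa [add_comm q p] using h1

/-- The distance to a finite set is attained; the empty list is excluded since its distance would be
infinite. -/
theorem IsNet.exists_near {n : ℕ} {S : Set ℂ} {L : List ℂ} (h : IsNet n S (listSet L)) {v : ℂ}
    (hv : v ∈ S) : ∃ w ∈ L, ‖w - v‖ ≤ 1 / (3 * n) := by
  have h1 : Metric.infEDist v (listSet L) ≤ ENNReal.ofReal (1 / (3 * n)) :=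
    (Metric.infEDist_le_hausdorffEDist_of_mem hv).trans h.2
  have hne : (listSet L).Nonempty := by
    rw [Set.nonempty_iff_ne_empty]
    intro h0
    rw [h0, Metric.infEDist_empty] at h1
    exact absurd h1 (not_le.2 ENNReal.ofReal_lt_top)
  have hfin : (listSet L).Finite := L.finite_toSet
  obtain ⟨w, hw, he⟩ := hfin.isCompact.exists_infEDist_eq_edist hne v
  refine ⟨w, hw, ?_⟩
  rw [he, edist_comm, edist_dist, ENNReal.ofReal_le_ofReal_iff (by positivity)] at h1
  rwa [← dist_eq_norm]

theorem norm_le_radius {A : E →L[ℂ] E} (hA : IsTridiagonal A) {b : Bounds}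
    (ha : ∀ j, ‖subdiag A j‖ ≤ b.α) (hb : ∀ j, ‖diagonal A j‖ ≤ b.β)
    (hc : ∀ j, ‖superdiag A j‖ ≤ b.γ) : ‖A‖ ≤ b.radius := by
  have h0a : 0 ≤ b.α := (norm_nonneg _).trans (ha 0)
  have h0b : 0 ≤ b.β := (norm_nonneg _).trans (hb 0)
  have h0c : 0 ≤ b.γ := (norm_nonneg _).trans (hc 0)
  refine ContinuousLinearMap.opNorm_le_bound _ (by unfold Bounds.radius; positivity) fun x => ?_
  refine norm_le_of_forall_three_term h0a h0b h0c fun i => ?_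
  rw [hA.apply]
  refine norm_add₃_le.trans ?_
  rw [norm_mul, norm_mul, norm_mul]
  gcongr
  · exact ha _
  · exact hb _
  · exact hc _

section inclusions

variable {t : ℂ} {n : ℕ} {A : PsErg} {b : Bounds} {s : Nets}

/-- The bounds are valid for `A`. -/
def IsBound (A : PsErg) (b : Bounds) : Prop :=
  (∀ j : ℤ, ‖subdiag A.1 j‖ ≤ b.α) ∧ (∀ j : ℤ, ‖diagonal A.1 j‖ ≤ b.β) ∧
    (∀ j : ℤ, ‖superdiag A.1 j‖ ≤ b.γ) ∧ 0 < b.radius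

/-- The lists are `1 / (3 n)`-nets for `A`. -/
def IsNets (A : PsErg) (n : ℕ) (s : Nets) : Prop :=
  IsNet n A.Sα (listSet s.α) ∧ IsNet n A.Sβ (listSet s.β) ∧ IsNet n A.Sγ (listSet s.γ)

theorem IsBound.add_nonneg (hb : IsBound A b) : 0 ≤ b.α + b.γ :=
  _root_.add_nonneg ((norm_nonneg _).trans (hb.1 0)) ((norm_nonneg _).trans (hb.2.2.1 0))

theorem IsBound.eps_nonneg (hb : IsBound A b) (n : ℕ) : 0 ≤ b.epsDag n + 3 / (n : ℝ) := by
  have := hb.add_nonneg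
  unfold Bounds.epsDag
  positivity

theorem exists_mem_piFin_near (ht : ‖t‖ = 1) (hn : 0 < n) (hb : IsBound A b) (hs : IsNets A n s)
    {z : ℂ} (hz : z ∈ Spec A) : ∃ w ∈ piFin t n b s, ‖z - w‖ ≤ 3 / 2 / n := by
  obtain ⟨Sα, Sβ, Sγ, hA⟩ := A.2
  have hn' : (0 : ℝ) < n := by exact_mod_cast hn
  have hzr : ‖z‖ ≤ b.radius := (spectrum.norm_le_norm_of_mem hz).trans
    (norm_le_radius hA.tridiagonal hb.1 hb.2.1 hb.2.2.1)
  obtain ⟨w, hw, hzw⟩ := exists_grid_near hn hb.2.2.2 hzr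
  refine ⟨w, ⟨?_, hw⟩, hzw⟩
  obtain ⟨a, ha, b', hb', c, hc, hle⟩ := exists_words_of_mem_spectrum hA.tridiagonal hb.1 hb.2.2.1
    hz hn ht (s := 1 / (2 * n)) (by positivity)
    (fun j => hs.1.exists_near (subset_closure (Set.mem_range_self j)))
    (fun j => hs.2.1.exists_near (subset_closure (Set.mem_range_self j)))
    (fun j => hs.2.2.exists_near (subset_closure (Set.mem_range_self j)))
  refine ⟨_, (mem_periodisedMatrices_iff hn).2 ⟨a, ha, b', hb', c, hc, rfl⟩, ?_⟩
  refine (lowerNorm_perMatrix_perturb hn ht (a' := a) (b' := b') (c' := c) (η := 0)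
    (fun i _ => by simp) (fun i _ => by simp) (fun i _ => by simp) hle w).trans ?_
  -- The error budget: slack, three roundings to the nets, and the move from `z` to the grid point.
  have h1 : 1 / (2 * n) + 3 * (1 / (3 * n)) + 3 / 2 / n = 3 / (n : ℝ) := by
    field_simp
    norm_num
  unfold Bounds.epsDag
  linarith

theorem spec_subset_piHat (ht : ‖t‖ = 1) (hn : 0 < n) (hb : IsBound A b) (hs : IsNets A n s) :
    Spec A ⊆ piHat t n b s := fun z hz => by
  obtain ⟨w, hw, hzw⟩ := exists_mem_piFin_near ht hn hb hs hz
  exact ⟨w, hw, hzw.trans (by gcongr; norm_num)⟩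

theorem piFin_subset_closedPseudospectrum (ht : ‖t‖ = 1) (hn : 0 < n) (hb : IsBound A b)
    (hs : IsNets A n s) : piFin t n b s ⊆ closedPseudospectrum (b.epsDag n + 3 / (n : ℝ)) A.1 := by
  rintro z ⟨⟨B, hB, hle⟩, -⟩
  obtain ⟨Sα, Sβ, Sγ, hA⟩ := A.2
  obtain ⟨a, ha, b', hb', c, hc, rfl⟩ := (mem_periodisedMatrices_iff hn).1 hB
  have hmem : ∀ {L l : List ℂ} {S S' : Set ℂ}, S ⊆ S' → IsNet n S (listSet L) → l ∈ words L n →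
      ∀ i < n, l.getD i 0 ∈ S' := by
    intro L l S S' hSS hS hl i hi
    rw [mem_words] at hl
    rw [List.getD_eq_getElem _ _ (by omega)]
    exact hSS (hS.1 (hl.2 _ (List.getElem_mem _)))
  refine (mem_closedPseudospectrum_iff (hb.eps_nonneg n)).2 (Or.inl ?_)
  -- The net points lie in the closures of the entries, and these lie in the given sets, which are
  -- compact and hence closed.
  refine hA.lowerBoundLE_of_perMatrix hn ht (hmem ?_ hs.1 ha) (hmem ?_ hs.2.1 hb')
    (hmem ?_ hs.2.2 hc) hle
  · exact closure_minimal (Set.range_subset_iff.2 fun j => (hA.entries_mem j).1)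
      hA.compact.1.isClosed
  · exact closure_minimal (Set.range_subset_iff.2 fun j => (hA.entries_mem j).2.1)
      hA.compact.2.1.isClosed
  · exact closure_minimal (Set.range_subset_iff.2 fun j => (hA.entries_mem j).2.2)
      hA.compact.2.2.isClosed

theorem addDisc_mono {S T : Set ℂ} (h : S ⊆ T) (r : ℝ) : addDisc S r ⊆ addDisc T r :=
  fun _ ⟨w, hw, hz⟩ => ⟨w, h hw, hz⟩

/-- One direction comes from the pseudospectral inclusion, with up to `2 / n` for fattening; the
other from a finite-set point within `3 / (2 n)` of each spectral point. -/
theorem hausdorffEDist_pi_le (ht : ‖t‖ = 1) (hn : 0 < n) (hb : IsBound A b) (hs : IsNets A n s)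
    {d : ℝ} (hd : 0 ≤ d)
    (h : closedPseudospectrum (b.epsDag n + 3 / (n : ℝ)) A.1 ⊆ addDisc (Spec A) d) :
    Metric.hausdorffEDist (piFin t n b s) (Spec A) ≤ ENNReal.ofReal (d + 2 / n) ∧
      Metric.hausdorffEDist (piHat t n b s) (Spec A) ≤ ENNReal.ofReal (d + 2 / n) := by
  have hn' : (0 : ℝ) < n := by exact_mod_cast hn
  have hed : ∀ {x y : ℂ} {r : ℝ}, ‖x - y‖ ≤ r → edist x y ≤ ENNReal.ofReal r := by
    intro x y r hxy
    rw [edist_dist, dist_eq_norm]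
    exact ENNReal.ofReal_le_ofReal hxy
  have hnear := fun z (hz : z ∈ Spec A) => exists_mem_piFin_near ht hn hb hs hz
  have h2 : 3 / 2 / (n : ℝ) ≤ 2 / n := by gcongr; norm_num
  have h0 : 0 < 2 / (n : ℝ) := by positivity
  constructor
  · refine Metric.hausdorffEDist_le_of_mem_edist (fun z hz => ?_) fun z hz => ?_
    · obtain ⟨w, hw, hzw⟩ := h (piFin_subset_closedPseudospectrum ht hn hb hs hz)
      exact ⟨w, hw, hed (by linarith)⟩
    · obtain ⟨w, hw, hzw⟩ := hnear z hz
      exact ⟨w, hw, hed (by linarith)⟩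
  · refine Metric.hausdorffEDist_le_of_mem_edist (fun z hz => ?_) fun z hz => ?_
    · obtain ⟨v, hv, hzv⟩ := hz
      obtain ⟨w, hw, hvw⟩ := h (piFin_subset_closedPseudospectrum ht hn hb hs hv)
      refine ⟨w, hw, hed ?_⟩
      have := norm_sub_le_norm_sub_add_norm_sub z v w
      linarith
    · exact ⟨z, spec_subset_piHat ht hn hb hs hz, by simp⟩

theorem spec_nonempty (A : PsErg) : (Spec A).Nonempty := spectrum.nonempty A.1

theorem piFin_nonempty (ht : ‖t‖ = 1) (hn : 0 < n) (hb : IsBound A b) (hs : IsNets A n s) :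
    (piFin t n b s).Nonempty := by
  obtain ⟨z, hz⟩ := spec_nonempty A
  obtain ⟨w, hw, -⟩ := exists_mem_piFin_near ht hn hb hs hz
  exact ⟨w, hw⟩

end inclusions

/-! ### Rates of convergence uniform in the operator -/

theorem closedPseudospectrum_mono (A : E →L[ℂ] E) {e e' : ℝ} (h : e ≤ e') :
    closedPseudospectrum e A ⊆ closedPseudospectrum e' A := fun _ hz => le_trans hz h

theorem LowerBoundLE.norm_le {T : E →L[ℂ] E} {z : ℂ} {c : ℝ} (h : LowerBoundLE T z c) :
    ‖z‖ ≤ ‖T‖ + (c + 1) := by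
  obtain ⟨u, hu, hle⟩ := h (c + 1) (by linarith)
  have h0 : 0 < ‖u‖ := norm_pos_iff.2 hu
  have h1 : ‖z‖ * ‖u‖ ≤ (‖T‖ + (c + 1)) * ‖u‖ := by
    have h2 := norm_sub_norm_le (z • u) (T u)
    rw [norm_sub_rev, norm_smul] at h2
    have h3 := T.le_opNorm u
    linarith
  exact le_of_mul_le_mul_right h1 h0

/-- A crude bound from boundedness, making the admissible radii a nonempty set for every `n`, not
only for large `n`. -/
theorem exists_closedPseudospectrum_subset_addDisc (A : E →L[ℂ] E) {r : ℝ} (hr : 0 ≤ r) :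
    ∃ d, 0 ≤ d ∧ closedPseudospectrum r A ⊆ addDisc (spectrum ℂ A) d := by
  obtain ⟨w, hw⟩ := spectrum.nonempty A
  refine ⟨‖A‖ + (r + 1) + ‖w‖, by positivity, fun z hz => ⟨w, hw, ?_⟩⟩
  refine (norm_sub_le _ _).trans (add_le_add ?_ le_rfl)
  rcases (mem_closedPseudospectrum_iff hr).1 hz with h | h
  · exact h.norm_le
  · have := h.norm_le
    rwa [RCLike.norm_conj, LinearIsometryEquiv.norm_map] at this

theorem addDisc_mono_right (S : Set ℂ) {r r' : ℝ} (h : r ≤ r') : addDisc S r ⊆ addDisc S r' :=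
  fun _ ⟨w, hw, hz⟩ => ⟨w, hw, hz.trans h⟩

/-- Pseudospectra with parameters tending to zero converge to the spectrum. -/
theorem exists_tendsto_closedPseudospectrum_subset (A : E →L[ℂ] E) {e : ℕ → ℝ}
    (he : Tendsto e atTop (𝓝 0)) (he0 : ∀ n, 0 ≤ e n) : ∃ d : ℕ → ℝ, Tendsto d atTop (𝓝 0) ∧
      ∀ n, 0 ≤ d n ∧ closedPseudospectrum (e n) A ⊆ addDisc (spectrum ℂ A) (d n) := by
  let T : ℕ → Set ℝ := fun n =>
    {d | 0 ≤ d ∧ closedPseudospectrum (e n) A ⊆ addDisc (spectrum ℂ A) d}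
  have hT : ∀ n, (T n).Nonempty := fun n =>
    exists_closedPseudospectrum_subset_addDisc A (he0 n)
  have hTb : ∀ n, BddBelow (T n) := fun n => ⟨0, fun _ h => h.1⟩
  have hT0 : ∀ n, 0 ≤ sInf (T n) := fun n => Real.sInf_nonneg fun _ h => h.1
  -- The extra term tends to zero and avoids asking whether the infimum is attained.
  refine ⟨fun n => sInf (T n) + 1 / ((n : ℝ) + 1), ?_, fun n => ?_⟩
  · have h1 : Tendsto (fun n => sInf (T n)) atTop (𝓝 0) := by
      rw [Metric.tendsto_atTop]
      intro η hη
      obtain ⟨ε, hε, hsub⟩ := exists_closedPseudospectrum_subset A (half_pos hη)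
      obtain ⟨N, hN⟩ := eventually_atTop.1 (he.eventually (gt_mem_nhds hε))
      refine ⟨N, fun n hn => ?_⟩
      rw [Real.dist_eq, sub_zero, abs_of_nonneg (hT0 n)]
      refine lt_of_le_of_lt (csInf_le (hTb n) ⟨(half_pos hη).le, ?_⟩) (half_lt_self hη)
      exact (closedPseudospectrum_mono A (hN n hn).le).trans hsub
    simpa using h1.add tendsto_one_div_add_atTop_nhds_zero_nat
  · have hpos : 0 < 1 / ((n : ℝ) + 1) := by positivity
    refine ⟨add_nonneg (hT0 n) hpos.le, ?_⟩
    obtain ⟨d, hd, hlt⟩ := exists_lt_of_csInf_lt (hT n) (lt_add_of_pos_right (sInf (T n)) hpos)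
    exact hd.2.trans (addDisc_mono_right _ hlt.le)

/-- Pseudospectra depend only on the three sets, so the rate of one reference operator `A₀` serves
all of them; if there is none, nothing needs proof. Replacing `C` by `max C 0` keeps the parameters
nonnegative. -/
theorem exists_tendsto_hausdorffEDist_pi_le (Sα Sβ Sγ : Set ℂ) (C : ℝ) :
    ∃ δ : ℕ → ℝ, Tendsto δ atTop (𝓝 0) ∧
      ∀ (t : ℂ) (A : PsErg) (n : ℕ) (b : Bounds) (s : Nets), ‖t‖ = 1 → 0 < n → IsBound A b →
        IsNets A n s → PseudoergodicWrt A.1 Sα Sβ Sγ → b.α + b.γ ≤ C →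
          Metric.hausdorffEDist (piFin t n b s) (Spec A) ≤ ENNReal.ofReal (δ n) ∧
            Metric.hausdorffEDist (piHat t n b s) (Spec A) ≤ ENNReal.ofReal (δ n) := by
  by_cases hex : ∃ A : PsErg, PseudoergodicWrt A.1 Sα Sβ Sγ
  · obtain ⟨A₀, hA₀⟩ := hex
    let e : ℕ → ℝ := fun n => max C 0 * (22 / (7 * (n : ℝ))) + 3 / n
    have hinv : Tendsto (fun n : ℕ => (n : ℝ)⁻¹) atTop (𝓝 0) := tendsto_inv_atTop_nhds_zero_nat
    have he : Tendsto e atTop (𝓝 0) := by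
      have h := hinv.const_mul (max C 0 * (22 / 7) + 3)
      rw [mul_zero] at h
      refine h.congr fun n => ?_
      simp only [e, div_eq_mul_inv, mul_inv]
      ring
    have he0 : ∀ n, 0 ≤ e n := fun n => by positivity
    obtain ⟨d, hd, hsub⟩ := exists_tendsto_closedPseudospectrum_subset A₀.1 he he0
    refine ⟨fun n => d n + 2 / n, ?_, ?_⟩
    · have h := hd.add (hinv.const_mul 2)
      rw [mul_zero, add_zero] at h
      exact h.congr fun n => by rw [div_eq_mul_inv]
    · intro t A n b s ht hn hb hs hA hC
      refine hausdorffEDist_pi_le ht hn hb hs (hsub n).1 ?_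
      have h1 : b.epsDag n + 3 / (n : ℝ) ≤ e n := by
        have : b.α + b.γ ≤ max C 0 := hC.trans (le_max_left _ _)
        simp only [e, Bounds.epsDag]
        gcongr
      have h2 : Spec A = spectrum ℂ A₀.1 := by
        rw [Spec, ← closedPseudospectrum_zero, ← closedPseudospectrum_zero,
          hA.closedPseudospectrum_eq hA₀ le_rfl]
      rw [h2]
      refine (closedPseudospectrum_mono A.1 h1).trans ?_
      rw [hA.closedPseudospectrum_eq hA₀ (he0 n)]
      exact (hsub n).2
  · exact ⟨fun _ => 0, tendsto_const_nhds, fun t A n b s _ _ _ _ hA => (hex ⟨A, hA⟩).elim⟩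

theorem hConv_of_le {S : ℕ → Set ℂ} {T : Set ℂ} {δ : ℕ → ℝ} (hδ : Tendsto δ atTop (𝓝 0))
    (h : ∀ n, 0 < n → Metric.hausdorffEDist (S n) T ≤ ENNReal.ofReal (δ n)) : HConv S T := by
  have h0 : Tendsto (fun n => ENNReal.ofReal (δ n)) atTop (𝓝 0) := by
    simpa using ENNReal.tendsto_ofReal hδ
  refine tendsto_of_tendsto_of_tendsto_of_le_of_le' tendsto_const_nhds h0
    (Eventually.of_forall fun _ => zero_le) ?_
  filter_upwards [eventually_gt_atTop 0] with n hn using h n hn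

/-! ### Towers of algorithms -/

theorem addDisc_zero (S : Set ℂ) : addDisc S 0 = S := by
  ext z
  refine ⟨fun ⟨w, hw, h⟩ => ?_, fun h => ⟨z, h, by simp⟩⟩
  rw [norm_le_zero_iff, sub_eq_zero] at h
  rwa [h]

theorem Halts.zero {O : ℕ → RData} {x : RData} :
    Halts O (.comp (.pair .one .one) .sub) x (.num 0) := by
  have h := (Halts.one (O := O) (x := x)).pair Halts.one |>.comp (Halts.sub 1 1)
  rwa [sub_self] at h

theorem isArithmeticTower_addDisc {Bd : PsErg → Bounds} {Nt : PsErg → ℕ → Nets} {t : ℂ}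
    (ht : ‖t‖ = 1) (hBd : ∀ A, IsBound A (Bd A)) (hNt : ∀ A n, 0 < n → IsNets A n (Nt A n))
    {ρ : ℕ → ℝ} (hρ : ∀ n, 0 ≤ ρ n) {q : Prog}
    (hq : ∀ O (n : ℕ) c, 0 < n → Halts O q (.pair (.num n) c) (.num (ρ n))) :
    IsArithmeticTower (evaluations Bd Nt)
      (fun n A => addDisc (piFin t n (Bd A) (Nt A n)) (ρ n)) := by
  obtain ⟨p, hp⟩ := exists_prog_piFin
  -- The phase `t` is stored as a machine constant; the oracle is queried at `0` for the bounds and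
  -- at `n` for the nets.
  refine ⟨.pair q (.comp (.pair .fst (.pair .snd
    (.pair (.comp (.comp (.pair .one .one) .sub) .query) (.comp .fst .query)))) p),
    encComplex t, fun A n hn => ?_⟩
  have hz : Halts (fun k => evaluations Bd Nt k A) (.comp (.comp (.pair .one .one) .sub) .query)
      (.pair (.num n) (encComplex t)) (encBounds (Bd A)) := by
    have h := Halts.query (O := fun k => evaluations Bd Nt k A) 0
    rw [Nat.cast_zero] at h
    exact Halts.zero.comp h
  have hk : Halts (fun k => evaluations Bd Nt k A) (.comp .fst .query)
      (.pair (.num n) (encComplex t)) (encNets (Nt A n)) := by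
    have h := Halts.query (O := fun k => evaluations Bd Nt k A) n
    simp only [evaluations, if_neg hn.ne'] at h
    exact Halts.fst.comp h
  obtain ⟨N, hN⟩ := (hq _ n (encComplex t) hn).pair
    ((Halts.fst.pair (Halts.snd.pair (hz.pair hk))).comp (hp _ n t (Bd A) (Nt A n)))
  refine ⟨_, N, hN, ρ n, _, hρ n, ?_, rfl, ?_⟩
  · obtain ⟨z, hz⟩ := piFin_nonempty ht hn (hBd A) (hNt A n hn)
    rw [← listSet_piFinList hn t (Bd A) (Nt A n) (hBd A).2.2.2 (hBd A).add_nonneg] at hz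
    exact List.ne_nil_of_mem hz
  · rw [listSet_piFinList hn t (Bd A) (Nt A n) (hBd A).2.2.2 (hBd A).add_nonneg]

theorem isArithmeticTower_piFin {Bd : PsErg → Bounds} {Nt : PsErg → ℕ → Nets} {t : ℂ}
    (ht : ‖t‖ = 1) (hBd : ∀ A, IsBound A (Bd A)) (hNt : ∀ A n, 0 < n → IsNets A n (Nt A n)) :
    IsArithmeticTower (evaluations Bd Nt) (fun n A => piFin t n (Bd A) (Nt A n)) := by
  simpa only [addDisc_zero] using isArithmeticTower_addDisc ht hBd hNt (ρ := fun _ => 0)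
    (fun _ => le_rfl) (fun _ _ _ _ => Halts.zero)

theorem isArithmeticTower_piHat {Bd : PsErg → Bounds} {Nt : PsErg → ℕ → Nets} {t : ℂ}
    (ht : ‖t‖ = 1) (hBd : ∀ A, IsBound A (Bd A)) (hNt : ∀ A n, 0 < n → IsNets A n (Nt A n)) :
    IsArithmeticTower (evaluations Bd Nt) (fun n A => piHat t n (Bd A) (Nt A n)) := by
  refine isArithmeticTower_addDisc ht hBd hNt (ρ := fun n => 2 / (n : ℝ)) (fun _ => by positivity)
    (q := .comp (.pair (.comp (.pair .one .one) .add) .fst) .div) fun O n c hn => ?_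
  have h1 : Halts O (.comp (.pair .one .one) .add) (.pair (.num n) c) (.num 2) := by
    have h := (Halts.one (O := O) (x := .pair (.num n) c)).pair Halts.one |>.comp (Halts.add 1 1)
    rwa [one_add_one_eq_two] at h
  exact (h1.pair Halts.fst).comp (Halts.div _ _ (by positivity))

theorem isCompact_piHat {t : ℂ} {n : ℕ} (hn : 0 < n) {A : PsErg} {b : Bounds} {s : Nets}
    (hb : IsBound A b) : IsCompact (piHat t n b s) := by
  have h : piHat t n b s = ⋃ w ∈ piFin t n b s, Metric.closedBall w (2 / n) := by
    ext z
    simp [piHat, addDisc, dist_eq_norm]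
  rw [h, ← listSet_piFinList hn t b s hb.2.2.2 hb.add_nonneg]
  exact (List.finite_toSet _).isCompact_biUnion fun _ _ => isCompact_closedBall _ _

/-! ### The bilateral shift -/

/-- The bilateral shift. -/
def bilateralShift : E →L[ℂ] E := (shiftE (-1)).toContinuousLinearEquiv

theorem bilateralShift_apply (v : E) (i : ℤ) : bilateralShift v i = v (i + -1) := rfl

theorem entry_bilateralShift (i j : ℤ) : entry bilateralShift i j = if i = j + 1 then 1 else 0 := by
  rw [entry, bilateralShift_apply, lp.single_apply, Pi.single_apply]
  exact if_congr (by omega) rfl rfl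

/-- With singletons there is only one admissible tridiagonal matrix of each size, and every window
equals it. -/
theorem pseudoergodicWrt_bilateralShift : PseudoergodicWrt bilateralShift {1} {0} {0} where
  tridiagonal i j hij := by
    rw [entry_bilateralShift, if_neg]
    rintro rfl
    simp at hij
  compact := ⟨isCompact_singleton, isCompact_singleton, isCompact_singleton⟩
  nonempty := ⟨Set.singleton_nonempty _, Set.singleton_nonempty _, Set.singleton_nonempty _⟩
  entries_mem j := by
    simp [subdiag, diagonal, superdiag, entry_bilateralShift]
    omega
  approx ε hε n _ B hB := by
    refine ⟨0, ?_⟩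
    have : finiteSection bilateralShift n 0 - B = 0 := by
      ext i j
      obtain ⟨h1, h2, h3, h4⟩ := hB i j
      rw [Matrix.sub_apply, Matrix.zero_apply, sub_eq_zero, finiteSection, Matrix.of_apply,
        entry_bilateralShift]
      by_cases c1 : (i : ℕ) = j + 1
      · rw [if_pos (by omega), Set.mem_singleton_iff.1 (h1 c1)]
      · rw [if_neg (by omega)]
        by_cases c2 : i = j
        · exact (Set.mem_singleton_iff.1 (h2 c2)).symm
        · by_cases c3 : (j : ℕ) = i + 1
          · exact (Set.mem_singleton_iff.1 (h3 c3)).symm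
          · exact (h4 c1 c2 c3).symm
    rw [this]
    unfold matOp
    rwa [map_zero, norm_zero]

/-- Unitarity confines the spectrum to the circle. Conversely, the periodised `1 × 1` matrix with
phase `z` is `z` itself, so its difference with `z` vanishes and the transfer to the operator
applies with error `0`. -/
theorem spectrum_bilateralShift : spectrum ℂ bilateralShift = Metric.sphere 0 1 := by
  refine Set.Subset.antisymm ?_ fun z hz => ?_
  · exact spectrum.subset_circle_of_unitary
      (Unitary.linearIsometryEquiv.symm (shiftE (-1))).2
  · have hz1 : ‖z‖ = 1 := by simpa using hz
    rw [← closedPseudospectrum_zero]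
    refine (mem_closedPseudospectrum_iff le_rfl).2 (Or.inl ?_)
    refine pseudoergodicWrt_bilateralShift.lowerBoundLE_of_perMatrix one_pos hz1
      (a := [1]) (b := [0]) (c := [0]) ?_ ?_ ?_ ?_
    · intro i hi; simp [Nat.lt_one_iff.1 hi]
    · intro i hi; simp [Nat.lt_one_iff.1 hi]
    · intro i hi; simp [Nat.lt_one_iff.1 hi]
    · rw [lowerNorm_le_iff one_pos]
      refine ⟨EuclideanSpace.single 0 1, by simp, ?_⟩
      have : perMatrix 1 z [1] [0] [0] - z • (1 : Matrix (Fin 1) (Fin 1) ℂ) = 0 := by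
        ext i j
        fin_cases i
        fin_cases j
        simp [perMatrix, perEntry]
      rw [this]
      unfold matOp
      simp

/-- With `r = 0` the specified set is finite, unlike the circle. With `r > 0` the points `z`, `z +
r`, `z - r` would all have modulus one, contradicting the parallelogram law. -/
theorem not_specifies_sphere (d : RData) : ¬ Specifies d (Metric.sphere 0 1) := by
  rintro ⟨r, l, hr, hl, -, hS⟩
  rcases hr.eq_or_lt with rfl | hr
  · rw [addDisc_zero] at hS
    have hinf : (Metric.sphere (0 : ℂ) 1).Infinite := by
      refine (isPreconnected_sphere (by rw [Complex.rank_real_complex]; norm_num) 0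
        1).infinite_of_nontrivial
        ⟨1, by simp, -1, by simp, by norm_num⟩
    rw [hS] at hinf
    exact hinf (List.finite_toSet l)
  · obtain ⟨z, hz⟩ := List.exists_mem_of_ne_nil l hl
    have hmem : ∀ w : ℂ, ‖w‖ ≤ r → ‖z + w‖ = 1 := by
      intro w hw
      have : z + w ∈ Metric.sphere (0 : ℂ) 1 := by
        rw [hS]
        exact ⟨z, hz, by simpa using hw⟩
      simpa using this
    have h0 := hmem 0 (by simpa using hr.le)
    have h1 := hmem r (by simp [abs_of_pos hr])
    have h2 := hmem (-r) (by simp [abs_of_pos hr])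
    have h3 := parallelogram_law_with_norm ℝ z (r : ℂ)
    rw [add_zero] at h0
    rw [← sub_eq_add_neg] at h2
    rw [h1, h2, h0, Complex.norm_real, Real.norm_of_nonneg hr.le] at h3
    nlinarith

/-- The obstruction is the output format, not the information available: no string specifies the
spectrum of the shift, so the evaluations are arbitrary here. -/
theorem not_arithmeticIndexZero (Λ : ℕ → PsErg → RData) : ¬ ArithmeticIndexZero Spec Λ := by
  rintro ⟨p, c, h⟩
  obtain ⟨d, N, -, hd⟩ := h ⟨bilateralShift, _, _, _, pseudoergodicWrt_bilateralShift⟩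
  refine not_specifies_sphere d ?_
  rw [← spectrum_bilateralShift]
  exact hd

end TridiagSpec

end

/-! ### Assembly of the four assertions -/

open TridiagSpec
theorem proposition8p6 :
    -- one program computes the finite sets in finitely many operations from `n`, `t`, the bounds
    -- and the nets
    (∃ p : Prog, ∀ (t : ℂ) (Bd : PsErg → Bounds) (Nt : PsErg → ℕ → Nets),
      ‖t‖ = 1 → IsBoundMap Bd → IsNetMap Nt → ∀ (A : PsErg) (n : ℕ), 0 < n →
        ComputesFiniteSet p (encInput n t (Bd A) (Nt A n)) (piFin t n (Bd A) (Nt A n))) ∧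
    -- convergence and inclusions
    (∀ (t : ℂ) (Bd : PsErg → Bounds) (Nt : PsErg → ℕ → Nets),
      ‖t‖ = 1 → IsBoundMap Bd → IsNetMap Nt → ∀ A : PsErg,
        HConv (fun n => piFin t n (Bd A) (Nt A n)) (Spec A) ∧
        HConv (fun n => piHat t n (Bd A) (Nt A n)) (Spec A) ∧
        ∀ n : ℕ, 0 < n →
          Spec A ⊆ piHat t n (Bd A) (Nt A n) ∧
          piHat t n (Bd A) (Nt A n) ⊆
            addDisc (closedPseudospectrum ((Bd A).epsDag n + 3 / (n : ℝ)) A.1) (2 / (n : ℝ))) ∧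
    -- consequences for the solvability complexity index
    (∀ (t : ℂ) (Bd : PsErg → Bounds) (Nt : PsErg → ℕ → Nets),
      ‖t‖ = 1 → IsBoundMap Bd → IsNetMap Nt →
        IsArithmeticTower (evaluations Bd Nt) (fun n A => piFin t n (Bd A) (Nt A n)) ∧
        IsArithmeticTower (evaluations Bd Nt) (fun n A => piHat t n (Bd A) (Nt A n)) ∧
        InPiOneA Spec (evaluations Bd Nt) ∧
        ArithmeticIndexOne Spec (evaluations Bd Nt)) ∧
    -- uniform convergence over all operators with the same three sets
    (∀ (Sα Sβ Sγ : Set ℂ) (C : ℝ), ∃ δ : ℕ → ℝ, Tendsto δ atTop (𝓝 0) ∧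
      ∀ (t : ℂ) (Bd : PsErg → Bounds) (Nt : PsErg → ℕ → Nets),
        ‖t‖ = 1 → IsBoundMap Bd → IsNetMap Nt → ∀ A : PsErg,
          PseudoergodicWrt A.1 Sα Sβ Sγ → (Bd A).α + (Bd A).γ ≤ C → ∀ n : ℕ, 0 < n →
            Metric.hausdorffEDist (piFin t n (Bd A) (Nt A n)) (Spec A) ≤ ENNReal.ofReal (δ n) ∧
            Metric.hausdorffEDist (piHat t n (Bd A) (Nt A n)) (Spec A) ≤
              ENNReal.ofReal (δ n)) := by
  have hconv : ∀ (t : ℂ) (Bd : PsErg → Bounds) (Nt : PsErg → ℕ → Nets),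
      ‖t‖ = 1 → IsBoundMap Bd → IsNetMap Nt → ∀ A : PsErg,
        HConv (fun n => piFin t n (Bd A) (Nt A n)) (Spec A) ∧
        HConv (fun n => piHat t n (Bd A) (Nt A n)) (Spec A) := by
    intro t Bd Nt ht hBd hNt A
    obtain ⟨Sα, Sβ, Sγ, hA⟩ := A.2
    obtain ⟨δ, hδ, h⟩ := exists_tendsto_hausdorffEDist_pi_le Sα Sβ Sγ ((Bd A).α + (Bd A).γ)
    exact ⟨hConv_of_le hδ fun n hn =>
        (h t A n (Bd A) (Nt A n) ht hn (hBd A) (hNt A n hn) hA le_rfl).1,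
      hConv_of_le hδ fun n hn =>
        (h t A n (Bd A) (Nt A n) ht hn (hBd A) (hNt A n hn) hA le_rfl).2⟩
  refine ⟨?_, ?_, ?_, ?_⟩
  · obtain ⟨p, hp⟩ := exists_prog_piFin
    refine ⟨p, fun t Bd Nt _ hBd _ A n hn => ?_⟩
    obtain ⟨N, hN⟩ := hp (fun _ => RData.nil) n t (Bd A) (Nt A n)
    exact ⟨_, N, hN, listSet_piFinList hn t _ _ (hBd A).2.2.2 (IsBound.add_nonneg (hBd A))⟩
  · intro t Bd Nt ht hBd hNt A
    exact ⟨(hconv t Bd Nt ht hBd hNt A).1, (hconv t Bd Nt ht hBd hNt A).2, fun n hn =>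
      ⟨spec_subset_piHat ht hn (hBd A) (hNt A n hn),
        addDisc_mono (piFin_subset_closedPseudospectrum ht hn (hBd A) (hNt A n hn)) _⟩⟩
  · intro t Bd Nt ht hBd hNt
    have hfin := isArithmeticTower_piFin ht hBd hNt
    have hhat := isArithmeticTower_piHat ht hBd hNt
    -- The fattened sets already contain the spectrum, so they serve both as tower and as enclosing
    -- sets, at distance zero.
    refine ⟨hfin, hhat, ⟨_, fun n A => piHat t n (Bd A) (Nt A n), hhat,
      fun A => (hconv t Bd Nt ht hBd hNt A).2, fun A n hn =>
        ⟨isCompact_piHat hn (hBd A), spec_subset_piHat ht hn (hBd A) (hNt A n hn), ?_⟩⟩,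
      ⟨_, hfin, fun A => (hconv t Bd Nt ht hBd hNt A).1⟩, not_arithmeticIndexZero _⟩
    rw [Metric.hausdorffEDist_self]
    exact zero_le
  · intro Sα Sβ Sγ C
    obtain ⟨δ, hδ, h⟩ := exists_tendsto_hausdorffEDist_pi_le Sα Sβ Sγ C
    exact ⟨δ, hδ, fun t Bd Nt ht hBd hNt A hA hC n hn =>
      h t A n (Bd A) (Nt A n) ht hn (hBd A) (hNt A n hn) hA hC⟩
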